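/- **Setting.** A PDG $\mathfrak M=(\mathcal X,\mathcal A,\mathbb P,\boldsymbol\alpha,\boldsymbol\beta)$ is a finite directed hypergraph whose nodes $\mathcal X$ are variables with finite nonempty value sets and whose arcs $a\in\mathcal A$ carry source and target sets $S_a,T_a\subseteq\mathcal X$, a conditional distribution $p_a(T_a|S_a)$, a number $\alpha_a\in\mathbb R$ and an extended real $\beta_a$. For a joint distribution $\mu$ put $$[\![\mathfrak M]\!]_\gamma(\mu)=\sum_a\beta_a D\big(\mu(T_a,S_a)\,\|\,p_a(T_a|S_a)\mu(S_a)\big)+\gamma\Big(\sum_a\alpha_a H_\mu(T_a|S_a)-H(\mu)\Big),$$ let $\langle\!\langle\mathfrak M\rangle\!\rangle_\gamma=\inf_\mu[\![\mathfrak M]\!]_\gamma(\mu)$ be its inconsistency and $[\![\mathfrak M]\!]^*_\gamma$ the set of minimizers; $[\![\mathfrak M]\!]^*_{0^+}$ is the set of limits of minimizers as $\gamma\to0^+$. $\mathfrak M$ is proper if $\boldsymbol\beta\ge0$ and $\alpha_a>0$ implies $\beta_a>0$. The pair $(\mathfrak M,\gamma)$ is in the *convex range* if $\mathfrak M$ is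 proper and either $\gamma=0^+$ or $0<\gamma<\min_{a:\alpha_a>0}\beta_a/\alpha_a$. $\mathfrak M+(\Pr(U{=}u)=p)$ is $\mathfrak M$ with an additional binary variable, a deterministic arc from $U$ making it the indicator of $U=u$, and an arc without sources asserting that it is true with probability $p$ (both arcs with $\beta=1$, $\alpha=0$). *APPROX-INFER-CVX*: given $(\mathfrak M,\gamma)$ in the convex range, a query $\Pr(Y{=}y|X{=}x)$ and $\epsilon>0$, find $r$ with $|r-\mu^*(Y{=}y|X{=}x)|\le\epsilon$, where $\mu^*$ is the optimal distribution; the query is unconditional if $X=\emptyset$. *APPROX-CALC-INC*: given $\mathfrak M$, $\gamma\ge0$, $\epsilon>0$, find $r$ with $|r-\langle\!\langle\mathfrak M\rangle\!\rangle_\gamma|<\epsilon$. Instances are assumed to have finite inconsistency (at $\gamma=0$ if $\gamma=0^+$) and evidence $X{=}x$ of positive probability under $\mu^*$. $\mathfrak M_1$ is more inconsistent than $\mathfrak M_2$ at $\gamma$ if $\langle\!\langle\mathfrak M_1\rangle\!\rangle_\gamma>\langle\!\langle\mathfrak M_2\rangle\!\rangle_\gamma$; at $0^+$, if this holds for all sufficiently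 small $\gamma>0$. Reductions are programs over real registers with loops and calls to a subroutine that is an arbitrary correct procedure for the problem reduced to; arithmetic operations, comparisons and moves cost one unit of time. **Theorem.** Under these assumptions the optimal distribution $\mu^*$ exists and is unique, and the following hold. The program in (a) and the one in (b) are each a single program, using no logarithms, for all instances, and all constants in $O(\cdot)$ are universal unless said otherwise. (a) Unconditional APPROX-INFER-CVX reduces to the problem of determining which of two PDGs is more inconsistent: there is a program that, given $\epsilon>0$ and calls (of unit cost) that compare $\mathfrak M+(\Pr(Y{=}y)=p)$ with $\mathfrak M+(\Pr(Y{=}y)=q)$ at $\gamma$ for computed $p,q\in[0,1]$, returns a correct answer in time $O(\log(2+1/\epsilon))$ with $O(\log(2+1/\epsilon))$ calls. (b) For real $\gamma>0$, APPROX-INFER-CVX reduces to APPROX-CALC-INC: there is a program that, given $\epsilon$ and $\gamma$ and calls for the $\gamma$-inconsistency of $\mathfrak M+(\Pr(E)=p)$, with $E$ one of the events $X{=}x$ and $X{=}x,Y{=}y$, up to a computed precision, returns a correct answer in time $$O\!\left(\log\frac{2+|\langle\!\langle\mathfrak M\rangle\!\rangle_\gamma|}{\min(\gamma,1)\min(\epsilon,1)\,\mu^*(x)}\cdot\log\frac{2}{\min(\epsilon,1)\,\mu^*(x)}\right)$$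 with $O\!\left(\log\frac{2}{\min(\epsilon,1)}\cdot\log\big(2+\log\frac1{\mu^*(x)}\big)\right)$ calls. Here a call is charged one unit plus the number of binary digits of its answer, before the point and after it up to the requested precision. (c) Conversely, APPROX-CALC-INC, for $\mathfrak M$ proper and $\gamma=0$ or $0<\gamma<\min_{a:\alpha_a>0}\beta_a/\alpha_a$, reduces to (unconditional) APPROX-INFER-CVX, with $\gamma=0^+$ used for $\gamma=0$. Let $(\mathcal C,\mathcal T)$ be a tree decomposition of the hypergraph with a choice of a cluster $C_a\supseteq S_a\cup T_a$ for each arc, and let $\mathcal V\mathcal C$ be the set of pairs of a cluster $C$ and a joint value $c$ of its variables. There is a program, depending only on the hypergraph, the value sets and the tree decomposition, that from the numbers $\mathbb P,\boldsymbol\alpha,\boldsymbol\beta,\gamma,\epsilon$ computes a correct answer with $O(|\mathcal V\mathcal C|)$ calls (of unit cost, each asking for a probability $\Pr(C{=}c)$, $(C,c)\in\mathcal V\mathcal C$, up to a computed precision) and in time $O\big(|\mathcal V\mathcal C|+\sum_{a\in\mathcal A}|\mathcal V(C_a)|\big)$, where logarithms also cost one unit. Moreover, for fixed $T$ and $V$,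 if $\mathcal X\neq\emptyset$, the hypergraph has treewidth at most $T$ and every variable has at most $V$ values, then a tree decomposition of width at most $T$ can be chosen such that some such program makes $O(|\mathcal X|)$ calls and takes time $O(|\mathcal X|+|\mathcal A|)$, with constants depending only on $T$ and $V$. -/

import Mathlib

open Set Filter Topology

noncomputable section

/-! ## Directed hypergraphs of finite variables -/

/-- A finite directed hypergraph whose nodes are variables with finite, nonempty sets of values;
every arc has a set of sources and a set of targets. -/
structure VarGraph : Type 1 where
  Var : Type
  Val : Var → Type
  Arc : Type
  src : Arc → Finset Var
  tgt : Arc → Finset Var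
  [fintypeVar : Fintype Var]
  [decEqVar : DecidableEq Var]
  [fintypeVal : ∀ x, Fintype (Val x)]
  [decEqVal : ∀ x, DecidableEq (Val x)]
  [nonemptyVal : ∀ x, Nonempty (Val x)]
  [fintypeArc : Fintype Arc]

namespace VarGraph

attribute [instance] fintypeVar decEqVar fintypeVal decEqVal nonemptyVal fintypeArc

variable (G : VarGraph)

/-- Joint settings of all variables. -/
abbrev World : Type := ∀ x : G.Var, G.Val x

/-- Joint settings of the set `U` of variables. -/
abbrev Setting (U : Finset G.Var) : Type := ∀ x : {x // x ∈ U}, G.Val x.1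

variable {G}

/-- The values that the world `w` gives to the variables in `U`. -/
def restrict (U : Finset G.Var) (w : G.World) : G.Setting U := fun x => w x.1

/-- The restriction of a joint setting to a subset of its variables. -/
def Setting.sub {U W : Finset G.Var} (h : U ⊆ W) (v : G.Setting W) : G.Setting U :=
  fun x => v ⟨x.1, h x.2⟩

variable (G)

/-- Joint probability distributions over the variables. -/
abbrev Dist : Type := stdSimplex ℝ G.World

variable {G}

/-- The marginal probability `μ(U = u)`. -/
def Dist.pr (μ : G.Dist) (U : Finset G.Var) (u : G.Setting U) : ℝ :=
  ∑ w : G.World, if restrict U w = u then μ.1 w else 0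

/-- The probability `μ(S = s, T = t)`. -/
def Dist.pr2 (μ : G.Dist) (S T : Finset G.Var) (s : G.Setting S) (t : G.Setting T) : ℝ :=
  ∑ w : G.World, if restrict S w = s ∧ restrict T w = t then μ.1 w else 0

/-- The conditional probability `μ(Y = y | X = x)`, where `(x, y)` is the joint setting `v`
(used when `μ(X = x) > 0`). -/
def Dist.condPr (μ : G.Dist) (X Y : Finset G.Var) (v : G.Setting (X ∪ Y)) : ℝ :=
  μ.pr (X ∪ Y) v / μ.pr X (v.sub Finset.subset_union_left)

/-- The entropy of the joint distribution. -/
def Dist.entropy (μ : G.Dist) : ℝ := ∑ w : G.World, Real.negMulLog (μ.1 w)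

/-- The conditional entropy of `T` given `S`; terms of probability zero contribute zero. -/
def Dist.condEntropy (μ : G.Dist) (S T : Finset G.Var) : ℝ :=
  ∑ s : G.Setting S, ∑ t : G.Setting T,
    μ.pr2 S T s t * Real.log (μ.pr S s / μ.pr2 S T s t)

end VarGraph

/-- Relative entropy `D(q ‖ r)` of finite distributions, `⊤` unless `q ≪ r`. -/
def relEntropy {ι : Type} [Fintype ι] (q r : ι → ℝ) : EReal :=
  open Classical in
  if ∀ i, r i = 0 → q i = 0 then ((∑ i, q i * Real.log (q i / r i) : ℝ) : EReal) else ⊤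

/-! ## Probabilistic dependency graphs -/

/-- A probabilistic dependency graph over the directed hypergraph `G`: every arc carries a
conditional distribution of its targets given its sources, a structural confidence `alpha` and an
observational confidence `beta` (extended real). -/
structure PDG (G : VarGraph) : Type where
  cpd : ∀ a : G.Arc, G.Setting (G.src a) → G.Setting (G.tgt a) → ℝ
  cpd_mem : ∀ a s, cpd a s ∈ stdSimplex ℝ (G.Setting (G.tgt a))
  alpha : G.Arc → ℝ
  beta : G.Arc → EReal

/-- The trade-off parameter: either the formal value `0⁺` or a real number. -/
inductive TradeOff : Type
  | zeroPlus : TradeOff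
  | real : ℝ → TradeOff

/-- The real number underlying the trade-off parameter (`0` for `0⁺`). -/
def TradeOff.toReal : TradeOff → ℝ
  | .zeroPlus => 0
  | .real g => g

namespace PDG

variable {G : VarGraph}

/-- Observational incompatibility
`∑ₐ βₐ D( μ(Tₐ,Sₐ) ‖ pₐ(Tₐ|Sₐ) μ(Sₐ) )`. -/
def obsInc (M : PDG G) (μ : G.Dist) : EReal :=
  ∑ a : G.Arc, M.beta a *
    relEntropy
      (fun st : G.Setting (G.src a) × G.Setting (G.tgt a) =>
        μ.pr2 (G.src a) (G.tgt a) st.1 st.2)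
      (fun st => M.cpd a st.1 st.2 * μ.pr (G.src a) st.1)

/-- Structural incompatibility `(∑ₐ αₐ H_μ(Tₐ|Sₐ)) - H(μ)`. -/
def structInc (M : PDG G) (μ : G.Dist) : ℝ :=
  (∑ a : G.Arc, M.alpha a * μ.condEntropy (G.src a) (G.tgt a)) - μ.entropy

/-- The scoring function `obsInc + γ structInc`. -/
def score (M : PDG G) (γ : ℝ) (μ : G.Dist) : EReal :=
  M.obsInc μ + ((γ * M.structInc μ : ℝ) : EReal)

/-- The `γ`-inconsistency: the infimum of the scoring function. -/
def inc (M : PDG G) (γ : ℝ) : EReal := ⨅ μ : G.Dist, M.score γ μ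

/-- The optimal distributions for a real trade-off parameter. -/
def optReal (M : PDG G) (γ : ℝ) : Set G.Dist :=
  {μ | ∀ ν : G.Dist, M.score γ μ ≤ M.score γ ν}

/-- The optimal distributions; at `0⁺` these are the limits of optimal distributions for
`γ → 0` from above. -/
def opt (M : PDG G) : TradeOff → Set G.Dist
  | .zeroPlus => {μ | ∃ m : ℝ → G.Dist,
      (∀ᶠ g in 𝓝[>] (0 : ℝ), m g ∈ M.optReal g) ∧ Tendsto m (𝓝[>] 0) (𝓝 μ)}
  | .real g => M.optReal g

/-- A PDG is proper if `β ≥ 0`, and `αₐ > 0` implies `βₐ > 0`. -/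
def Proper (M : PDG G) : Prop :=
  ∀ a, 0 ≤ M.beta a ∧ (0 < M.alpha a → 0 < M.beta a)

/-- The convex range: `M` is proper, and `γ = 0⁺` or `0 < γ < minₐ βₐ / αₐ` (the minimum being over
the arcs with `αₐ > 0`, the others imposing no constraint). -/
def Cvx (M : PDG G) (γ : TradeOff) : Prop :=
  M.Proper ∧
    match γ with
    | .zeroPlus => True
    | .real g => 0 < g ∧ ∀ a, 0 < M.alpha a → ((g * M.alpha a : ℝ) : EReal) < M.beta a

/-- `M₁` is more inconsistent than `M₂`; at `0⁺`: for all sufficiently small `γ > 0`. -/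
def MoreInc (γ : TradeOff) {G₁ G₂ : VarGraph} (M₁ : PDG G₁) (M₂ : PDG G₂) : Prop :=
  match γ with
  | .zeroPlus => ∀ᶠ g in 𝓝[>] (0 : ℝ), M₂.inc g < M₁.inc g
  | .real g => M₂.inc g < M₁.inc g

end PDG

/-! ## Adding the belief `Pr(U = u) = p` to a PDG -/

namespace VarGraph

variable (G : VarGraph)

/-- Values of the variables after adding a binary variable `none`. -/
def OptVal : Option G.Var → Type
  | none => Bool
  | some x => G.Val x

instance (o : Option G.Var) : Fintype (G.OptVal o) :=
  match o with
  | none => inferInstanceAs (Fintype Bool)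
  | some x => inferInstanceAs (Fintype (G.Val x))

instance (o : Option G.Var) : DecidableEq (G.OptVal o) :=
  match o with
  | none => inferInstanceAs (DecidableEq Bool)
  | some x => inferInstanceAs (DecidableEq (G.Val x))

instance (o : Option G.Var) : Nonempty (G.OptVal o) :=
  match o with
  | none => inferInstanceAs (Nonempty Bool)
  | some x => inferInstanceAs (Nonempty (G.Val x))

/-- Joint settings of a set of variables that may contain the new one. -/
abbrev OptSetting (W : Finset (Option G.Var)) : Type := ∀ o : {o // o ∈ W}, G.OptVal o.1

variable {G}

/-- A setting of the copies of the variables in `S`, seen as a setting of `S`. -/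
def OptSetting.pull {S : Finset G.Var} (s : G.OptSetting (S.map Function.Embedding.some)) :
    G.Setting S :=
  fun x => s ⟨some x.1, Finset.mem_map_of_mem Function.Embedding.some x.2⟩

/-- `OptSetting.pull` is a bijection. -/
def OptSetting.pullEquiv (S : Finset G.Var) :
    G.OptSetting (S.map Function.Embedding.some) ≃ G.Setting S where
  toFun := OptSetting.pull
  invFun v := fun
    | ⟨none, h⟩ => absurd h (by simp)
    | ⟨some x, h⟩ => v ⟨x, by simpa using h⟩
  left_inv s := by
    funext ⟨o, h⟩
    cases o with
    | none => simp at h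
    | some x => rfl
  right_inv v := by
    funext x
    rfl

/-- The value of the new binary variable, from a setting of that variable alone. -/
def OptSetting.bit (t : G.OptSetting {none}) : Bool := t ⟨none, Finset.mem_singleton_self _⟩

variable (G)

/-- `OptSetting.bit` is a bijection. -/
def OptSetting.bitEquiv : G.OptSetting {none} ≃ Bool where
  toFun := OptSetting.bit
  invFun b := fun
    | ⟨none, _⟩ => b
    | ⟨some _, h⟩ => absurd h (by simp)
  left_inv t := by
    funext ⟨o, h⟩
    cases o with
    | none => rfl
    | some x => simp at h
  right_inv b := rfl

/-- The hypergraph with one more binary variable `none`, an arc from `U` to it (`inr true`), and an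
arc without sources to it (`inr false`). -/
def addEvent (U : Finset G.Var) : VarGraph where
  Var := Option G.Var
  Val := G.OptVal
  Arc := G.Arc ⊕ Bool
  src
    | .inl a => (G.src a).map Function.Embedding.some
    | .inr true => U.map Function.Embedding.some
    | .inr false => ∅
  tgt
    | .inl a => (G.tgt a).map Function.Embedding.some
    | .inr true => {none}
    | .inr false => {none}

end VarGraph

open VarGraph in
/-- `M + (Pr(U = u) = p)`: add a binary variable, a deterministic arc making it the indicator of the
event `U = u`, and an arc without sources asserting that it is true with probability `p`.  Both arcs
have observational confidence `1` and structural confidence `0`. -/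
def PDG.addProb {G : VarGraph} (M : PDG G) (U : Finset G.Var) (u : G.Setting U)
    (p : ℝ) (hp : p ∈ Icc (0 : ℝ) 1) : PDG (G.addEvent U) where
  cpd
    | .inl a => fun s t => M.cpd a (OptSetting.pull s) (OptSetting.pull t)
    | .inr true => fun s t =>
        if OptSetting.bit t = decide (OptSetting.pull (S := U) s = u) then 1 else 0
    | .inr false => fun _ t => if OptSetting.bit t = true then p else 1 - p
  cpd_mem
    | .inl a => fun s =>
        ⟨fun t => (M.cpd_mem a (OptSetting.pull s)).1 (OptSetting.pull t),
          ((OptSetting.pullEquiv (G.tgt a)).sum_comp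
            (fun t => M.cpd a (OptSetting.pull s) t)).trans (M.cpd_mem a (OptSetting.pull s)).2⟩
    | .inr true => fun s =>
        ⟨fun t => by dsimp only; split_ifs <;> norm_num,
          ((OptSetting.bitEquiv G).sum_comp
            (fun b => if b = decide (OptSetting.pull (S := U) s = u)
              then (1 : ℝ) else 0)).trans (by simp)⟩
    | .inr false => fun _ =>
        ⟨fun t => by
            have h0 := hp.1
            have h1 := hp.2
            dsimp only
            split_ifs <;> linarith,
          ((OptSetting.bitEquiv G).sum_comp
            (fun b => if b = true then p else 1 - p)).trans (by simp)⟩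
  alpha := Sum.elim M.alpha (fun _ => 0)
  beta := Sum.elim M.beta (fun _ => 1)

/-! ## Solvers of the three problems -/

/-- A procedure that says which of two PDGs is more inconsistent (any answer is allowed if neither
is). -/
abbrev Comparer : Type 1 :=
  ∀ (_ : TradeOff) (G₁ : VarGraph) (_ : PDG G₁) (G₂ : VarGraph) (_ : PDG G₂), Bool

def Comparer.Correct (O : Comparer) : Prop :=
  ∀ (γ : TradeOff) (G₁ : VarGraph) (M₁ : PDG G₁) (G₂ : VarGraph) (M₂ : PDG G₂),
    (PDG.MoreInc γ M₁ M₂ → O γ G₁ M₁ G₂ M₂ = true) ∧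
    (PDG.MoreInc γ M₂ M₁ → O γ G₁ M₁ G₂ M₂ = false)

/-- A procedure for approximate inconsistency calculation: instances are `(M, γ, ε)`. -/
abbrev IncSolver : Type 1 := ∀ (G : VarGraph) (_ : PDG G) (_γ _ε : ℝ), ℝ

/-- For `γ ≥ 0` and `ε > 0` the answer is within `ε` of the `γ`-inconsistency, whenever that is a
real number. -/
def IncSolver.Correct (O : IncSolver) : Prop :=
  ∀ (G : VarGraph) (M : PDG G) (γ ε : ℝ), 0 ≤ γ → 0 < ε →
    ∀ v : ℝ, M.inc γ = (v : EReal) → |v - O G M γ ε| < ε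

/-- A procedure for approximate inference in the convex range: instances are
`(M, γ, Pr(Y = y | X = x) = ?, ε)`, with `v` the joint setting `(x, y)`. -/
abbrev InferSolver : Type 1 :=
  ∀ (G : VarGraph) (_ : PDG G) (_ : TradeOff) (X Y : Finset G.Var) (_ : G.Setting (X ∪ Y)) (_ε : ℝ),
    ℝ

/-- The answer is within `ε` of the probability in the optimal distribution, whenever the
inconsistency is finite and the evidence has positive probability. -/
def InferSolver.Correct (O : InferSolver) : Prop :=
  ∀ (G : VarGraph) (M : PDG G) (γ : TradeOff), M.Cvx γ → M.inc γ.toReal ≠ ⊤ →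
    ∀ (X Y : Finset G.Var) (v : G.Setting (X ∪ Y)) (ε : ℝ), 0 < ε →
      ∀ μ ∈ M.opt γ, 0 < μ.pr X (v.sub Finset.subset_union_left) →
        |O G M γ X Y v ε - μ.condPr X Y v| ≤ ε

/-! ## Programs with subroutine calls, and their running time -/

/-- Programs over real registers named by `ρ`, with subroutine calls described by `κ`. -/
inductive Prog (ρ κ : Type) : Type
  | skip : Prog ρ κ
  | const (d : ρ) (q : ℚ) : Prog ρ κ
  | move (d x : ρ) : Prog ρ κ
  | add (d x y : ρ) : Prog ρ κ
  | sub (d x y : ρ) : Prog ρ κ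
  | mul (d x y : ρ) : Prog ρ κ
  | div (d x y : ρ) : Prog ρ κ
  | log (d x : ρ) : Prog ρ κ
  | call (d : ρ) (k : κ) : Prog ρ κ
  | seq (P Q : Prog ρ κ) : Prog ρ κ
  | ifLt (x y : ρ) (P Q : Prog ρ κ) : Prog ρ κ
  | whileLt (x y : ρ) (P : Prog ρ κ) : Prog ρ κ

/-- The program uses field operations, comparisons and calls only. -/
def Prog.LogFree {ρ κ : Type} : Prog ρ κ → Prop
  | .log _ _ => False
  | .seq P Q => P.LogFree ∧ Q.LogFree
  | .ifLt _ _ P Q => P.LogFree ∧ Q.LogFree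
  | .whileLt _ _ P => P.LogFree
  | _ => True

/-- The memory `R` after storing `v` in register `d`. -/
def store {ρ : Type} (R : ρ → ℝ) (d : ρ) (v : ℝ) : ρ → ℝ :=
  open Classical in fun r => if r = d then v else R r

/-- `Exec sub P R R' t k`: started with memory `R`, the program `P` halts with memory `R'` after time
`t` and `k` subroutine calls.  Every arithmetic operation, move and test takes one unit of time.
The subroutine `sub` returns the answer to a call together with the time charged for the call
(`none` if the call is ill-formed, in which case the program is stuck).  Division by zero and the
logarithm of a non-positive number are stuck as well. -/
inductive Exec {ρ κ : Type} (sub : κ → (ρ → ℝ) → Option (ℝ × ℕ)) :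
    Prog ρ κ → (ρ → ℝ) → (ρ → ℝ) → ℕ → ℕ → Prop
  | skip (R : ρ → ℝ) : Exec sub .skip R R 0 0
  | const (R : ρ → ℝ) (d : ρ) (q : ℚ) : Exec sub (.const d q) R (store R d (q : ℝ)) 1 0
  | move (R : ρ → ℝ) (d x : ρ) : Exec sub (.move d x) R (store R d (R x)) 1 0
  | add (R : ρ → ℝ) (d x y : ρ) : Exec sub (.add d x y) R (store R d (R x + R y)) 1 0
  | sub (R : ρ → ℝ) (d x y : ρ) : Exec sub (.sub d x y) R (store R d (R x - R y)) 1 0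
  | mul (R : ρ → ℝ) (d x y : ρ) : Exec sub (.mul d x y) R (store R d (R x * R y)) 1 0
  | div (R : ρ → ℝ) (d x y : ρ) (h : R y ≠ 0) :
      Exec sub (.div d x y) R (store R d (R x / R y)) 1 0
  | log (R : ρ → ℝ) (d x : ρ) (h : 0 < R x) :
      Exec sub (.log d x) R (store R d (Real.log (R x))) 1 0
  | call (R : ρ → ℝ) (d : ρ) (k : κ) (v : ℝ) (c : ℕ) (h : sub k R = some (v, c)) :
      Exec sub (.call d k) R (store R d v) c 1
  | seq {P Q : Prog ρ κ} {R₁ R₂ R₃ : ρ → ℝ} {t₁ t₂ k₁ k₂ : ℕ}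
      (h₁ : Exec sub P R₁ R₂ t₁ k₁) (h₂ : Exec sub Q R₂ R₃ t₂ k₂) :
      Exec sub (.seq P Q) R₁ R₃ (t₁ + t₂) (k₁ + k₂)
  | ifTrue {x y : ρ} {P Q : Prog ρ κ} {R R' : ρ → ℝ} {t k : ℕ}
      (h : R x < R y) (h₁ : Exec sub P R R' t k) : Exec sub (.ifLt x y P Q) R R' (t + 1) k
  | ifFalse {x y : ρ} {P Q : Prog ρ κ} {R R' : ρ → ℝ} {t k : ℕ}
      (h : ¬ R x < R y) (h₁ : Exec sub Q R R' t k) : Exec sub (.ifLt x y P Q) R R' (t + 1) k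
  | whileTrue {x y : ρ} {P : Prog ρ κ} {R₁ R₂ R₃ : ρ → ℝ} {t₁ t₂ k₁ k₂ : ℕ}
      (h : R₁ x < R₁ y) (h₁ : Exec sub P R₁ R₂ t₁ k₁)
      (h₂ : Exec sub (.whileLt x y P) R₂ R₃ t₂ k₂) :
      Exec sub (.whileLt x y P) R₁ R₃ (t₁ + t₂ + 1) (k₁ + k₂)
  | whileFalse {x y : ρ} {P : Prog ρ κ} {R : ρ → ℝ} (h : ¬ R x < R y) :
      Exec sub (.whileLt x y P) R R 1 0

/-! ## The calls that the reductions may make -/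

/-- The call `(i, j)`: is `M + (Pr(U = u) = p)` more inconsistent than `M + (Pr(U = u) = q)`, where
`p`, `q` are the contents of registers `i`, `j`?  The answer is `1` (yes) or `0` (no) and takes one
unit of time. -/
def compareCall (O : Comparer) {G : VarGraph} (M : PDG G) (γ : TradeOff) (U : Finset G.Var)
    (u : G.Setting U) (k : ℕ × ℕ) (R : ℕ → ℝ) : Option (ℝ × ℕ) :=
  open Classical in
  if h : R k.1 ∈ Icc (0 : ℝ) 1 ∧ R k.2 ∈ Icc (0 : ℝ) 1 then
    some (if O γ _ (M.addProb U u _ h.1) _ (M.addProb U u _ h.2) = true then 1 else 0, 1)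
  else none

/-- The number of binary digits of `r` before the point, and up to precision `ε` after it. -/
def answerBits (r ε : ℝ) : ℕ := Nat.size ⌊|r|⌋₊ + Nat.size ⌈1 / ε⌉₊

/-- The call `(b, i, j)`: what is the inconsistency of `M + (Pr(E) = p)` up to precision `ε`, where
`p`, `ε` are the contents of registers `i`, `j`, and `E` is the event `X = x, Y = y` if `b` is true
and the event `X = x` otherwise?  The time charged is one plus the number of binary digits of the
answer. -/
def incCall (O : IncSolver) {G : VarGraph} (M : PDG G) (γ : ℝ) (X Y : Finset G.Var)
    (v : G.Setting (X ∪ Y)) (k : Bool × ℕ × ℕ) (R : ℕ → ℝ) : Option (ℝ × ℕ) :=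
  open Classical in
  if h : R k.2.1 ∈ Icc (0 : ℝ) 1 ∧ 0 < R k.2.2 then
    let r : ℝ :=
      if k.1 = true then O _ (M.addProb (X ∪ Y) v _ h.1) γ (R k.2.2)
      else O _ (M.addProb X (v.sub Finset.subset_union_left) _ h.1) γ (R k.2.2)
    some (r, 1 + answerBits r (R k.2.2))
  else none

/-- Initial memory: `ε` in register `0`, `g` in register `1`, zero elsewhere. -/
def initMem (ε g : ℝ) : ℕ → ℝ
  | 0 => ε
  | 1 => g
  | _ => 0

/-! ## Tree decompositions, and programs for calculating the inconsistency -/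

/-- A tree decomposition of the hypergraph `G`, with a choice of a cluster containing each arc. -/
structure TreeDecomp (G : VarGraph) : Type 1 where
  Node : Type
  [fintypeNode : Fintype Node]
  tree : SimpleGraph Node
  isTree : tree.IsTree
  cluster : Node → Finset G.Var
  var_mem : ∀ x : G.Var, ∃ i, x ∈ cluster i
  home : G.Arc → Node
  src_subset : ∀ a, G.src a ⊆ cluster (home a)
  tgt_subset : ∀ a, G.tgt a ⊆ cluster (home a)
  path_subset : ∀ (i j : Node) (p : tree.Walk i j), p.IsPath →
    ∀ k ∈ p.support, cluster i ∩ cluster j ⊆ cluster k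

attribute [instance] TreeDecomp.fintypeNode

namespace TreeDecomp

variable {G : VarGraph} (D : TreeDecomp G)

/-- The number of pairs `(C, c)` of a cluster and a setting of its variables. -/
def size : ℕ := ∑ i : D.Node, Fintype.card (G.Setting (D.cluster i))

/-- The total number of pairs `(a, c)` of an arc `a` and a setting `c` of the cluster chosen
for `a`. -/
def arcSize : ℕ := ∑ a : G.Arc, Fintype.card (G.Setting (D.cluster (D.home a)))

/-- The width of the decomposition is at most `T`. -/
def WidthLE (T : ℕ) : Prop := ∀ i, (D.cluster i).card ≤ T + 1

end TreeDecomp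

/-- Names of the numbers that make up an instance `(M, γ, ε)` with `M` a PDG over `G`. -/
inductive InputName (G : VarGraph) : Type
  | eps : InputName G
  | gamma : InputName G
  | alpha (a : G.Arc) : InputName G
  | beta (a : G.Arc) : InputName G
  | betaInf (a : G.Arc) : InputName G
  | cpd (a : G.Arc) (s : G.Setting (G.src a)) (t : G.Setting (G.tgt a)) : InputName G

/-- Initial memory: the numbers of the instance in the input registers (an infinite confidence is
marked by a flag), zero in the working registers. -/
def inputMem {G : VarGraph} (M : PDG G) (γ : TradeOff) (ε : ℝ) : InputName G ⊕ ℕ → ℝ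
  | .inl .eps => ε
  | .inl .gamma => γ.toReal
  | .inl (.alpha a) => M.alpha a
  | .inl (.beta a) => (M.beta a).toReal
  | .inl (.betaInf a) => open Classical in if M.beta a = ⊤ then 1 else 0
  | .inl (.cpd a s t) => M.cpd a s t
  | .inr _ => 0

/-- The call `(i, c, j)`: what is `Pr(C = c)`, for `C` the `i`-th cluster, up to the precision in
register `j`?  It takes one unit of time. -/
def inferCall (O : InferSolver) {G : VarGraph} (D : TreeDecomp G) (M : PDG G) (γ : TradeOff)
    (k : (Σ i : D.Node, G.Setting (D.cluster i)) × (InputName G ⊕ ℕ))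
    (R : InputName G ⊕ ℕ → ℝ) : Option (ℝ × ℕ) :=
  open Classical in
  if 0 < R k.2 then
    some (O G M γ ∅ (D.cluster k.1.1) (fun x => k.1.2 ⟨x.1, by simpa using x.2⟩) (R k.2), 1)
  else none

/-- `P` solves approximate inconsistency calculation for the PDGs over `G` in the convex range, with
at most `calls` calls to any correct inference procedure and in time at most `time`.  The result is
left in working register `0`. -/
def CalcsInc {G : VarGraph} (D : TreeDecomp G)
    (P : Prog (InputName G ⊕ ℕ)
      ((Σ i : D.Node, G.Setting (D.cluster i)) × (InputName G ⊕ ℕ)))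
    (calls time : ℝ) : Prop :=
  ∀ (M : PDG G) (γ : TradeOff), M.Cvx γ → M.inc γ.toReal ≠ ⊤ → ∀ ε : ℝ, 0 < ε →
    ∀ O : InferSolver, O.Correct →
      ∃ (R : InputName G ⊕ ℕ → ℝ) (t k : ℕ),
        Exec (inferCall O D M γ) P (inputMem M γ ε) R t k ∧
        (∃ r : ℝ, M.inc γ.toReal = (r : EReal) ∧ |r - R (.inr 0)| < ε) ∧
        (k : ℝ) ≤ calls ∧ (t : ℝ) ≤ time

end

open Set Filter Topology

noncomputable section

/-! ## Elementary inequalities for relative entropy -/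

/-! For a proper PDG the score is infinite off a compact convex set `Feas`, where it equals the real
continuous function `val`: terms linear in the distribution, conditional entropies with coefficients
`γα - β`, and `-γ H`. In the convex range these coefficients are nonpositive (for infinite β the
conditional entropy is linear on `Feas`), so everything but `-γ H` is convex, and the compensation
identity `Dist.entropy_mix` makes `val` strongly convex (`val_mix_le`, `val_half_mix_le`). Hence the
minimizer μ is unique, and the excess score of ν is at least `γ/2 (√ν(E) - √μ(E))²` for every event
E (`val_growth`). At `0⁺`, the midpoint inequality divided by γ shows that the minimizers converge
(`exists_tendsto_opt`).

Adding `Pr(U=u) = p` forces the new variable to be the indicator of the event, so for `0 < p < 1`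
the new inconsistency is `F(p) = inf_ν (val ν + binKL (ν(u)) p)`. It exceeds `val μ` by at least
`min(γ,1)/4 (√p - √x)²`, where `x = μ(u)`. The expression under the infimum is jointly convex in
`(ν, p)`, so along the segment from `p` to `x` this excess becomes a guaranteed drop between any two
points on the same side of `x` (`addInc_sub_ge_of_le`, `addInc_sub_ge_of_ge`).

Part (a) is then a ternary search on exact comparisons. In (b) values of F are known only
approximately. The drop carries a factor `1/x`, so once some `hi` with `x ≤ hi < 4x` is known for
the evidence, a precision of order `min(γ,1) ε² hi` suffices (for `ε ≤ 1`) to find the probabilities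
of the evidence and of the conjunction up to a small multiple of `ε hi`, and their quotient is the
answer. The scale `hi` is found by repeated squaring followed by bisection of the exponent, which
takes `O(log log (1/x))` calls.

For (c), all terms of the score except `-γ H` depend only on marginals of clusters. For `γ > 0` the
optimum therefore has the largest entropy among the distributions with its cluster marginals, namely
that of the junction distribution: `∑ H(cluster) - H(separator)` (`exists_entropy_opt`). So the
inconsistency is an explicit function of the cluster marginals, with a modulus of continuity of
order `√δ` coming from `x log x`, and the program computes a sufficient δ from the input
(`exists_junctionVal`). For bounded width, dropping clusters contained in others leaves at most one
more cluster than there are variables (`RunInt.exists_reduce`). -/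

/-- The summand `a log (a / b)` of relative entropy. -/
def klTerm (a b : ℝ) : ℝ := a * Real.log (a / b)

@[simp] lemma klTerm_zero_left (b : ℝ) : klTerm 0 b = 0 := by simp [klTerm]

@[simp] lemma klTerm_self (a : ℝ) : klTerm a a = 0 := by
  by_cases h : a = 0 <;> simp [klTerm, h]

/-- The bound `log z ≤ z - 1` at `z = b r / a`. Equality holds for `r = a / b`; using one slope `r`
for many pairs yields the log-sum inequality. -/
lemma klTerm_tangent {a b r : ℝ} (ha : 0 ≤ a) (hb : 0 ≤ b) (hab : b = 0 → a = 0) (hr : 0 < r) :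
    a * Real.log r + a - b * r ≤ klTerm a b := by
  rcases ha.eq_or_lt with rfl | ha
  · simp; positivity
  have hb' : 0 < b := lt_of_le_of_ne hb fun h => ha.ne' (hab h.symm)
  have h1 : Real.log (b * r / a) ≤ b * r / a - 1 := Real.log_le_sub_one_of_pos (by positivity)
  have h2 : Real.log (b * r / a) = Real.log r - Real.log (a / b) := by
    rw [Real.log_div (by positivity) ha.ne', Real.log_mul hb'.ne' hr.ne',
      Real.log_div ha.ne' hb'.ne']
    ring
  rw [h2] at h1
  have h3 := mul_le_mul_of_nonneg_left h1 ha.le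
  have h4 : a * (b * r / a - 1) = b * r - a := by field_simp
  rw [h4] at h3
  unfold klTerm
  linarith

/-- Again `log z ≤ z - 1`, now at `z = √b / √a`. The terms `a - b` cancel when summed over two
distributions. Square roots, rather than plain differences, are what later gives the factor `1 / x`
for small probabilities. -/
lemma klTerm_ge_hellinger {a b : ℝ} (ha : 0 ≤ a) (hb : 0 ≤ b) (hab : b = 0 → a = 0) :
    (√a - √b) ^ 2 + a - b ≤ klTerm a b := by
  rcases ha.eq_or_lt with rfl | ha
  · simp [Real.sq_sqrt hb]
  have hb' : 0 < b := lt_of_le_of_ne hb fun h => ha.ne' (hab h.symm)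
  have hsa := Real.sqrt_pos.2 ha
  have hsb := Real.sqrt_pos.2 hb'
  have h1 : Real.log (√b / √a) ≤ √b / √a - 1 := Real.log_le_sub_one_of_pos (by positivity)
  have h2 : Real.log (√b / √a) = - Real.log (a / b) / 2 := by
    rw [← Real.sqrt_div hb, Real.log_sqrt (by positivity), ← Real.log_inv, inv_div]
  rw [h2] at h1
  have h3 := mul_le_mul_of_nonneg_left h1 ha.le
  have h4 : a * (√b / √a - 1) = √a * √b - a := by
    have : a = √a * √a := (Real.mul_self_sqrt ha.le).symm
    field_simp
    nlinarith
  rw [h4] at h3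
  have h5 : (√a - √b) ^ 2 = a - 2 * (√a * √b) + b := by
    rw [sub_sq, Real.sq_sqrt ha.le, Real.sq_sqrt hb]; ring
  unfold klTerm
  linarith

/-- The log-sum inequality: tangents at the common slope `(∑ a) / (∑ b)` add up to equality on the
left. -/
lemma klTerm_sum_le {ι : Type*} (s : Finset ι) (a b : ι → ℝ) (ha : ∀ i ∈ s, 0 ≤ a i)
    (hb : ∀ i ∈ s, 0 ≤ b i) (hab : ∀ i ∈ s, b i = 0 → a i = 0) :
    klTerm (∑ i ∈ s, a i) (∑ i ∈ s, b i) ≤ ∑ i ∈ s, klTerm (a i) (b i) := by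
  rcases (Finset.sum_nonneg ha).eq_or_lt with h0 | h0
  · have : ∀ i ∈ s, a i = 0 := (Finset.sum_eq_zero_iff_of_nonneg ha).1 h0.symm
    rw [← h0, klTerm_zero_left, Finset.sum_eq_zero fun i hi => by rw [this i hi, klTerm_zero_left]]
  have hB : 0 < ∑ i ∈ s, b i := by
    refine lt_of_le_of_ne (Finset.sum_nonneg hb) fun h => h0.ne' ?_
    have := (Finset.sum_eq_zero_iff_of_nonneg hb).1 h.symm
    exact Finset.sum_eq_zero fun i hi => hab i hi (this i hi)
  set A := ∑ i ∈ s, a i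
  set B := ∑ i ∈ s, b i
  have h1 := Finset.sum_le_sum fun i hi =>
    klTerm_tangent (ha i hi) (hb i hi) (hab i hi) (div_pos h0 hB)
  rw [Finset.sum_sub_distrib, Finset.sum_add_distrib, ← Finset.sum_mul, ← Finset.sum_mul] at h1
  have : B * (A / B) = A := by field_simp
  unfold klTerm at h1 ⊢
  linarith

lemma klTerm_mul_mul (c a b : ℝ) : klTerm (c * a) (c * b) = c * klTerm a b := by
  by_cases h : c = 0
  · simp [h]
  · rw [klTerm, klTerm, mul_div_mul_left _ _ h, mul_assoc]

lemma klTerm_add_le {a b a' b' : ℝ} (ha : 0 ≤ a) (hb : 0 ≤ b) (hab : b = 0 → a = 0)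
    (ha' : 0 ≤ a') (hb' : 0 ≤ b') (hab' : b' = 0 → a' = 0) :
    klTerm (a + a') (b + b') ≤ klTerm a b + klTerm a' b' := by
  simpa using klTerm_sum_le Finset.univ ![a, a'] ![b, b'] (by simp [Fin.forall_fin_two, *])
    (by simp [Fin.forall_fin_two, *]) (by simp [Fin.forall_fin_two]; tauto)

/-- Homogeneity and subadditivity together are joint convexity. -/
lemma klTerm_mix_le {a b a' b' t : ℝ} (ht : t ∈ Icc (0 : ℝ) 1) (ha : 0 ≤ a) (hb : 0 ≤ b)
    (hab : b = 0 → a = 0) (ha' : 0 ≤ a') (hb' : 0 ≤ b') (hab' : b' = 0 → a' = 0) :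
    klTerm ((1 - t) * a + t * a') ((1 - t) * b + t * b')
      ≤ (1 - t) * klTerm a b + t * klTerm a' b' := by
  have h1 : 0 ≤ 1 - t := sub_nonneg.2 ht.2
  rw [← klTerm_mul_mul, ← klTerm_mul_mul]
  refine klTerm_add_le (mul_nonneg h1 ha) (mul_nonneg h1 hb) ?_ (mul_nonneg ht.1 ha')
    (mul_nonneg ht.1 hb') ?_
  · intro h; rcases mul_eq_zero.1 h with h | h
    · simp [h]
    · simp [hab h]
  · intro h; rcases mul_eq_zero.1 h with h | h
    · simp [h]
    · simp [hab' h]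

/-- Relative entropy of the Bernoulli distributions with parameters `x` and `p`. -/
def binKL (x p : ℝ) : ℝ := klTerm x p + klTerm (1 - x) (1 - p)

@[simp] lemma binKL_self (x : ℝ) : binKL x x = 0 := by simp [binKL]

lemma binKL_ge_hellinger {x p : ℝ} (hx : x ∈ Icc (0 : ℝ) 1) (hp : p ∈ Icc (0 : ℝ) 1)
    (h0 : p = 0 → x = 0) (h1 : p = 1 → x = 1) : (√x - √p) ^ 2 ≤ binKL x p := by
  have a := klTerm_ge_hellinger hx.1 hp.1 h0
  have b := klTerm_ge_hellinger (a := 1 - x) (b := 1 - p) (by linarith [hx.2]) (by linarith [hp.2])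
    (fun h => by rw [h1 (by linarith)]; ring)
  have c := sq_nonneg (√(1 - x) - √(1 - p))
  unfold binKL
  linarith

lemma binKL_nonneg {x p : ℝ} (hx : x ∈ Icc (0 : ℝ) 1) (hp : p ∈ Ioo (0 : ℝ) 1) :
    0 ≤ binKL x p :=
  (sq_nonneg _).trans (binKL_ge_hellinger hx ⟨hp.1.le, hp.2.le⟩ (fun h => absurd h hp.1.ne')
    (fun h => absurd h hp.2.ne))

/-- Only the second parameter may be an endpoint: it will be `p' = x' = μ(u)` for the optimal μ,
which can be 0 or 1. -/
lemma binKL_mix_le {x p x' p' t : ℝ} (ht : t ∈ Icc (0 : ℝ) 1) (hx : x ∈ Icc (0 : ℝ) 1)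
    (hp : p ∈ Ioo (0 : ℝ) 1) (hx' : x' ∈ Icc (0 : ℝ) 1) (hp' : p' ∈ Icc (0 : ℝ) 1)
    (h0 : p' = 0 → x' = 0) (h1 : p' = 1 → x' = 1) :
    binKL ((1 - t) * x + t * x') ((1 - t) * p + t * p')
      ≤ (1 - t) * binKL x p + t * binKL x' p' := by
  have a := klTerm_mix_le ht hx.1 hp.1.le (fun h => absurd h hp.1.ne') hx'.1 hp'.1 h0
  have b := klTerm_mix_le (a := 1 - x) (b := 1 - p) (a' := 1 - x') (b' := 1 - p') ht
    (by linarith [hx.2]) (by linarith [hp.2]) (fun h => by linarith [hp.2]) (by linarith [hx'.2])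
    (by linarith [hp'.2]) (fun h => by rw [h1 (by linarith)]; ring)
  have e1 : 1 - ((1 - t) * x + t * x') = (1 - t) * (1 - x) + t * (1 - x') := by ring
  have e2 : 1 - ((1 - t) * p + t * p') = (1 - t) * (1 - p) + t * (1 - p') := by ring
  unfold binKL
  rw [e1, e2]
  linarith

/-- A crude bound that only serves to limit the number of digits of the answers to calls. -/
lemma binKL_le {x p ζ : ℝ} (hx : x ∈ Icc (0 : ℝ) 1) (hζ : 0 < ζ) (hp : ζ ≤ p) (hp' : ζ ≤ 1 - p) :
    binKL x p ≤ 1 / ζ := by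
  have key : ∀ y q : ℝ, 0 ≤ y → y ≤ 1 → ζ ≤ q → klTerm y q ≤ y * (1 / ζ) := by
    intro y q hy hy1 hq
    rcases hy.eq_or_lt with rfl | hy
    · simp
    refine mul_le_mul_of_nonneg_left ?_ hy.le
    have hq0 : 0 < q := hζ.trans_le hq
    calc Real.log (y / q) ≤ y / q - 1 := Real.log_le_sub_one_of_pos (by positivity)
      _ ≤ y / q := by linarith
      _ ≤ 1 / ζ := by gcongr
  have a := key x p hx.1 hx.2 hp
  have b := key (1 - x) (1 - p) (by linarith [hx.2]) (by linarith [hx.1]) hp'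
  unfold binKL
  linarith

/-! ## Marginals and entropies -/

namespace VarGraph

namespace Dist

variable {G : VarGraph} (μ ν : G.Dist)

lemma nonneg (w : G.World) : 0 ≤ μ.1 w := μ.2.1 w

lemma sum_eq_one : ∑ w, μ.1 w = 1 := μ.2.2

lemma sum_pr_mul (U : Finset G.Var) (g : G.Setting U → ℝ) :
    ∑ u, μ.pr U u * g u = ∑ w, μ.1 w * g (restrict U w) := by
  simp only [pr, Finset.sum_mul]
  rw [Finset.sum_comm]
  refine Finset.sum_congr rfl fun w _ => ?_
  simp [ite_mul]

lemma sum_pr2_mul (S T : Finset G.Var) (g : G.Setting S → G.Setting T → ℝ) :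
    ∑ s, ∑ t, μ.pr2 S T s t * g s t = ∑ w, μ.1 w * g (restrict S w) (restrict T w) := by
  have : ∀ s, ∑ t, μ.pr2 S T s t * g s t
      = ∑ w, if restrict S w = s then μ.1 w * g s (restrict T w) else 0 := by
    intro s
    simp only [pr2, Finset.sum_mul]
    rw [Finset.sum_comm]
    refine Finset.sum_congr rfl fun w _ => ?_
    by_cases h : restrict S w = s <;> simp [h, ite_mul]
  simp only [this]
  rw [Finset.sum_comm]
  refine Finset.sum_congr rfl fun w _ => ?_
  simp

lemma pr_nonneg (U : Finset G.Var) (u : G.Setting U) : 0 ≤ μ.pr U u :=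
  Finset.sum_nonneg fun w _ => by split_ifs <;> simp [μ.nonneg]

lemma pr2_nonneg (S T : Finset G.Var) (s : G.Setting S) (t : G.Setting T) : 0 ≤ μ.pr2 S T s t :=
  Finset.sum_nonneg fun w _ => by split_ifs <;> simp [μ.nonneg]

lemma sum_pr (U : Finset G.Var) : ∑ u, μ.pr U u = 1 := by
  simpa [μ.sum_eq_one] using μ.sum_pr_mul U fun _ => 1

lemma pr_le_one (U : Finset G.Var) (u : G.Setting U) : μ.pr U u ≤ 1 := by
  rw [← μ.sum_pr U]
  exact Finset.single_le_sum (fun i _ => μ.pr_nonneg U i) (Finset.mem_univ u)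

lemma pr_mem (U : Finset G.Var) (u : G.Setting U) : μ.pr U u ∈ Icc (0 : ℝ) 1 :=
  ⟨μ.pr_nonneg U u, μ.pr_le_one U u⟩

lemma le_pr (U : Finset G.Var) (w : G.World) : μ.1 w ≤ μ.pr U (restrict U w) := by
  have := Finset.single_le_sum (f := fun w' => if restrict U w' = restrict U w then μ.1 w' else 0)
    (fun i _ => by split_ifs <;> simp [μ.nonneg]) (Finset.mem_univ w)
  simpa [pr] using this

lemma restrict_eq_iff (U : Finset G.Var) (w w' : G.World) :
    restrict U w = restrict U w' ↔ ∀ x ∈ U, w x = w' x := by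
  constructor
  · intro h x hx; exact congrFun h ⟨x, hx⟩
  · intro h; funext x; exact h x.1 x.2

lemma pr2_restrict (S T : Finset G.Var) (w : G.World) :
    μ.pr2 S T (restrict S w) (restrict T w) = μ.pr (S ∪ T) (restrict (S ∪ T) w) := by
  refine Finset.sum_congr rfl fun w' _ => ?_
  simp only [restrict_eq_iff, Finset.mem_union, or_imp, forall_and]

lemma pr2_le_pr (S T : Finset G.Var) (s : G.Setting S) (t : G.Setting T) :
    μ.pr2 S T s t ≤ μ.pr S s := by
  refine Finset.sum_le_sum fun w' _ => ?_
  split_ifs with h1 h2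
  · exact le_rfl
  · exact absurd h1.1 h2
  · exact μ.nonneg _
  · exact le_rfl

lemma sum_pr2 (S T : Finset G.Var) (s : G.Setting S) : ∑ t, μ.pr2 S T s t = μ.pr S s := by
  simp only [pr2, pr]
  rw [Finset.sum_comm]
  refine Finset.sum_congr rfl fun w _ => ?_
  by_cases h : restrict S w = s <;> simp [h]

/-- The entropy of the marginal on `U`. -/
def ent (U : Finset G.Var) : ℝ := ∑ u, Real.negMulLog (μ.pr U u)

lemma ent_eq (U : Finset G.Var) :
    μ.ent U = -∑ w, μ.1 w * Real.log (μ.pr U (restrict U w)) := by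
  rw [← μ.sum_pr_mul U fun u => Real.log (μ.pr U u), ← Finset.sum_neg_distrib]
  exact Finset.sum_congr rfl fun u _ => by rw [Real.negMulLog]; ring

/-- The chain rule; it leaves only entropies of marginals, which are visibly continuous. -/
lemma condEntropy_eq (S T : Finset G.Var) : μ.condEntropy S T = μ.ent (S ∪ T) - μ.ent S := by
  rw [condEntropy, sum_pr2_mul μ S T fun s t => Real.log (μ.pr S s / μ.pr2 S T s t), ent_eq, ent_eq,
    neg_sub_neg, ← Finset.sum_sub_distrib]
  refine Finset.sum_congr rfl fun w _ => ?_
  rcases (μ.nonneg w).eq_or_lt with h | h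
  · simp [← h]
  · rw [pr2_restrict, Real.log_div (h.trans_le (μ.le_pr _ w)).ne' (h.trans_le (μ.le_pr _ w)).ne']
    ring

/-- In this form concavity is joint convexity of `klTerm` at the pairs `(μ(s,t), μ(s))`, both
entries being linear in μ. -/
lemma condEntropy_eq_neg (S T : Finset G.Var) :
    μ.condEntropy S T = -∑ s, ∑ t, klTerm (μ.pr2 S T s t) (μ.pr S s) := by
  simp only [← Finset.sum_neg_distrib]
  refine Finset.sum_congr rfl fun s _ => Finset.sum_congr rfl fun t _ => ?_
  rw [klTerm, ← mul_neg, ← Real.log_inv, inv_div]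

lemma continuous_apply (w : G.World) : Continuous fun μ : G.Dist => μ.1 w :=
  (_root_.continuous_apply w).comp continuous_subtype_val

lemma continuous_pr (U : Finset G.Var) (u : G.Setting U) : Continuous fun μ : G.Dist => μ.pr U u :=
  continuous_finsetSum _ fun w _ => by
    split_ifs
    · exact continuous_apply w
    · exact continuous_const

lemma continuous_pr2 (S T : Finset G.Var) (s : G.Setting S) (t : G.Setting T) :
    Continuous fun μ : G.Dist => μ.pr2 S T s t :=
  continuous_finsetSum _ fun w _ => by
    split_ifs
    · exact continuous_apply w
    · exact continuous_const

lemma continuous_ent (U : Finset G.Var) : Continuous fun μ : G.Dist => μ.ent U :=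
  continuous_finsetSum _ fun u _ => Real.continuous_negMulLog.comp (continuous_pr U u)

lemma continuous_entropy : Continuous fun μ : G.Dist => μ.entropy :=
  continuous_finsetSum _ fun u _ => Real.continuous_negMulLog.comp (continuous_apply u)

lemma continuous_condEntropy (S T : Finset G.Var) :
    Continuous fun μ : G.Dist => μ.condEntropy S T := by
  simp only [condEntropy_eq]
  exact (continuous_ent _).sub (continuous_ent _)

/-- The mixture `(1 - t) μ + t ν`. -/
def mix (t : ℝ) (ht : t ∈ Icc (0 : ℝ) 1) : G.Dist :=
  ⟨fun w => (1 - t) * μ.1 w + t * ν.1 w,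
    fun w => add_nonneg (mul_nonneg (sub_nonneg.2 ht.2) (μ.nonneg w)) (mul_nonneg ht.1 (ν.nonneg w)),
    by rw [Finset.sum_add_distrib, ← Finset.mul_sum, ← Finset.mul_sum, μ.sum_eq_one, ν.sum_eq_one]
       ring⟩

variable {t : ℝ} (ht : t ∈ Icc (0 : ℝ) 1)

lemma mix_apply (w : G.World) : (mix μ ν t ht).1 w = (1 - t) * μ.1 w + t * ν.1 w := rfl

lemma mix_pr (U : Finset G.Var) (u : G.Setting U) :
    (mix μ ν t ht).pr U u = (1 - t) * μ.pr U u + t * ν.pr U u := by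
  simp only [pr, mix_apply, Finset.mul_sum, ← Finset.sum_add_distrib]
  exact Finset.sum_congr rfl fun w _ => by split_ifs <;> simp

lemma mix_pr2 (S T : Finset G.Var) (s : G.Setting S) (r : G.Setting T) :
    (mix μ ν t ht).pr2 S T s r = (1 - t) * μ.pr2 S T s r + t * ν.pr2 S T s r := by
  simp only [pr2, mix_apply, Finset.mul_sum, ← Finset.sum_add_distrib]
  exact Finset.sum_congr rfl fun w _ => by split_ifs <;> simp

lemma condEntropy_mix_ge (S T : Finset G.Var) :
    (1 - t) * μ.condEntropy S T + t * ν.condEntropy S T ≤ (mix μ ν t ht).condEntropy S T := by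
  simp only [condEntropy_eq_neg, mix_pr, mix_pr2, mul_neg, ← neg_add, Finset.mul_sum,
    ← Finset.sum_add_distrib]
  refine neg_le_neg (Finset.sum_le_sum fun s _ => Finset.sum_le_sum fun r _ => ?_)
  exact klTerm_mix_le ht (μ.pr2_nonneg _ _ _ _) (μ.pr_nonneg _ _)
    (fun h => le_antisymm ((μ.pr2_le_pr _ _ _ _).trans h.le) (μ.pr2_nonneg _ _ _ _))
    (ν.pr2_nonneg _ _ _ _) (ν.pr_nonneg _ _)
    (fun h => le_antisymm ((ν.pr2_le_pr _ _ _ _).trans h.le) (ν.pr2_nonneg _ _ _ _))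

/-- Relative entropy of joint distributions. -/
def kl : ℝ := ∑ w, klTerm (μ.1 w) (ν.1 w)

/-- Coarsen to the blocks `E` and `Eᶜ` by the log-sum inequality and apply the Hellinger bound to
each; the linear corrections of the two blocks cancel. -/
lemma kl_ge (E : Finset G.World) (h : ∀ w, ν.1 w = 0 → μ.1 w = 0) :
    (√(∑ w ∈ E, μ.1 w) - √(∑ w ∈ E, ν.1 w)) ^ 2 ≤ μ.kl ν := by
  have sum_split : ∀ f : G.World → ℝ, ∑ w, f w = ∑ w ∈ E, f w + ∑ w ∈ Eᶜ, f w :=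
    fun f => (Finset.sum_add_sum_compl E f).symm
  have key : ∀ E : Finset G.World, (√(∑ w ∈ E, μ.1 w) - √(∑ w ∈ E, ν.1 w)) ^ 2
      + ∑ w ∈ E, μ.1 w - ∑ w ∈ E, ν.1 w ≤ ∑ w ∈ E, klTerm (μ.1 w) (ν.1 w) := by
    intro E
    have hn : ∀ i ∈ E, 0 ≤ ν.1 i := fun i _ => ν.nonneg i
    refine (klTerm_ge_hellinger (Finset.sum_nonneg fun i _ => μ.nonneg i)
      (Finset.sum_nonneg hn) fun h0 => ?_).trans
      (klTerm_sum_le E _ _ (fun i _ => μ.nonneg i) (fun i _ => ν.nonneg i) fun i _ => h i)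
    exact Finset.sum_eq_zero fun i hi => h i ((Finset.sum_eq_zero_iff_of_nonneg hn).1 h0 i hi)
  have h1 := key E
  have h2 := key Eᶜ
  have h3 := sum_split μ.1
  have h4 := sum_split ν.1
  rw [μ.sum_eq_one] at h3
  rw [ν.sum_eq_one] at h4
  rw [kl, sum_split]
  nlinarith [sq_nonneg (√(∑ w ∈ Eᶜ, μ.1 w) - √(∑ w ∈ Eᶜ, ν.1 w))]

lemma kl_nonneg (h : ∀ w, ν.1 w = 0 → μ.1 w = 0) : 0 ≤ μ.kl ν :=
  (sq_nonneg _).trans (μ.kl_ge ν ∅ h)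

/-- The compensation identity: the entropy gained by mixing is exactly the mean relative entropy to
the mixture. It is the source of all strong convexity below. -/
lemma entropy_mix :
    (mix μ ν t ht).entropy = (1 - t) * (μ.entropy + μ.kl (mix μ ν t ht))
      + t * (ν.entropy + ν.kl (mix μ ν t ht)) := by
  simp only [entropy, kl, ← Finset.sum_add_distrib, Finset.mul_sum]
  refine Finset.sum_congr rfl fun w _ => ?_
  set m := (mix μ ν t ht).1 w with hm
  rw [mix_apply] at hm
  have h1 : 0 ≤ 1 - t := sub_nonneg.2 ht.2
  have key : ∀ c a : ℝ, 0 ≤ c → 0 ≤ a → c * a ≤ m →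
      c * (Real.negMulLog a + klTerm a m) = -(c * a) * Real.log m := by
    intro c a hc ha hle
    rcases hc.eq_or_lt with rfl | hc
    · simp
    rcases ha.eq_or_lt with rfl | ha
    · simp
    have : 0 < m := (mul_pos hc ha).trans_le hle
    rw [Real.negMulLog, klTerm, Real.log_div ha.ne' this.ne']
    ring
  have hm1 := mul_nonneg h1 (μ.nonneg w)
  have hm2 := mul_nonneg ht.1 (ν.nonneg w)
  rw [key _ _ h1 (μ.nonneg w) (by linarith), key _ _ ht.1 (ν.nonneg w) (by linarith),
    Real.negMulLog]
  linear_combination (-Real.log m) * hm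

end Dist

end VarGraph
end

noncomputable section

/-! ## The score as a real function on the feasible distributions -/

lemma EReal.coe_finsetSum {ι : Type*} (s : Finset ι) (f : ι → ℝ) :
    ((∑ i ∈ s, f i : ℝ) : EReal) = ∑ i ∈ s, (f i : EReal) := by
  classical
  induction s using Finset.induction_on with
  | empty => simp
  | insert a s ha ih => rw [Finset.sum_insert ha, Finset.sum_insert ha, EReal.coe_add, ih]

lemma EReal.finsetSum_eq_top {ι : Type*} [DecidableEq ι] {s : Finset ι} {f : ι → EReal} {i : ι}
    (hi : i ∈ s) (h : f i = ⊤) (h0 : ∀ j ∈ s, 0 ≤ f j) : ∑ j ∈ s, f j = ⊤ := by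
  rw [← Finset.add_sum_erase s f hi, h]
  refine EReal.top_add_of_ne_bot fun hb => ?_
  have : 0 ≤ ∑ j ∈ s.erase i, f j := Finset.sum_nonneg fun j hj => h0 j (Finset.mem_of_mem_erase hj)
  rw [hb] at this
  exact absurd this (by simp)

/-- Gibbs' inequality by summing Hellinger bounds. Strictness is needed for arcs with infinite
confidence, where any deviation must cost `⊤`. -/
lemma sum_klTerm_pos {ι : Type*} [Fintype ι] {q r : ι → ℝ} (hq : ∀ i, 0 ≤ q i) (hr : ∀ i, 0 ≤ r i)
    (h : ∀ i, r i = 0 → q i = 0) (hs : ∑ i, q i = ∑ i, r i) :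
    0 ≤ ∑ i, klTerm (q i) (r i) ∧ (q ≠ r → 0 < ∑ i, klTerm (q i) (r i)) := by
  have h1 : ∑ i, (√(q i) - √(r i)) ^ 2 ≤ ∑ i, klTerm (q i) (r i) := by
    have := Finset.sum_le_sum fun i (_ : i ∈ Finset.univ) => klTerm_ge_hellinger (hq i) (hr i) (h i)
    rw [Finset.sum_sub_distrib, Finset.sum_add_distrib] at this
    linarith
  refine ⟨(Finset.sum_nonneg fun i _ => sq_nonneg _).trans h1, fun hne => lt_of_lt_of_le ?_ h1⟩
  obtain ⟨i, hi⟩ := Function.ne_iff.1 hne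
  refine Finset.sum_pos' (fun i _ => sq_nonneg _) ⟨i, Finset.mem_univ i, ?_⟩
  have : √(q i) ≠ √(r i) := fun h => hi ((Real.sqrt_inj (hq i) (hr i)).1 h)
  exact sq_pos_of_ne_zero (sub_ne_zero.2 this)

lemma relEntropy_eq_coe {ι : Type} [Fintype ι] {q r : ι → ℝ} (h : ∀ i, r i = 0 → q i = 0) :
    relEntropy q r = ((∑ i, klTerm (q i) (r i) : ℝ) : EReal) := if_pos h

lemma relEntropy_eq_top {ι : Type} [Fintype ι] {q r : ι → ℝ} (h : ¬ ∀ i, r i = 0 → q i = 0) :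
    relEntropy q r = ⊤ := if_neg h

lemma relEntropy_nonneg {ι : Type} [Fintype ι] {q r : ι → ℝ} (hq : ∀ i, 0 ≤ q i) (hr : ∀ i, 0 ≤ r i)
    (hs : ∑ i, q i = ∑ i, r i) : 0 ≤ relEntropy q r := by
  by_cases h : ∀ i, r i = 0 → q i = 0
  · rw [relEntropy_eq_coe h]
    exact_mod_cast (sum_klTerm_pos hq hr h hs).1
  · rw [relEntropy_eq_top h]; exact le_top

namespace PDG

open VarGraph

variable {G : VarGraph} (M : PDG G)

/-- The incompatibility of `μ` with the arc `a`. -/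
def arcInc (a : G.Arc) (μ : G.Dist) : EReal :=
  relEntropy
    (fun st : G.Setting (G.src a) × G.Setting (G.tgt a) => μ.pr2 (G.src a) (G.tgt a) st.1 st.2)
    (fun st => M.cpd a st.1 st.2 * μ.pr (G.src a) st.1)

lemma obsInc_eq (μ : G.Dist) : M.obsInc μ = ∑ a, M.beta a * M.arcInc a μ := rfl

lemma cpd_nonneg (a : G.Arc) (s t) : 0 ≤ M.cpd a s t := (M.cpd_mem a s).1 t

lemma cpd_le_one (a : G.Arc) (s t) : M.cpd a s t ≤ 1 := by
  rw [← (M.cpd_mem a s).2]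
  exact Finset.single_le_sum (fun i _ => M.cpd_nonneg a s i) (Finset.mem_univ t)

/-- The expected log-likelihood of the conditional distribution on the arc `a`. -/
def logLik (a : G.Arc) (μ : G.Dist) : ℝ :=
  ∑ w, μ.1 w * Real.log (M.cpd a (VarGraph.restrict (G.src a) w)
    (VarGraph.restrict (G.tgt a) w))

/-- The distributions with finite observational incompatibility. -/
def Feas : Set G.Dist :=
  {μ | ∀ a, (M.beta a ≠ 0 → ∀ s t, M.cpd a s t = 0 → μ.pr2 (G.src a) (G.tgt a) s t = 0) ∧
    (M.beta a = ⊤ → ∀ s t, μ.pr2 (G.src a) (G.tgt a) s t = M.cpd a s t * μ.pr (G.src a) s)}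

/-- The score of a feasible distribution. -/
def val (γ : ℝ) (μ : G.Dist) : ℝ :=
  ∑ a, ((γ * M.alpha a - (M.beta a).toReal) * μ.condEntropy (G.src a) (G.tgt a)
    - (M.beta a).toReal * M.logLik a μ) - γ * μ.entropy

variable {M}

lemma sum_arc (a : G.Arc) (μ : G.Dist) :
    ∑ st : G.Setting (G.src a) × G.Setting (G.tgt a), μ.pr2 (G.src a) (G.tgt a) st.1 st.2
      = ∑ st : G.Setting (G.src a) × G.Setting (G.tgt a),
          M.cpd a st.1 st.2 * μ.pr (G.src a) st.1 := by
  rw [Fintype.sum_prod_type, Fintype.sum_prod_type]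
  refine Finset.sum_congr rfl fun s _ => ?_
  dsimp only
  rw [Dist.sum_pr2, ← Finset.sum_mul, (M.cpd_mem a s).2, one_mul]

lemma arcInc_nonneg (a : G.Arc) (μ : G.Dist) : 0 ≤ M.arcInc a μ :=
  relEntropy_nonneg (fun _ => μ.pr2_nonneg _ _ _ _)
    (fun _ => mul_nonneg (M.cpd_nonneg _ _ _) (μ.pr_nonneg _ _)) (sum_arc a μ)

lemma ac_of_supp {a : G.Arc} {μ : G.Dist}
    (h : ∀ s t, M.cpd a s t = 0 → μ.pr2 (G.src a) (G.tgt a) s t = 0)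
    (st : G.Setting (G.src a) × G.Setting (G.tgt a))
    (h0 : M.cpd a st.1 st.2 * μ.pr (G.src a) st.1 = 0) :
    μ.pr2 (G.src a) (G.tgt a) st.1 st.2 = 0 := by
  rcases mul_eq_zero.1 h0 with h1 | h1
  · exact h _ _ h1
  · exact le_antisymm ((μ.pr2_le_pr _ _ _ _).trans h1.le) (μ.pr2_nonneg _ _ _ _)

/-- Splitting the logarithm separates the conditional entropy, which does not see the conditional
distribution of the arc, from a part that is linear in μ. -/
lemma sum_klTerm_arc {a : G.Arc} {μ : G.Dist}
    (h : ∀ s t, M.cpd a s t = 0 → μ.pr2 (G.src a) (G.tgt a) s t = 0) :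
    ∑ st : G.Setting (G.src a) × G.Setting (G.tgt a),
      klTerm (μ.pr2 (G.src a) (G.tgt a) st.1 st.2) (M.cpd a st.1 st.2 * μ.pr (G.src a) st.1)
      = -μ.condEntropy (G.src a) (G.tgt a) - M.logLik a μ := by
  rw [Fintype.sum_prod_type, Dist.condEntropy_eq_neg, logLik,
    ← μ.sum_pr2_mul _ _ fun s t => Real.log (M.cpd a s t), neg_neg]
  simp only [← Finset.sum_sub_distrib]
  refine Finset.sum_congr rfl fun s _ => Finset.sum_congr rfl fun t _ => ?_
  rcases (μ.pr2_nonneg (G.src a) (G.tgt a) s t).eq_or_lt with h0 | h0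
  · simp [← h0]
  have hp : 0 < μ.pr (G.src a) s := h0.trans_le (μ.pr2_le_pr _ _ _ _)
  have hc : M.cpd a s t ≠ 0 := fun hc => h0.ne' (h s t hc)
  rw [klTerm, klTerm, Real.log_div h0.ne' (mul_ne_zero hc hp.ne'), Real.log_mul hc hp.ne',
    Real.log_div h0.ne' hp.ne']
  ring

lemma arcInc_of_supp {a : G.Arc} {μ : G.Dist}
    (h : ∀ s t, M.cpd a s t = 0 → μ.pr2 (G.src a) (G.tgt a) s t = 0) :
    M.arcInc a μ = ((-μ.condEntropy (G.src a) (G.tgt a) - M.logLik a μ : ℝ) : EReal) := by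
  rw [arcInc, relEntropy_eq_coe (ac_of_supp h), sum_klTerm_arc h]

/-- When μ follows the arc exactly the relative entropy vanishes, so the conditional entropy is
linear in μ. -/
lemma condEntropy_of_eq {a : G.Arc} {μ : G.Dist}
    (h : ∀ s t, μ.pr2 (G.src a) (G.tgt a) s t = M.cpd a s t * μ.pr (G.src a) s) :
    μ.condEntropy (G.src a) (G.tgt a) = -M.logLik a μ := by
  have := sum_klTerm_arc (M := M) (a := a) (μ := μ) fun s t h0 => by rw [h, h0, zero_mul]
  simp only [h, klTerm_self, Finset.sum_const_zero] at this
  linarith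

lemma score_of_mem {μ : G.Dist} (h : μ ∈ M.Feas) (hM : M.Proper) (γ : ℝ) :
    M.score γ μ = (M.val γ μ : EReal) := by
  have key : ∀ a, M.beta a * M.arcInc a μ =
      ((-(M.beta a).toReal * μ.condEntropy (G.src a) (G.tgt a)
        - (M.beta a).toReal * M.logLik a μ : ℝ) : EReal) := by
    intro a
    obtain ⟨h1, h2⟩ := h a
    by_cases hb : M.beta a = 0
    · simp [hb]
    rw [arcInc_of_supp (h1 hb)]
    -- The relative entropy is zero here and `⊤ * 0 = 0`, in agreement with `toReal ⊤ = 0` in `val`.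
    by_cases ht : M.beta a = ⊤
    · rw [condEntropy_of_eq (h2 ht), ht]
      simp
    · have hbot : M.beta a ≠ ⊥ := fun h => by
        have := (hM a).1
        rw [h] at this
        exact absurd this (by simp)
      conv_lhs => rw [← EReal.coe_toReal ht hbot]
      rw [← EReal.coe_mul]
      congr 1
      ring
  rw [score, obsInc_eq, Finset.sum_congr rfl fun a _ => key a, ← EReal.coe_finsetSum,
    ← EReal.coe_add, structInc, val, mul_sub, Finset.mul_sum, ← add_sub_assoc,
    ← Finset.sum_add_distrib]
  congr 2
  exact Finset.sum_congr rfl fun a _ => by ring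

/-- Either a support condition fails under positive β, or an infinite β multiplies a positive
relative entropy. The other terms are nonnegative and cannot cancel the infinite one. -/
lemma score_of_notMem {μ : G.Dist} (h : μ ∉ M.Feas) (hM : M.Proper) (γ : ℝ) :
    M.score γ μ = ⊤ := by
  classical
  simp only [Feas, mem_ofPred_eq, not_forall] at h
  obtain ⟨a, ha⟩ := h
  have key : M.beta a * M.arcInc a μ = ⊤ := by
    by_cases h1 : M.beta a ≠ 0 → ∀ s t, M.cpd a s t = 0 → μ.pr2 (G.src a) (G.tgt a) s t = 0
    · have h2 : ¬ (M.beta a = ⊤ → ∀ s t, μ.pr2 (G.src a) (G.tgt a) s t =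
          M.cpd a s t * μ.pr (G.src a) s) := fun h => ha ⟨h1, h⟩
      push Not at h2
      obtain ⟨hb, s, t, hne⟩ := h2
      have hs := h1 (by simp [hb])
      rw [hb, arcInc, relEntropy_eq_coe (ac_of_supp hs)]
      refine EReal.top_mul_of_pos ?_
      have := (sum_klTerm_pos (fun _ => μ.pr2_nonneg _ _ _ _)
        (fun _ => mul_nonneg (M.cpd_nonneg _ _ _) (μ.pr_nonneg _ _)) (ac_of_supp hs)
        (sum_arc a μ)).2 fun he => hne (congrFun he (s, t))
      exact_mod_cast this
    · push Not at h1
      obtain ⟨hb, s, t, h0, hne⟩ := h1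
      rw [arcInc, relEntropy_eq_top fun h => hne (h (s, t) (by simp [h0]))]
      exact EReal.mul_top_of_pos (lt_of_le_of_ne (hM a).1 hb.symm)
  rw [score, obsInc_eq, EReal.finsetSum_eq_top (Finset.mem_univ a) key fun b _ =>
    mul_nonneg (hM b).1 (arcInc_nonneg b μ)]
  exact EReal.top_add_of_ne_bot (EReal.coe_ne_bot _)

lemma continuous_logLik (a : G.Arc) : Continuous fun μ : G.Dist => M.logLik a μ :=
  continuous_finsetSum _ fun w _ => (Dist.continuous_apply w).mul continuous_const

lemma continuous_val (γ : ℝ) : Continuous fun μ : G.Dist => M.val γ μ :=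
  (continuous_finsetSum _ fun a _ =>
    (continuous_const.mul (Dist.continuous_condEntropy _ _)).sub
      (continuous_const.mul (continuous_logLik a))).sub
    (continuous_const.mul Dist.continuous_entropy)

lemma isClosed_feas : IsClosed M.Feas := by
  simp only [Feas, ofPred_forall, ofPred_and]
  refine isClosed_iInter fun a => IsClosed.inter ?_ ?_
  · exact isClosed_iInter fun _ => isClosed_iInter fun s => isClosed_iInter fun t =>
      isClosed_iInter fun _ => isClosed_eq (Dist.continuous_pr2 _ _ _ _) continuous_const
  · exact isClosed_iInter fun _ => isClosed_iInter fun s => isClosed_iInter fun t =>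
      isClosed_eq (Dist.continuous_pr2 _ _ _ _) (continuous_const.mul (Dist.continuous_pr _ _))

lemma isCompact_feas : IsCompact M.Feas := isClosed_feas.isCompact

variable {μ ν : G.Dist} {t : ℝ}

lemma mix_mem_feas (hμ : μ ∈ M.Feas) (hν : ν ∈ M.Feas) (ht : t ∈ Icc (0 : ℝ) 1) :
    μ.mix ν t ht ∈ M.Feas := by
  intro a
  refine ⟨fun hb s r h0 => ?_, fun hb s r => ?_⟩
  · rw [Dist.mix_pr2, (hμ a).1 hb s r h0, (hν a).1 hb s r h0]; ring
  · rw [Dist.mix_pr2, Dist.mix_pr, (hμ a).2 hb s r, (hν a).2 hb s r]; ring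

lemma logLik_mix (a : G.Arc) (ht : t ∈ Icc (0 : ℝ) 1) :
    M.logLik a (μ.mix ν t ht) = (1 - t) * M.logLik a μ + t * M.logLik a ν := by
  simp only [logLik, Dist.mix_apply, Finset.mul_sum, ← Finset.sum_add_distrib]
  exact Finset.sum_congr rfl fun w _ => by ring

/-- The score of a proper PDG in the convex range is `γ`-strongly convex relative to the negative
entropy. -/
lemma val_mix_le {γ : ℝ} (hM : M.Cvx (.real γ)) (hμ : μ ∈ M.Feas) (hν : ν ∈ M.Feas)
    (ht : t ∈ Icc (0 : ℝ) 1) :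
    M.val γ (μ.mix ν t ht)
      + γ * ((1 - t) * μ.kl (μ.mix ν t ht) + t * ν.kl (μ.mix ν t ht))
      ≤ (1 - t) * M.val γ μ + t * M.val γ ν := by
  obtain ⟨hP, hγ, hα⟩ := hM
  set m := μ.mix ν t ht with hm
  -- A nonpositive coefficient times a concave function is convex. For `β = ⊤` the coefficient `γ α`
  -- may be positive, but then the conditional entropy is linear along the mixture.
  have key : ∀ a, (γ * M.alpha a - (M.beta a).toReal) * m.condEntropy (G.src a) (G.tgt a) ≤
      (1 - t) * ((γ * M.alpha a - (M.beta a).toReal) * μ.condEntropy (G.src a) (G.tgt a))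
      + t * ((γ * M.alpha a - (M.beta a).toReal) * ν.condEntropy (G.src a) (G.tgt a)) := by
    intro a
    by_cases htop : M.beta a = ⊤
    · rw [condEntropy_of_eq ((hμ a).2 htop), condEntropy_of_eq ((hν a).2 htop),
        condEntropy_of_eq ((mix_mem_feas hμ hν ht a).2 htop), logLik_mix]
      exact le_of_eq (by ring)
    · have hbot : M.beta a ≠ ⊥ := fun h => by
        have := (hP a).1
        rw [h] at this
        exact absurd this (by simp)
      have hc : γ * M.alpha a - (M.beta a).toReal ≤ 0 := by
        rcases le_or_gt (M.alpha a) 0 with h | h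
        · have := EReal.toReal_nonneg (hP a).1
          have := mul_nonpos_of_nonneg_of_nonpos hγ.le h
          linarith
        · have := hα a h
          rw [← EReal.coe_toReal htop hbot, EReal.coe_lt_coe_iff] at this
          linarith
      have := mul_le_mul_of_nonpos_left (Dist.condEntropy_mix_ge μ ν ht (G.src a) (G.tgt a)) hc
      rw [← hm] at this
      linarith
  have hsum := Finset.sum_le_sum fun a (_ : a ∈ Finset.univ) => key a
  have hH := Dist.entropy_mix μ ν ht
  rw [← hm] at hH
  simp only [val, Finset.sum_sub_distrib, hm ▸ logLik_mix (M := M) (μ := μ) (ν := ν) _ ht]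
  rw [hH]
  simp only [Finset.sum_add_distrib, ← Finset.mul_sum, mul_add] at hsum ⊢
  have e : ∑ a, ((M.beta a).toReal * ((1 - t) * M.logLik a μ)
      + (M.beta a).toReal * (t * M.logLik a ν))
      = (1 - t) * ∑ a, (M.beta a).toReal * M.logLik a μ
        + t * ∑ a, (M.beta a).toReal * M.logLik a ν := by
    simp only [Finset.mul_sum, ← Finset.sum_add_distrib]
    exact Finset.sum_congr rfl fun a _ => by ring
  rw [Finset.sum_add_distrib] at e
  linarith

lemma mix_ac (ht : t ∈ Ioo (0 : ℝ) 1) (w : G.World)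
    (h : (μ.mix ν t (Ioo_subset_Icc_self ht)).1 w = 0) : μ.1 w = 0 ∧ ν.1 w = 0 := by
  rw [Dist.mix_apply] at h
  have h1 : 0 < 1 - t := sub_pos.2 ht.2
  have h2 := mul_nonneg h1.le (μ.nonneg w)
  have h3 := mul_nonneg ht.1.le (ν.nonneg w)
  constructor
  · exact (mul_eq_zero.1 (by linarith : (1 - t) * μ.1 w = 0)).resolve_left h1.ne'
  · exact (mul_eq_zero.1 (by linarith : t * ν.1 w = 0)).resolve_left ht.1.ne'

lemma val_mix_le' {γ : ℝ} (hM : M.Cvx (.real γ)) (hμ : μ ∈ M.Feas) (hν : ν ∈ M.Feas)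
    (ht : t ∈ Ioo (0 : ℝ) 1) :
    M.val γ (μ.mix ν t (Ioo_subset_Icc_self ht)) ≤ (1 - t) * M.val γ μ + t * M.val γ ν := by
  refine le_trans ?_ (val_mix_le hM hμ hν (Ioo_subset_Icc_self ht))
  have h1 := μ.kl_nonneg _ fun w h => (mix_ac (μ := μ) (ν := ν) ht w h).1
  have h2 := ν.kl_nonneg _ fun w h => (mix_ac (μ := μ) (ν := ν) ht w h).2
  have := mul_nonneg hM.2.1.le
    (add_nonneg (mul_nonneg (sub_nonneg.2 ht.2.le) h1) (mul_nonneg ht.1.le h2))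
  linarith

lemma half_mem : (1 / 2 : ℝ) ∈ Ioo (0 : ℝ) 1 := ⟨by norm_num, by norm_num⟩

lemma val_half_mix_le {γ : ℝ} (hM : M.Cvx (.real γ)) (hμ : μ ∈ M.Feas) (hν : ν ∈ M.Feas)
    (E : Finset G.World) :
    M.val γ (μ.mix ν (1 / 2) (Ioo_subset_Icc_self half_mem))
      + γ / 4 * (√(∑ w ∈ E, μ.1 w) - √(∑ w ∈ E, ν.1 w)) ^ 2
      ≤ M.val γ μ / 2 + M.val γ ν / 2 := by
  have h0 := val_mix_le hM hμ hν (Ioo_subset_Icc_self half_mem)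
  have h1 := μ.kl_ge _ E fun w h => (mix_ac (μ := μ) (ν := ν) half_mem w h).1
  have h2 := ν.kl_ge _ E fun w h => (mix_ac (μ := μ) (ν := ν) half_mem w h).2
  set m := μ.mix ν (1 / 2) (Ioo_subset_Icc_self half_mem)
  -- Both relative entropies are to the same midpoint, and `(a - m)² + (b - m)² ≥ (a - b)² / 2`
  -- whatever `m` is.
  have h3 : (√(∑ w ∈ E, μ.1 w) - √(∑ w ∈ E, ν.1 w)) ^ 2 / 4 ≤
      (1 - 1 / 2) * μ.kl m + 1 / 2 * ν.kl m := by
    nlinarith [sq_nonneg (√(∑ w ∈ E, μ.1 w) + √(∑ w ∈ E, ν.1 w) - 2 * √(∑ w ∈ E, m.1 w))]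
  have := mul_le_mul_of_nonneg_left h3 hM.2.1.le
  linarith

end PDG
end

noncomputable section

/-! ## Existence and uniqueness of the optimal distribution -/

namespace PDG

open VarGraph

variable {G : VarGraph} {M : PDG G} {μ ν : G.Dist} {γ : ℝ}

lemma feas_nonempty (hM : M.Proper) (h : M.inc γ ≠ ⊤) : M.Feas.Nonempty := by
  by_contra hne
  rw [not_nonempty_iff_eq_empty] at hne
  exact h (iInf_eq_top.2 fun μ => score_of_notMem (by simp [hne]) hM γ)

lemma inc_le (hM : M.Proper) (hμ : μ ∈ M.Feas) : M.inc γ ≤ (M.val γ μ : EReal) :=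
  (iInf_le _ μ).trans_eq (score_of_mem hμ hM γ)

lemma le_inc (hM : M.Proper) {c : ℝ} (h : ∀ ν ∈ M.Feas, c ≤ M.val γ ν) : (c : EReal) ≤ M.inc γ := by
  refine le_iInf fun ν => ?_
  by_cases hν : ν ∈ M.Feas
  · rw [score_of_mem hν hM]
    exact_mod_cast h ν hν
  · rw [score_of_notMem hν hM]
    exact le_top

lemma inc_eq (hM : M.Proper) (hμ : μ ∈ M.Feas) (h : ∀ ν ∈ M.Feas, M.val γ μ ≤ M.val γ ν) :
    M.inc γ = (M.val γ μ : EReal) :=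
  le_antisymm (inc_le hM hμ) (le_inc hM h)

lemma exists_val_min (γ : ℝ) (h : M.Feas.Nonempty) :
    ∃ μ ∈ M.Feas, ∀ ν ∈ M.Feas, M.val γ μ ≤ M.val γ ν := by
  obtain ⟨μ, hμ, hmin⟩ := isCompact_feas.exists_isMinOn h (continuous_val (M := M) γ).continuousOn
  exact ⟨μ, hμ, fun ν hν => hmin hν⟩

lemma mem_optReal_iff (hM : M.Proper) (hne : M.Feas.Nonempty) :
    μ ∈ M.optReal γ ↔ μ ∈ M.Feas ∧ ∀ ν ∈ M.Feas, M.val γ μ ≤ M.val γ ν := by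
  constructor
  · intro h
    obtain ⟨ν₀, hν₀⟩ := hne
    have hμ : μ ∈ M.Feas := by
      by_contra hμ
      have := h ν₀
      rw [score_of_notMem hμ hM, score_of_mem hν₀ hM] at this
      exact absurd this (by simp)
    refine ⟨hμ, fun ν hν => ?_⟩
    have := h ν
    rw [score_of_mem hμ hM, score_of_mem hν hM] at this
    exact_mod_cast this
  · rintro ⟨hμ, h⟩ ν
    rw [score_of_mem hμ hM]
    by_cases hν : ν ∈ M.Feas
    · rw [score_of_mem hν hM]
      exact_mod_cast h ν hν
    · rw [score_of_notMem hν hM]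
      exact le_top

lemma dist_ext (h : ∀ w, (√(∑ v ∈ {w}, μ.1 v) - √(∑ v ∈ {w}, ν.1 v)) ^ 2 ≤ 0) : μ = ν := by
  refine Subtype.ext (funext fun w => ?_)
  have h0 := pow_eq_zero_iff two_ne_zero |>.1 (le_antisymm (h w) (sq_nonneg _))
  simpa [Real.sqrt_inj (μ.nonneg w) (ν.nonneg w), sub_eq_zero] using h0

/-- Distance from the optimum is controlled by the excess score. -/
lemma val_growth (hM : M.Cvx (.real γ)) (hμ : μ ∈ M.Feas)
    (hmin : ∀ ν ∈ M.Feas, M.val γ μ ≤ M.val γ ν) (hν : ν ∈ M.Feas) (E : Finset G.World) :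
    M.val γ μ + γ / 2 * (√(∑ w ∈ E, ν.1 w) - √(∑ w ∈ E, μ.1 w)) ^ 2 ≤ M.val γ ν := by
  have h1 := val_half_mix_le hM hν hμ E
  have h2 := hmin _ (mix_mem_feas hν hμ (Ioo_subset_Icc_self half_mem))
  linarith

lemma optReal_eq (hM : M.Cvx (.real γ)) (hμ : μ ∈ M.Feas)
    (hmin : ∀ ν ∈ M.Feas, M.val γ μ ≤ M.val γ ν) : M.optReal γ = {μ} := by
  ext ν
  rw [mem_singleton_iff, mem_optReal_iff hM.1 ⟨μ, hμ⟩]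
  constructor
  · rintro ⟨hν, h⟩
    refine dist_ext fun w => ?_
    have h1 := val_growth hM hμ hmin hν {w}
    have h2 := h μ hμ
    have h3 : γ / 2 * (√(∑ v ∈ {w}, ν.1 v) - √(∑ v ∈ {w}, μ.1 v)) ^ 2 ≤ 0 := by linarith
    exact nonpos_of_mul_nonpos_right h3 (half_pos hM.2.1)
  · rintro rfl
    exact ⟨hμ, hmin⟩

lemma val_eq_add (γ : ℝ) (μ : G.Dist) : M.val γ μ = M.val 0 μ + γ * M.structInc μ := by
  have : ∀ a, (γ * M.alpha a - (M.beta a).toReal) * μ.condEntropy (G.src a) (G.tgt a)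
      - (M.beta a).toReal * M.logLik a μ =
      ((0 * M.alpha a - (M.beta a).toReal) * μ.condEntropy (G.src a) (G.tgt a)
      - (M.beta a).toReal * M.logLik a μ)
      + γ * (M.alpha a * μ.condEntropy (G.src a) (G.tgt a)) := fun a => by ring
  simp only [val, structInc, Finset.sum_congr rfl fun a _ => this a, Finset.sum_add_distrib,
    ← Finset.mul_sum]
  ring

lemma continuous_structInc : Continuous fun μ : G.Dist => M.structInc μ :=
  (continuous_finsetSum _ fun _ _ => continuous_const.mul (Dist.continuous_condEntropy _ _)).sub
    Dist.continuous_entropy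

lemma eventually_cvx (hM : M.Proper) : ∀ᶠ g in 𝓝[>] (0 : ℝ), M.Cvx (.real g) := by
  have h : ∀ a, ∀ᶠ g in 𝓝[>] (0 : ℝ), 0 < M.alpha a → ((g * M.alpha a : ℝ) : EReal) < M.beta a := by
    intro a
    by_cases ha : 0 < M.alpha a
    · have hc : Tendsto (fun g : ℝ => ((g * M.alpha a : ℝ) : EReal)) (𝓝[>] 0) (𝓝 0) := by
        have : Continuous fun g : ℝ => ((g * M.alpha a : ℝ) : EReal) :=
          continuous_coe_real_ereal.comp (continuous_id.mul continuous_const)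
        simpa using (this.tendsto 0).mono_left nhdsWithin_le_nhds
      filter_upwards [hc.eventually (gt_mem_nhds ((hM a).2 ha))] with g hg _ using hg
    · exact Eventually.of_forall fun g h => absurd h ha
  filter_upwards [eventually_all.2 h, self_mem_nhdsWithin] with g hg hpos using ⟨hM, hpos, hg⟩

/-- As `γ → 0` the optimal distributions converge to the distribution of least structural
incompatibility among those of least observational incompatibility. -/
lemma exists_tendsto_opt (hM : M.Proper) (hne : M.Feas.Nonempty) :
    ∃ μ ∈ M.Feas, (∀ ν ∈ M.Feas, M.val 0 μ ≤ M.val 0 ν) ∧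
      ∀ m : ℝ → G.Dist, (∀ᶠ g in 𝓝[>] (0 : ℝ), m g ∈ M.optReal g) →
        Tendsto m (𝓝[>] 0) (𝓝 μ) := by
  obtain ⟨μ₀, hμ₀, hmin₀⟩ := exists_val_min (M := M) 0 hne
  -- The limit is found by minimizing in two stages: the structural incompatibility among the
  -- minimizers of `val 0`.
  have hcl : IsClosed {μ : G.Dist | M.val 0 μ ≤ M.val 0 μ₀} :=
    isClosed_le (continuous_val 0) continuous_const
  obtain ⟨μ, ⟨hμ, hμv⟩, hμmin⟩ := (isCompact_feas.inter_right hcl).exists_isMinOn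
    ⟨μ₀, hμ₀, by simp⟩ (continuous_structInc (M := M)).continuousOn
  have hv : ∀ ν ∈ M.Feas, M.val 0 μ ≤ M.val 0 ν := fun ν hν => le_trans hμv (hmin₀ ν hν)
  refine ⟨μ, hμ, hv, fun m hm => ?_⟩
  have hm' : ∀ᶠ g in 𝓝[>] (0 : ℝ), m g ∈ M.Feas ∧ ∀ ν ∈ M.Feas, M.val g (m g) ≤ M.val g ν := by
    filter_upwards [hm] with g hg using (mem_optReal_iff hM hne).1 hg
  -- By compactness it suffices to identify every cluster point; an ultrafilter turns a cluster
  -- point into a limit.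
  refine isCompact_feas.tendsto_nhds_of_unique_mapClusterPt (hm'.mono fun g h => h.1) ?_
  intro y hy hcl
  obtain ⟨U, hU, hUy⟩ := mapClusterPt_iff_ultrafilter.1 hcl
  have hg0 : Tendsto (fun g : ℝ => g) U (𝓝 0) := tendsto_id'.2 (hU.trans nhdsWithin_le_nhds)
  -- `m g` is optimal at `g` while μ is optimal for `val 0`, so `m g` can only win through its
  -- structural term.
  have hB : M.structInc y ≤ M.structInc μ := by
    refine le_of_tendsto ((continuous_structInc (M := M)).continuousAt.tendsto.comp hUy) ?_
    filter_upwards [hU hm', hU self_mem_nhdsWithin] with g hg hpos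
    have h1 := hg.2 μ hμ
    rw [val_eq_add g, val_eq_add g μ] at h1
    have h2 := hv _ hg.1
    exact le_of_mul_le_mul_left (by linarith : g * M.structInc (m g) ≤ g * M.structInc μ) hpos
  have hA : M.val 0 y ≤ M.val 0 μ := by
    have t1 := ((continuous_val (M := M) 0).tendsto y).comp hUy
    have t2 := (hg0.mul (((continuous_structInc (M := M)).tendsto y).comp hUy
      |>.const_sub (M.structInc μ))).const_add (M.val 0 μ)
    rw [zero_mul, add_zero] at t2
    refine le_of_tendsto_of_tendsto t1 t2 ?_
    filter_upwards [hU hm'] with g hg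
    have h1 := hg.2 μ hμ
    rw [val_eq_add g, val_eq_add g μ] at h1
    simp only [Function.comp]
    linarith
  refine dist_ext fun w => ?_
  set mid := y.mix μ (1 / 2) (Ioo_subset_Icc_self half_mem)
  have hmid : mid ∈ M.Feas := mix_mem_feas hy hμ _
  set d := (√(∑ v ∈ {w}, y.1 v) - √(∑ v ∈ {w}, μ.1 v)) ^ 2
  have hd : 0 ≤ d := sq_nonneg _
  -- `mid` does not depend on `g`. Letting `g → 0` shows that `mid` again minimizes `val 0`;
  -- dividing by `g` then shows that `mid` undercuts the minimal structural incompatibility by `d /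
  -- 4`, which forces `d = 0`.
  have hall : ∀ᶠ g in 𝓝[>] (0 : ℝ), M.val 0 mid + g * (M.structInc mid + d / 4) ≤
      M.val 0 μ + g * M.structInc μ := by
    filter_upwards [eventually_cvx hM, self_mem_nhdsWithin] with g hg hpos
    have h1 := val_half_mix_le hg hy hμ {w}
    rw [val_eq_add g, val_eq_add g y, val_eq_add g μ] at h1
    have h2 := mul_le_mul_of_nonneg_left hB (le_of_lt hpos)
    have : M.val 0 mid + g * M.structInc mid + g / 4 * d ≤
      (M.val 0 y + g * M.structInc y) / 2 + (M.val 0 μ + g * M.structInc μ) / 2 := h1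
    linarith
  have hmidA : M.val 0 mid ≤ M.val 0 μ := by
    have hid : Tendsto (fun g : ℝ => g) (𝓝[>] 0) (𝓝 0) := tendsto_id'.2 nhdsWithin_le_nhds
    have t1 := (hid.mul_const (M.structInc mid + d / 4)).const_add (M.val 0 mid)
    have t2 := (hid.mul_const (M.structInc μ)).const_add (M.val 0 μ)
    simp only [zero_mul, add_zero] at t1 t2
    exact le_of_tendsto_of_tendsto t1 t2 hall
  obtain ⟨g, hg, hpos⟩ := (hall.and self_mem_nhdsWithin).exists
  have h1 : M.structInc μ ≤ M.structInc mid := hμmin ⟨hmid, hmidA.trans hμv⟩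
  have h2 := hv mid hmid
  have h3 : g * (M.structInc mid + d / 4) ≤ g * M.structInc μ := by linarith
  have h4 := le_of_mul_le_mul_left h3 hpos
  linarith

/-- The optimal distribution exists, is unique, and attains the inconsistency. -/
lemma exists_opt {γ : TradeOff} (hM : M.Cvx γ) (h : M.inc γ.toReal ≠ ⊤) :
    ∃ μ ∈ M.Feas, M.opt γ = {μ} ∧ ∀ ν ∈ M.Feas, M.val γ.toReal μ ≤ M.val γ.toReal ν := by
  have hne := feas_nonempty hM.1 h
  cases γ with
  | real g =>
    obtain ⟨μ, hμ, hmin⟩ := exists_val_min (M := M) g hne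
    exact ⟨μ, hμ, optReal_eq hM hμ hmin, hmin⟩
  | zeroPlus =>
    obtain ⟨μ, hμ, hmin, ht⟩ := exists_tendsto_opt hM.1 hne
    refine ⟨μ, hμ, ?_, hmin⟩
    -- Minimizers exist by compactness for every real `g`; convexity is needed only for their
    -- convergence.
    choose m hm hmm using fun g : ℝ => exists_val_min (M := M) g hne
    have hopt : ∀ᶠ g in 𝓝[>] (0 : ℝ), m g ∈ M.optReal g :=
      Eventually.of_forall fun g => (mem_optReal_iff hM.1 hne).2 ⟨hm g, hmm g⟩
    ext ν
    rw [mem_singleton_iff]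
    constructor
    · rintro ⟨m', h1, h2⟩
      exact tendsto_nhds_unique h2 (ht m' h1)
    · rintro rfl
      exact ⟨m, hopt, ht m hopt⟩

end PDG
end

noncomputable section

/-! ## The inconsistency after adding a belief -/

lemma relEntropy_comp_equiv {ι κ : Type} [Fintype ι] [Fintype κ] (e : ι ≃ κ) (q r : κ → ℝ) :
    relEntropy (fun i => q (e i)) (fun i => r (e i)) = relEntropy q r := by
  have h : (∀ i, r (e i) = 0 → q (e i) = 0) ↔ ∀ k, r k = 0 → q k = 0 :=
    e.forall_congr_left.trans (by simp)
  by_cases hk : ∀ k, r k = 0 → q k = 0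
  · rw [relEntropy_eq_coe hk, relEntropy_eq_coe (h.2 hk),
      e.sum_comp fun k => klTerm (q k) (r k)]
  · rw [relEntropy_eq_top hk, relEntropy_eq_top fun h' => hk (h.1 h')]

lemma relEntropy_self {ι : Type} [Fintype ι] (q : ι → ℝ) : relEntropy q q = 0 := by
  rw [relEntropy_eq_coe fun _ h => h]
  simp

namespace VarGraph

variable {G : VarGraph} {U : Finset G.Var}

/-- The world of the old variables. -/
def under (w : (G.addEvent U).World) : G.World := fun x => w (some x)

/-- The value of the new variable. -/
def newBit (w : (G.addEvent U).World) : Bool := w none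

/-- The world that extends `w` by a value of the new variable. -/
def extendBy (U : Finset G.Var) (b : Bool) (w : G.World) : (G.addEvent U).World
  | none => b
  | some x => w x

@[simp] lemma under_extendBy (b : Bool) (w : G.World) : under (extendBy U b w) = w := rfl

@[simp] lemma newBit_extendBy (b : Bool) (w : G.World) : newBit (extendBy U b w) = b := rfl

lemma extendBy_under (w : (G.addEvent U).World) : extendBy U (newBit w) (under w) = w := by
  funext o
  cases o <;> rfl

/-- Worlds of the extended hypergraph. -/
def extendEquiv (U : Finset G.Var) : Bool × G.World ≃ (G.addEvent U).World where
  toFun z := extendBy U z.1 z.2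
  invFun w := (newBit w, under w)
  left_inv _ := rfl
  right_inv w := extendBy_under w

lemma sum_addEvent (f : (G.addEvent U).World → ℝ) : ∑ w, f w = ∑ w, ∑ b, f (extendBy U b w) := by
  rw [← (extendEquiv U).sum_comp, Fintype.sum_prod_type, Finset.sum_comm]
  rfl

variable (U) in
/-- The copies of the variables in `S`. -/
def old (S : Finset G.Var) : Finset (G.addEvent U).Var := S.map Function.Embedding.some

variable (U) in
/-- The set of the new variable. -/
def new : Finset (G.addEvent U).Var := ({none} : Finset (Option G.Var))

/-- Settings of copies of variables. -/
def oldEquiv (S : Finset G.Var) : (G.addEvent U).Setting (old U S) ≃ G.Setting S :=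
  OptSetting.pullEquiv S

/-- Settings of the new variable. -/
def newEquiv : (G.addEvent U).Setting (new U) ≃ Bool := OptSetting.bitEquiv G

namespace Dist

variable (U) (u : G.Setting U) (μ : G.Dist)

/-- The extension of `μ` in which the new variable is the indicator of `U = u`. -/
def lift : (G.addEvent U).Dist :=
  ⟨fun w => if newBit w = decide (restrict U (under w) = u) then μ.1 (under w) else 0,
    fun w => by dsimp only; split_ifs; exacts [μ.nonneg _, le_rfl],
    by
      rw [sum_addEvent, ← μ.sum_eq_one]
      refine Finset.sum_congr rfl fun w _ => ?_
      rw [Fintype.sum_bool, newBit_extendBy, newBit_extendBy, under_extendBy, under_extendBy]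
      by_cases h : restrict U w = u <;> simp [h]⟩

lemma lift_apply (w : (G.addEvent U).World) : (lift U u μ).1 w =
    if newBit w = decide (restrict U (under w) = u) then μ.1 (under w) else 0 := rfl

/-- Only one of the two extensions of a world carries mass, and `F w 0 = 0` discards the other. -/
lemma sum_lift (F : (G.addEvent U).World → ℝ → ℝ) (hF : ∀ w, F w 0 = 0) :
    ∑ w, F w ((lift U u μ).1 w) = ∑ w, F (extendBy U (decide (restrict U w = u)) w) (μ.1 w) := by
  rw [sum_addEvent]
  refine Finset.sum_congr rfl fun w _ => ?_
  rw [Finset.sum_eq_single (decide (restrict U w = u))]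
  · rw [lift_apply, newBit_extendBy, under_extendBy, if_pos rfl]
  · intro b _ hb
    rw [lift_apply, newBit_extendBy, under_extendBy, if_neg hb, hF]
  · simp

lemma restrict_old_eq_iff (S : Finset G.Var) (w : (G.addEvent U).World)
    (s : (G.addEvent U).Setting (old U S)) :
    restrict (old U S) w = s ↔ restrict S (under w) = oldEquiv S s :=
  (oldEquiv S).injective.eq_iff.symm

lemma restrict_new_eq_iff (w : (G.addEvent U).World) (t : (G.addEvent U).Setting (new U)) :
    restrict (new U) w = t ↔ newBit w = newEquiv t :=
  newEquiv.injective.eq_iff.symm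

lemma lift_pr2_old (S T : Finset G.Var) (s : (G.addEvent U).Setting (old U S))
    (t : (G.addEvent U).Setting (old U T)) :
    (lift U u μ).pr2 (old U S) (old U T) s t = μ.pr2 S T (oldEquiv S s) (oldEquiv T t) := by
  rw [pr2, sum_lift U u μ (fun w x => if restrict (old U S) w = s ∧
    restrict (old U T) w = t then x else 0) (by simp)]
  simp only [restrict_old_eq_iff, under_extendBy]
  rfl

lemma lift_pr_old (S : Finset G.Var) (s : (G.addEvent U).Setting (old U S)) :
    (lift U u μ).pr (old U S) s = μ.pr S (oldEquiv S s) := by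
  rw [pr, sum_lift U u μ (fun w x => if restrict (old U S) w = s then x else 0) (by simp)]
  simp only [restrict_old_eq_iff, under_extendBy]
  rfl

lemma lift_pr2_indicator (s : (G.addEvent U).Setting (old U U))
    (t : (G.addEvent U).Setting (new U)) :
    (lift U u μ).pr2 (old U U) (new U) s t
      = (if newEquiv t = decide (oldEquiv U s = u) then 1 else 0) * μ.pr U (oldEquiv U s) := by
  rw [pr2, sum_lift U u μ (fun w x => if restrict (old U U) w = s ∧
    restrict (new U) w = t then x else 0) (by simp), pr, Finset.mul_sum]
  refine Finset.sum_congr rfl fun w _ => ?_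
  simp only [restrict_old_eq_iff, restrict_new_eq_iff, under_extendBy, newBit_extendBy]
  by_cases h : restrict U w = oldEquiv U s
  · simp [h, eq_comm]
  · simp [h]

lemma sum_ite_pr (b : Bool) :
    ∑ w, (if decide (restrict U w = u) = b then μ.1 w else 0)
      = if b = true then μ.pr U u else 1 - μ.pr U u := by
  cases b
  · rw [← μ.sum_eq_one]
    simp only [pr, ← Finset.sum_sub_distrib]
    simp only [decide_eq_false_iff_not, Bool.false_eq_true, if_false]
    exact Finset.sum_congr rfl fun w _ => by split_ifs <;> simp_all
  · simp [pr]

lemma restrict_empty (w : G.World) (s : G.Setting ∅) : restrict ∅ w = s := by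
  funext x
  exact absurd x.2 (Finset.notMem_empty _)

lemma lift_pr2_empty (s : (G.addEvent U).Setting ∅) (t : (G.addEvent U).Setting (new U)) :
    (lift U u μ).pr2 ∅ (new U) s t
      = if newEquiv t = true then μ.pr U u else 1 - μ.pr U u := by
  rw [pr2, sum_lift U u μ (fun w x => if restrict ∅ w = s ∧
    restrict (new U) w = t then x else 0) (by simp), ← sum_ite_pr]
  refine Finset.sum_congr rfl fun w _ => ?_
  simp only [restrict_empty _ s, restrict_new_eq_iff, newBit_extendBy, true_and]

lemma pr_empty (ν : G.Dist) (s : G.Setting ∅) : ν.pr ∅ s = 1 := by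
  rw [← ν.sum_eq_one]
  exact Finset.sum_congr rfl fun w _ => if_pos (restrict_empty w s)

lemma lift_entropy : (lift U u μ).entropy = μ.entropy :=
  sum_lift U u μ (fun _ x => Real.negMulLog x) (by simp)

lemma lift_condEntropy (S T : Finset G.Var) :
    (lift U u μ).condEntropy (old U S) (old U T) = μ.condEntropy S T := by
  simp only [condEntropy, lift_pr2_old, lift_pr_old]
  rw [← (oldEquiv (U := U) S).sum_comp]
  refine Finset.sum_congr rfl fun s _ => ?_
  rw [← (oldEquiv (U := U) T).sum_comp]

/-- A distribution in which the new variable is the indicator of `U = u` is an extension. -/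
lemma exists_lift_eq (ν : (G.addEvent U).Dist)
    (h : ∀ w, newBit w ≠ decide (restrict U (under w) = u) → ν.1 w = 0) :
    ∃ μ, lift U u μ = ν := by
  refine ⟨⟨fun w => ∑ b, ν.1 (extendBy U b w), fun w => Finset.sum_nonneg fun b _ => ν.nonneg _,
    by rw [← sum_addEvent, ν.sum_eq_one]⟩, Subtype.ext (funext fun w => ?_)⟩
  simp only [lift]
  split_ifs with hw
  · rw [Finset.sum_eq_single (newBit w), extendBy_under]
    · intro b _ hb
      refine h _ ?_
      rwa [newBit_extendBy, under_extendBy, ← hw]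
    · simp
  · exact (h w hw).symm

end Dist

end VarGraph

namespace PDG

open VarGraph

variable {G : VarGraph} {M : PDG G} {U : Finset G.Var} {u : G.Setting U} {p : ℝ}
  {hp : p ∈ Icc (0 : ℝ) 1} {γ : ℝ}

lemma addProb_proper (hM : M.Proper) : (M.addProb U u p hp).Proper := by
  rintro (a | b)
  · exact hM a
  · exact ⟨zero_le_one, fun _ => zero_lt_one⟩

lemma addProb_arcInc_inl (a : G.Arc) (μ : G.Dist) :
    (M.addProb U u p hp).arcInc (.inl a) (Dist.lift U u μ) = M.arcInc a μ := by
  have h := relEntropy_comp_equiv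
    ((oldEquiv (U := U) (G.src a)).prodCongr (oldEquiv (U := U) (G.tgt a)))
    (fun st => μ.pr2 (G.src a) (G.tgt a) st.1 st.2)
    (fun st => M.cpd a st.1 st.2 * μ.pr (G.src a) st.1)
  refine Eq.trans ?_ h
  refine congrArg₂ relEntropy (funext fun st => ?_) (funext fun st => ?_)
  · exact Dist.lift_pr2_old U u μ _ _ st.1 st.2
  · exact congrArg _ (Dist.lift_pr_old U u μ _ st.1)

lemma addProb_arcInc_true (μ : G.Dist) :
    (M.addProb U u p hp).arcInc (.inr true) (Dist.lift U u μ) = 0 := by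
  refine Eq.trans ?_ (relEntropy_self fun st :
    (G.addEvent U).Setting (old U U) × (G.addEvent U).Setting (new U) =>
      (Dist.lift U u μ).pr2 (old U U) (new U) st.1 st.2)
  refine congrArg₂ relEntropy rfl (funext fun st => ?_)
  refine Eq.trans ?_ (Dist.lift_pr2_indicator U u μ st.1 st.2).symm
  exact congrArg _ (Dist.lift_pr_old U u μ _ st.1)

lemma addProb_arcInc_false (h : p ∈ Ioo (0 : ℝ) 1) (μ : G.Dist) :
    (M.addProb U u p hp).arcInc (.inr false) (Dist.lift U u μ)
      = ((binKL (μ.pr U u) p : ℝ) : EReal) := by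
  have h1 : (M.addProb U u p hp).arcInc (.inr false) (Dist.lift U u μ) = relEntropy
      (fun st : (G.addEvent U).Setting ∅ × (G.addEvent U).Setting (new U) =>
        if newEquiv st.2 = true then μ.pr U u else 1 - μ.pr U u)
      (fun st => if newEquiv st.2 = true then p else 1 - p) := by
    refine congrArg₂ relEntropy (funext fun st => ?_) (funext fun st => ?_)
    · exact Dist.lift_pr2_empty U u μ st.1 st.2
    · have : (Dist.lift U u μ).pr ∅ st.1 = 1 := Dist.pr_empty _ _
      exact (congrArg _ this).trans (mul_one _)
  rw [h1, relEntropy_eq_coe]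
  · congr 1
    rw [Fintype.sum_prod_type]
    have : Unique ((G.addEvent U).Setting ∅) :=
      { default := fun x => absurd x.2 (Finset.notMem_empty _)
        uniq := fun s => funext fun x => absurd x.2 (Finset.notMem_empty _) }
    rw [Fintype.sum_unique]
    refine (newEquiv.sum_comp fun b =>
      klTerm (if b = true then μ.pr U u else 1 - μ.pr U u) (if b = true then p else 1 - p)).trans ?_
    simp [binKL]
  · intro st hst
    split_ifs at hst
    · exact absurd hst h.1.ne'
    · exact absurd hst (by linarith [h.2])

/-- The indicator arc costs nothing and the arc asserting `p` costs a binary relative entropy. The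
new variable is a function of the old ones, so the entropies do not change. -/
lemma addProb_score_lift (h : p ∈ Ioo (0 : ℝ) 1) (μ : G.Dist) :
    (M.addProb U u p hp).score γ (Dist.lift U u μ)
      = M.score γ μ + ((binKL (μ.pr U u) p : ℝ) : EReal) := by
  have h1 : (M.addProb U u p hp).obsInc (Dist.lift U u μ)
      = M.obsInc μ + ((binKL (μ.pr U u) p : ℝ) : EReal) := by
    rw [obsInc_eq, obsInc_eq]
    refine (Fintype.sum_sum_type _).trans (congrArg₂ _ ?_ ?_)
    · exact Finset.sum_congr rfl fun a _ => congrArg _ (addProb_arcInc_inl a μ)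
    · rw [Fintype.sum_bool, addProb_arcInc_true, addProb_arcInc_false h, mul_zero, zero_add]
      exact one_mul _
  have h2 : (M.addProb U u p hp).structInc (Dist.lift U u μ) = M.structInc μ := by
    rw [structInc, structInc, Dist.lift_entropy]
    refine congrArg (· - μ.entropy) ((Fintype.sum_sum_type _).trans ?_)
    refine (congrArg₂ (· + ·) (Finset.sum_congr rfl fun a _ =>
      congrArg _ (Dist.lift_condEntropy U u μ (G.src a) (G.tgt a)))
      (Finset.sum_eq_zero fun b _ => zero_mul _)).trans (add_zero _)
  rw [score, score, h1, h2, add_right_comm]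

lemma addProb_inc_le (hM : M.Proper) (h : p ∈ Ioo (0 : ℝ) 1) {μ : G.Dist} (hμ : μ ∈ M.Feas) :
    (M.addProb U u p hp).inc γ ≤ ((M.val γ μ + binKL (μ.pr U u) p : ℝ) : EReal) := by
  refine (iInf_le _ (Dist.lift U u μ)).trans_eq ?_
  rw [addProb_score_lift h, score_of_mem hμ hM, EReal.coe_add]

/-- A distribution that is not an extension violates the deterministic arc and has infinite score.
Together with `addProb_inc_le` this makes the new inconsistency the infimum of `val μ + binKL (μ(u))
p` over feasible μ. -/
lemma le_addProb_inc (hM : M.Proper) (h : p ∈ Ioo (0 : ℝ) 1) {c : ℝ}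
    (hc : ∀ μ ∈ M.Feas, c ≤ M.val γ μ + binKL (μ.pr U u) p) :
    (c : EReal) ≤ (M.addProb U u p hp).inc γ := by
  refine le_iInf fun ν => ?_
  by_cases hν : ν ∈ (M.addProb U u p hp).Feas
  · obtain ⟨μ, rfl⟩ := Dist.exists_lift_eq U u ν (by
      intro w hw
      refine le_antisymm ?_ (ν.nonneg w)
      have h1 : ν.pr2 (old U U) (new U) (VarGraph.restrict (old U U) w)
          (VarGraph.restrict (new U) w) = 0 :=
        (hν (.inr true)).1 one_ne_zero (VarGraph.restrict (old U U) w)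
          (VarGraph.restrict (new U) w) (if_neg hw)
      rw [← h1, Dist.pr2_restrict]
      exact ν.le_pr _ w)
    rw [addProb_score_lift h]
    by_cases hμ : μ ∈ M.Feas
    · rw [score_of_mem hμ hM, ← EReal.coe_add]
      exact_mod_cast hc μ hμ
    · rw [score_of_notMem hμ hM, EReal.top_add_of_ne_bot (EReal.coe_ne_bot _)]
      exact le_top
  · rw [score_of_notMem hν (addProb_proper hM)]
    exact le_top

end PDG
end

noncomputable section

/-! ## The inconsistency as a function of the added probability -/

/-- Write `a - b = (√a - √b)(√a + √b)` and use `√a + √b ≤ 2 √a`. -/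
lemma sq_sub_div_le_sqrt_sub {a b : ℝ} (hb : 0 ≤ b) (hba : b ≤ a) (ha : 0 < a) :
    (a - b) ^ 2 / (4 * a) ≤ (√a - √b) ^ 2 := by
  rw [div_le_iff₀ (by positivity)]
  have h1 := Real.sqrt_le_sqrt hba
  have h2 : (√a + √b) ^ 2 ≤ 4 * a := by
    have := Real.sqrt_nonneg b
    nlinarith [Real.sq_sqrt ha.le]
  have h3 : a - b = (√a - √b) * (√a + √b) := by
    nlinarith [Real.sq_sqrt ha.le, Real.sq_sqrt hb]
  calc (a - b) ^ 2 = (√a - √b) ^ 2 * (√a + √b) ^ 2 := by rw [h3]; ring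
    _ ≤ _ := mul_le_mul_of_nonneg_left h2 (sq_nonneg _)

lemma VarGraph.Dist.pr_eq_sum_filter {G : VarGraph} (μ : G.Dist) (U : Finset G.Var)
    (u : G.Setting U) : μ.pr U u = ∑ w with VarGraph.restrict U w = u, μ.1 w :=
  (Finset.sum_filter _ _).symm

namespace PDG

open VarGraph

variable {G : VarGraph} (M : PDG G) (U : Finset G.Var) (u : G.Setting U)

/-- The inconsistency of `M + (Pr(U = u) = p)`. -/
def addInc (γ p : ℝ) : ℝ :=
  open Classical in if h : p ∈ Icc (0 : ℝ) 1 then ((M.addProb U u p h).inc γ).toReal else 0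

variable {M U u} {γ p q t : ℝ} {μ : G.Dist}

/-- Finiteness: the extension of μ bounds the value from above, and `binKL ≥ 0` bounds it from below
by `val μ`. At `p = 0` or `p = 1` the value may be infinite, so calls are made at inner points only.
-/
lemma addInc_spec (hM : M.Cvx (.real γ)) (hμ : μ ∈ M.Feas)
    (hmin : ∀ ν ∈ M.Feas, M.val γ μ ≤ M.val γ ν) (hp : p ∈ Ioo (0 : ℝ) 1)
    (hp' : p ∈ Icc (0 : ℝ) 1) :
    (M.addProb U u p hp').inc γ = (M.addInc U u γ p : EReal) := by
  rw [addInc, dif_pos hp', EReal.coe_toReal]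
  · intro h
    have := addProb_inc_le (γ := γ) (u := u) (hp := hp') hM.1 hp hμ
    rw [h] at this
    exact EReal.coe_ne_top _ (top_le_iff.1 this)
  · intro h
    have := le_addProb_inc (γ := γ) (u := u) (hp := hp') (c := M.val γ μ) hM.1 hp fun ν hν =>
      (hmin ν hν).trans (le_add_of_nonneg_right (binKL_nonneg (ν.pr_mem U u) hp))
    rw [h] at this
    exact absurd this (by simp)

lemma addInc_le (hM : M.Cvx (.real γ)) (hμ : μ ∈ M.Feas)
    (hmin : ∀ ν ∈ M.Feas, M.val γ μ ≤ M.val γ ν) (hp : p ∈ Ioo (0 : ℝ) 1) {ν : G.Dist}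
    (hν : ν ∈ M.Feas) : M.addInc U u γ p ≤ M.val γ ν + binKL (ν.pr U u) p := by
  have := addProb_inc_le (γ := γ) (u := u) (hp := Ioo_subset_Icc_self hp) hM.1 hp hν
  rw [addInc_spec hM hμ hmin hp] at this
  exact_mod_cast this

lemma le_addInc (hM : M.Cvx (.real γ)) (hμ : μ ∈ M.Feas)
    (hmin : ∀ ν ∈ M.Feas, M.val γ μ ≤ M.val γ ν) (hp : p ∈ Ioo (0 : ℝ) 1) {c : ℝ}
    (hc : ∀ ν ∈ M.Feas, c ≤ M.val γ ν + binKL (ν.pr U u) p) : c ≤ M.addInc U u γ p := by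
  have := le_addProb_inc (γ := γ) (u := u) (hp := Ioo_subset_Icc_self hp) hM.1 hp hc
  rw [addInc_spec hM hμ hmin hp] at this
  exact_mod_cast this

/-- A competitor ν pays `γ/2 (√ν(u) - √μ(u))²` for leaving the optimum and `(√ν(u) - √p)²` for
missing `p`; since `(a - b)² ≤ 2 (a - c)² + 2 (c - b)²`, it cannot make both small. -/
lemma addInc_ge (hM : M.Cvx (.real γ)) (hμ : μ ∈ M.Feas)
    (hmin : ∀ ν ∈ M.Feas, M.val γ μ ≤ M.val γ ν) (hp : p ∈ Ioo (0 : ℝ) 1) :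
    M.val γ μ + min γ 1 / 4 * (√p - √(μ.pr U u)) ^ 2 ≤ M.addInc U u γ p := by
  refine le_addInc hM hμ hmin hp fun ν hν => ?_
  have h1 := val_growth hM hμ hmin hν (Finset.univ.filter fun w => VarGraph.restrict U w = u)
  rw [← Dist.pr_eq_sum_filter, ← Dist.pr_eq_sum_filter] at h1
  have h2 := binKL_ge_hellinger (ν.pr_mem U u) (Ioo_subset_Icc_self hp)
    (fun h => absurd h hp.1.ne') (fun h => absurd h hp.2.ne)
  have hg0 : 0 < min γ 1 := lt_min hM.2.1 one_pos
  have h3 : min γ 1 / 2 * (√(ν.pr U u) - √(μ.pr U u)) ^ 2 ≤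
      γ / 2 * (√(ν.pr U u) - √(μ.pr U u)) ^ 2 :=
    mul_le_mul_of_nonneg_right (by linarith [min_le_left γ 1]) (sq_nonneg _)
  have h4 : min γ 1 / 2 * (√(ν.pr U u) - √p) ^ 2 ≤ 1 * (√(ν.pr U u) - √p) ^ 2 :=
    mul_le_mul_of_nonneg_right (by linarith [min_le_right γ 1]) (sq_nonneg _)
  have h5 : min γ 1 / 4 * (√p - √(μ.pr U u)) ^ 2 ≤ min γ 1 / 2 * (√(ν.pr U u) - √(μ.pr U u)) ^ 2
      + min γ 1 / 2 * (√(ν.pr U u) - √p) ^ 2 := by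
    nlinarith [mul_nonneg hg0.le (sq_nonneg (√p + √(μ.pr U u) - 2 * √(ν.pr U u)))]
  linarith

/-- Joint convexity of `val ν + binKL (ν(u)) p` in `(ν, p)`, along the segment to `(μ, μ(u))`, where
the second summand vanishes. -/
lemma addInc_mix_le (hM : M.Cvx (.real γ)) (hμ : μ ∈ M.Feas)
    (hmin : ∀ ν ∈ M.Feas, M.val γ μ ≤ M.val γ ν) (hp : p ∈ Ioo (0 : ℝ) 1) (hq : q ∈ Ioo (0 : ℝ) 1)
    (ht : t ∈ Ioc (0 : ℝ) 1) (h : q = (1 - t) * p + t * μ.pr U u) :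
    M.addInc U u γ q ≤ (1 - t) * M.addInc U u γ p + t * M.val γ μ := by
  -- The general argument divides by `1 - t`.
  rcases ht.2.eq_or_lt with rfl | ht1
  · have h1 := addInc_le (U := U) (u := u) hM hμ hmin hq hμ
    rw [show q = μ.pr U u by linarith] at h1 ⊢
    rw [binKL_self] at h1
    linarith
  have h1t : 0 < 1 - t := sub_pos.2 ht1
  have key : (M.addInc U u γ q - t * M.val γ μ) / (1 - t) ≤ M.addInc U u γ p := by
    refine le_addInc hM hμ hmin hp fun ν hν => ?_
    rw [div_le_iff₀ h1t]
    have ht' : t ∈ Ioo (0 : ℝ) 1 := ⟨ht.1, ht1⟩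
    have h1 := addInc_le (U := U) (u := u) hM hμ hmin hq
      (mix_mem_feas hν hμ (Ioo_subset_Icc_self ht'))
    have h2 := val_mix_le' hM hν hμ ht'
    have h3 := binKL_mix_le (Ioo_subset_Icc_self ht') (ν.pr_mem U u) hp (μ.pr_mem U u)
      (μ.pr_mem U u) (fun h => h) (fun h => h)
    rw [Dist.mix_pr, h] at h1
    rw [binKL_self] at h3
    rw [h]
    linarith
  rw [div_le_iff₀ h1t] at key
  linarith

/-- `q` lies at the fraction `t = (q - p) / (x - p)` of the way from `p` to `x`, so by convexity the
drop to `q` is at least `t` times the total drop, which `addInc_ge` bounds. Keeping the factor `1 /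
x` makes the precision needed for a fixed relative error proportional to `x` instead of `x²`. -/
lemma addInc_sub_ge_of_le (hM : M.Cvx (.real γ)) (hμ : μ ∈ M.Feas)
    (hmin : ∀ ν ∈ M.Feas, M.val γ μ ≤ M.val γ ν) (hp : 0 < p) (hpq : p < q) (hq : q < 1)
    (hx : q ≤ μ.pr U u) :
    min γ 1 * (q - p) * (μ.pr U u - p) / (16 * μ.pr U u)
      ≤ M.addInc U u γ p - M.addInc U u γ q := by
  set x := μ.pr U u with hxd
  have hxp : 0 < x - p := by linarith
  have hx0 : 0 < x := by linarith
  have h1 := addInc_mix_le (U := U) (u := u) (p := p) (q := q) (t := (q - p) / (x - p)) hM hμ hmin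
    ⟨hp, by linarith⟩ ⟨by linarith, hq⟩
    ⟨div_pos (by linarith) hxp, (div_le_one hxp).2 (by linarith)⟩ (by rw [← hxd]; field_simp; ring)
  have h2 := addInc_ge (U := U) (u := u) hM hμ hmin (p := p) ⟨hp, by linarith⟩
  rw [← hxd] at h2
  have h3 := sq_sub_div_le_sqrt_sub hp.le (by linarith : p ≤ x) hx0
  have hg0 : 0 < min γ 1 := lt_min hM.2.1 one_pos
  have h4 : min γ 1 / 4 * ((x - p) ^ 2 / (4 * x)) ≤ M.addInc U u γ p - M.val γ μ := by
    have := mul_le_mul_of_nonneg_left h3 (by linarith : 0 ≤ min γ 1 / 4)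
    nlinarith
  have h5 := mul_le_mul_of_nonneg_left h4
    (div_nonneg (by linarith) hxp.le : 0 ≤ (q - p) / (x - p))
  have h6 : (q - p) / (x - p) * (min γ 1 / 4 * ((x - p) ^ 2 / (4 * x)))
      = min γ 1 * (q - p) * (x - p) / (16 * x) := by field_simp; ring
  rw [h6] at h5
  linarith

/-- The mirror image; the larger number under the roots is now `q`, hence the denominator. -/
lemma addInc_sub_ge_of_ge (hM : M.Cvx (.real γ)) (hμ : μ ∈ M.Feas)
    (hmin : ∀ ν ∈ M.Feas, M.val γ μ ≤ M.val γ ν) (hp : 0 < p) (hpq : p < q) (hq : q < 1)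
    (hx : μ.pr U u ≤ p) :
    min γ 1 * (q - p) * (q - μ.pr U u) / (16 * q) ≤ M.addInc U u γ q - M.addInc U u γ p := by
  have hx0 := μ.pr_nonneg U u
  set x := μ.pr U u with hxd
  have hxq : 0 < q - x := by linarith
  have hq0 : 0 < q := by linarith
  have h1 := addInc_mix_le (U := U) (u := u) (p := q) (q := p) (t := (q - p) / (q - x)) hM hμ hmin
    ⟨hq0, hq⟩ ⟨hp, by linarith⟩
    ⟨div_pos (by linarith) hxq, (div_le_one hxq).2 (by linarith)⟩ (by rw [← hxd]; field_simp; ring)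
  have h2 := addInc_ge (U := U) (u := u) hM hμ hmin (p := q) ⟨hq0, hq⟩
  rw [← hxd] at h2
  have h3 := sq_sub_div_le_sqrt_sub hx0 (by linarith : x ≤ q) hq0
  have hg0 : 0 < min γ 1 := lt_min hM.2.1 one_pos
  have h4 : min γ 1 / 4 * ((q - x) ^ 2 / (4 * q)) ≤ M.addInc U u γ q - M.val γ μ := by
    have := mul_le_mul_of_nonneg_left h3 (by linarith : 0 ≤ min γ 1 / 4)
    linarith
  have h5 := mul_le_mul_of_nonneg_left h4
    (div_nonneg (by linarith) hxq.le : 0 ≤ (q - p) / (q - x))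
  have h6 : (q - p) / (q - x) * (min γ 1 / 4 * ((q - x) ^ 2 / (4 * q)))
      = min γ 1 * (q - p) * (q - x) / (16 * q) := by field_simp; ring
  rw [h6] at h5
  linarith

/-- Moving the added probability towards the optimal one decreases the inconsistency. -/
lemma moreInc_addProb {γ : TradeOff} (hM : M.Cvx γ) (hinc : M.inc γ.toReal ≠ ⊤)
    (hμ : M.opt γ = {μ}) (hp : 0 < p) (hpq : p < q) (hq : q < 1) (hp' : p ∈ Icc (0 : ℝ) 1)
    (hq' : q ∈ Icc (0 : ℝ) 1) :
    (q < μ.pr U u → MoreInc γ (M.addProb U u p hp') (M.addProb U u q hq')) ∧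
    (μ.pr U u < p → MoreInc γ (M.addProb U u q hq') (M.addProb U u p hp')) := by
  have hpi : p ∈ Ioo (0 : ℝ) 1 := ⟨hp, by linarith⟩
  have hqi : q ∈ Ioo (0 : ℝ) 1 := ⟨by linarith, hq⟩
  have key : ∀ {g : ℝ} {ν : G.Dist}, M.Cvx (.real g) → ν ∈ M.Feas →
      (∀ ν' ∈ M.Feas, M.val g ν ≤ M.val g ν') →
      (q < ν.pr U u → (M.addProb U u q hq').inc g < (M.addProb U u p hp').inc g) ∧
      (ν.pr U u < p → (M.addProb U u p hp').inc g < (M.addProb U u q hq').inc g) := by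
    intro g ν hg hν hmin
    have hg0 : 0 < min g 1 := lt_min hg.2.1 one_pos
    rw [addInc_spec hg hν hmin hpi, addInc_spec hg hν hmin hqi, EReal.coe_lt_coe_iff,
      EReal.coe_lt_coe_iff]
    constructor
    · intro hx
      have h1 := addInc_sub_ge_of_le hg hν hmin hp hpq hq hx.le
      have : 0 < min g 1 * (q - p) * (ν.pr U u - p) / (16 * ν.pr U u) :=
        div_pos (mul_pos (mul_pos hg0 (by linarith)) (by linarith)) (by linarith)
      linarith
    · intro hx
      have h1 := addInc_sub_ge_of_ge hg hν hmin hp hpq hq hx.le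
      have : 0 < min g 1 * (q - p) * (q - ν.pr U u) / (16 * q) :=
        div_pos (mul_pos (mul_pos hg0 (by linarith)) (by linarith)) (by linarith)
      linarith
  have hne := feas_nonempty hM.1 hinc
  cases γ with
  | real g =>
    have hmem : μ ∈ M.optReal g := by
      have : μ ∈ M.opt (.real g) := by rw [hμ]; rfl
      exact this
    obtain ⟨h1, h2⟩ := (mem_optReal_iff hM.1 hne).1 hmem
    exact key hM h1 h2
  | zeroPlus =>
    have hmem : μ ∈ M.opt .zeroPlus := by rw [hμ]; rfl
    obtain ⟨m, hm, ht⟩ := hmem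
    -- The optimal probabilities at small `g` converge to `μ(u)`, so they are eventually on the same
    -- strict side of `p` or `q`, and the claim for real `g` applies.
    have ht' := ((Dist.continuous_pr U u).tendsto μ).comp ht
    have hev := hm.and (eventually_cvx hM.1)
    constructor
    · intro hx
      filter_upwards [hev, ht'.eventually (lt_mem_nhds hx)] with g hg hxg
      obtain ⟨h1, h2⟩ := (mem_optReal_iff hM.1 hne).1 hg.1
      exact (key hg.2 h1 h2).1 hxg
    · intro hx
      filter_upwards [hev, ht'.eventually (gt_mem_nhds hx)] with g hg hxg
      obtain ⟨h1, h2⟩ := (mem_optReal_iff hM.1 hne).1 hg.1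
      exact (key hg.2 h1 h2).2 hxg

end PDG
end

noncomputable section

/-! ## Total correctness of programs -/

section Runs

variable {ρ κ : Type} {sb : κ → (ρ → ℝ) → Option (ℝ × ℕ)} {c : ℕ} {P Q : Prog ρ κ} {R R' : ρ → ℝ}
  {a a' k k' : ℕ} {Post Post' : (ρ → ℝ) → Prop}

/-- Started with memory `R`, the program halts with a memory satisfying `Post`, after at most `k`
calls and in time at most `a`, apart from a time of `c` for every call. -/
def Runs (sb : κ → (ρ → ℝ) → Option (ℝ × ℕ)) (c : ℕ) (P : Prog ρ κ) (R : ρ → ℝ) (a k : ℕ)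
    (Post : (ρ → ℝ) → Prop) : Prop :=
  ∃ R' t k', Exec sb P R R' t k' ∧ t ≤ a + k * c ∧ k' ≤ k ∧ Post R'

/-- Sequential composition of a list of programs. -/
def Prog.block : List (Prog ρ κ) → Prog ρ κ
  | [] => .skip
  | P :: L => .seq P (Prog.block L)

lemma store_apply (R : ρ → ℝ) (d : ρ) (v : ℝ) (r : ρ) [Decidable (r = d)] :
    store R d v r = if r = d then v else R r := by
  unfold store
  congr

lemma store_same (R : ρ → ℝ) (d : ρ) (v : ℝ) : store R d v d = v := by
  classical simp [store_apply]

lemma store_of_ne (R : ρ → ℝ) {d r : ρ} (v : ℝ) (h : r ≠ d) : store R d v r = R r := by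
  classical simp [store_apply, h]

namespace Runs

lemma mono (h : Runs sb c P R a k Post) (ha : a ≤ a') (hk : k ≤ k') (hP : ∀ R', Post R' → Post' R') :
    Runs sb c P R a' k' Post' := by
  obtain ⟨R', t, j, h1, h2, h3, h4⟩ := h
  exact ⟨R', t, j, h1, h2.trans (add_le_add ha (Nat.mul_le_mul_right c hk)), h3.trans hk, hP _ h4⟩

lemma skip (h : Post R) : Runs sb c .skip R a k Post :=
  ⟨R, 0, 0, .skip R, Nat.zero_le _, Nat.zero_le _, h⟩

lemma const {d : ρ} {q : ℚ} (h : Post (store R d q)) : Runs sb c (.const d q) R (a + 1) k Post :=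
  ⟨_, 1, 0, .const R d q, by lia, Nat.zero_le _, h⟩

lemma move {d x : ρ} (h : Post (store R d (R x))) : Runs sb c (.move d x) R (a + 1) k Post :=
  ⟨_, 1, 0, .move R d x, by lia, Nat.zero_le _, h⟩

lemma add {d x y : ρ} (h : Post (store R d (R x + R y))) :
    Runs sb c (.add d x y) R (a + 1) k Post :=
  ⟨_, 1, 0, .add R d x y, by lia, Nat.zero_le _, h⟩

lemma sub {d x y : ρ} (h : Post (store R d (R x - R y))) :
    Runs sb c (.sub d x y) R (a + 1) k Post :=
  ⟨_, 1, 0, .sub R d x y, by lia, Nat.zero_le _, h⟩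

lemma mul {d x y : ρ} (h : Post (store R d (R x * R y))) :
    Runs sb c (.mul d x y) R (a + 1) k Post :=
  ⟨_, 1, 0, .mul R d x y, by lia, Nat.zero_le _, h⟩

lemma div {d x y : ρ} (h0 : R y ≠ 0) (h : Post (store R d (R x / R y))) :
    Runs sb c (.div d x y) R (a + 1) k Post :=
  ⟨_, 1, 0, .div R d x y h0, by lia, Nat.zero_le _, h⟩

lemma log {d x : ρ} (h0 : 0 < R x) (h : Post (store R d (Real.log (R x)))) :
    Runs sb c (.log d x) R (a + 1) k Post :=
  ⟨_, 1, 0, .log R d x h0, by lia, Nat.zero_le _, h⟩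

lemma call {d : ρ} {i : κ} {v : ℝ} {n : ℕ} (hv : sb i R = some (v, n)) (hn : n ≤ c)
    (h : Post (store R d v)) : Runs sb c (.call d i) R a (k + 1) Post :=
  ⟨_, n, 1, .call R d i v n hv, by rw [add_mul, one_mul]; lia, by lia, h⟩

lemma seq (h : Runs sb c P R a k fun R' => Runs sb c Q R' a' k' Post) :
    Runs sb c (.seq P Q) R (a + a') (k + k') Post := by
  obtain ⟨R₁, t₁, j₁, e₁, ht₁, hj₁, R₂, t₂, j₂, e₂, ht₂, hj₂, hP⟩ := h
  exact ⟨R₂, _, _, .seq e₁ e₂, by rw [add_mul]; lia, by lia, hP⟩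

lemma ifLt {x y : ρ} (h1 : R x < R y → Runs sb c P R a k Post)
    (h2 : ¬ R x < R y → Runs sb c Q R a k Post) : Runs sb c (.ifLt x y P Q) R (a + 1) k Post := by
  by_cases h : R x < R y
  · obtain ⟨R', t, j, e, ht, hj, hP⟩ := h1 h
    exact ⟨R', _, _, .ifTrue h e, by lia, hj, hP⟩
  · obtain ⟨R', t, j, e, ht, hj, hP⟩ := h2 h
    exact ⟨R', _, _, .ifFalse h e, by lia, hj, hP⟩

/-- A loop with an invariant that counts the iterations still allowed. -/
lemma whileLt {x y : ρ} (I : ℕ → (ρ → ℝ) → Prop)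
    (h0 : ∀ R, I 0 R → ¬ R x < R y)
    (hstep : ∀ n R, I (n + 1) R → R x < R y → Runs sb c P R a k (I n))
    (hpost : ∀ n R, I n R → ¬ R x < R y → Post R) (n : ℕ) (hI : I n R) :
    Runs sb c (.whileLt x y P) R (n * (a + 1) + 1) (n * k) Post := by
  induction n generalizing R with
  | zero =>
    exact ⟨R, 1, 0, .whileFalse (h0 R hI), by lia, Nat.zero_le _, hpost _ _ hI (h0 R hI)⟩
  | succ n ih =>
    by_cases h : R x < R y
    · obtain ⟨R₁, t₁, j₁, e₁, ht₁, hj₁, hI₁⟩ := hstep n R hI h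
      obtain ⟨R₂, t₂, j₂, e₂, ht₂, hj₂, hP⟩ := ih hI₁
      refine ⟨R₂, _, _, .whileTrue h e₁ e₂, ?_, ?_, hP⟩
      · rw [show (n + 1) * k * c = n * k * c + k * c by ring,
          show (n + 1) * (a + 1) + 1 = n * (a + 1) + 1 + (a + 1) by ring]
        lia
      · rw [show (n + 1) * k = n * k + k by ring]
        lia
    · exact ⟨R, 1, 0, .whileFalse h, by lia, Nat.zero_le _, hpost _ _ hI h⟩

section Block

variable {L : List (Prog ρ κ)} {b j : ℕ} {d x y : ρ}

lemma nil (h : Post R) : Runs sb c (Prog.block []) R a k Post := skip h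

lemma cons (h : Runs sb c P R b j fun R' => Runs sb c (Prog.block L) R' a k Post) :
    Runs sb c (Prog.block (P :: L)) R (b + a) (j + k) Post := seq h

/-- The quantifier over `Q` says that `P` just replaces the memory by `R'`. The instances below turn
proofs about blocks into symbolic evaluation. -/
lemma prim (h : ∀ {Q : (ρ → ℝ) → Prop}, Q R' → Runs sb c P R 1 0 Q)
    (hL : Runs sb c (Prog.block L) R' a k Post) :
    Runs sb c (Prog.block (P :: L)) R (a + 1) k Post :=
  (cons (h hL)).mono (by lia) (by lia) fun _ h => h

lemma block_const {q : ℚ} (h : Runs sb c (Prog.block L) (store R d q) a k Post) :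
    Runs sb c (Prog.block (.const d q :: L)) R (a + 1) k Post := prim (const (a := 0)) h

lemma block_move (h : Runs sb c (Prog.block L) (store R d (R x)) a k Post) :
    Runs sb c (Prog.block (.move d x :: L)) R (a + 1) k Post := prim (move (a := 0)) h

lemma block_add (h : Runs sb c (Prog.block L) (store R d (R x + R y)) a k Post) :
    Runs sb c (Prog.block (.add d x y :: L)) R (a + 1) k Post := prim (add (a := 0)) h

lemma block_sub (h : Runs sb c (Prog.block L) (store R d (R x - R y)) a k Post) :
    Runs sb c (Prog.block (.sub d x y :: L)) R (a + 1) k Post := prim (sub (a := 0)) h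

lemma block_mul (h : Runs sb c (Prog.block L) (store R d (R x * R y)) a k Post) :
    Runs sb c (Prog.block (.mul d x y :: L)) R (a + 1) k Post := prim (mul (a := 0)) h

lemma block_div (h0 : R y ≠ 0) (h : Runs sb c (Prog.block L) (store R d (R x / R y)) a k Post) :
    Runs sb c (Prog.block (.div d x y :: L)) R (a + 1) k Post := prim (div (a := 0) h0) h

lemma block_call {i : κ} {v : ℝ} {n : ℕ} (hv : sb i R = some (v, n)) (hn : n ≤ c)
    (h : Runs sb c (Prog.block L) (store R d v) a k Post) :
    Runs sb c (Prog.block (.call d i :: L)) R a (k + 1) Post :=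
  (cons (call (a := 0) (k := 0) hv hn h)).mono (by lia) (by lia) fun _ h => h

end Block

end Runs

end Runs
end

noncomputable section

/-! ## Inference by comparing inconsistencies -/

lemma half_le_log_two_add {y : ℝ} (hy : 0 ≤ y) : 1 / 2 ≤ Real.log (2 + y) := by
  have h1 := Real.log_two_gt_d9
  have h2 := Real.log_le_log two_pos (by linarith : (2 : ℝ) ≤ 2 + y)
  linarith

lemma one_third_le_log : 1 / 3 ≤ Real.log (3 / 2) := by
  have := Real.one_sub_inv_le_log_of_pos (by norm_num : (0 : ℝ) < 3 / 2)
  norm_num at this ⊢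
  exact this

/-- Each search step shrinks an interval by `2/3`, so this counts steps. Rounding up costs 1, which
is at most `2 log (2 + y)`. -/
lemma exists_pow_three_halves {y : ℝ} (hy : 0 < y) :
    ∃ n : ℕ, y ≤ (3 / 2) ^ n ∧ (n : ℝ) ≤ 5 * Real.log (2 + y) := by
  have h1 := half_le_log_two_add hy.le
  have h3 := one_third_le_log
  refine ⟨⌈Real.log (2 + y) / Real.log (3 / 2)⌉₊, ?_, ?_⟩
  · have h4 := Nat.le_ceil (Real.log (2 + y) / Real.log (3 / 2))
    rw [div_le_iff₀ (by linarith), ← Real.log_pow] at h4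
    have := (Real.log_le_log_iff (by linarith) (by positivity)).1 h4
    linarith
  · have h4 := (Nat.ceil_lt_add_one (a := Real.log (2 + y) / Real.log (3 / 2))
      (div_nonneg (by linarith) (by linarith))).le
    have h5 : Real.log (2 + y) / Real.log (3 / 2) ≤ 3 * Real.log (2 + y) := by
      rw [div_le_iff₀ (by linarith)]
      nlinarith
    linarith

/-- Search for the optimal probability by comparing two inner points of the current interval.
Registers `2`, `3` hold the ends of the interval, register `4` its length. -/
def searchStep : Prog ℕ (ℕ × ℕ) :=
  .block [.mul 5 4 8, .sub 6 3 5, .add 5 2 5, .call 7 (5, 6),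
    .ifLt 9 7 (.move 2 5) (.move 3 6), .sub 4 3 2]

/-- The reduction of inference to comparing inconsistencies. -/
def searchProg : Prog ℕ (ℕ × ℕ) :=
  .block [.const 3 1, .const 8 (1 / 3), .sub 4 3 2, .whileLt 0 4 searchStep, .move 0 2]

/-- The state of the search for `x` after which `n` more steps are sufficient. -/
structure SearchInv (ε x : ℝ) (n : ℕ) (R : ℕ → ℝ) : Prop where
  eps : R 0 = ε
  third : R 8 = 1 / 3
  zero : R 9 = 0
  nonneg : 0 ≤ R 2
  le_one : R 3 ≤ 1
  len : R 4 = R 3 - R 2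
  le_x : R 2 ≤ x
  x_le : x ≤ R 3
  small : R 4 ≤ ε * (3 / 2) ^ n

section

open VarGraph PDG

variable {G : VarGraph} {M : PDG G} {γ : TradeOff} {μ : G.Dist} {Y : Finset G.Var}
  {y : G.Setting Y} {O : Comparer} {ε : ℝ}

/-- Even an arbitrary answer is informative: were `μ(y) < R i`, the second PDG would be strictly
more inconsistent and the answer could not be yes; symmetrically for no. -/
lemma exists_compareCall (hM : M.Cvx γ) (hinc : M.inc γ.toReal ≠ ⊤) (hμ : M.opt γ = {μ})
    (hO : O.Correct) {i j : ℕ} {R : ℕ → ℝ} (h0 : 0 < R i) (h1 : R i < R j) (h2 : R j < 1) :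
    ∃ v, compareCall O M γ Y y (i, j) R = some (v, 1) ∧
      ((v = 1 ∧ R i ≤ μ.pr Y y) ∨ (v = 0 ∧ μ.pr Y y ≤ R j)) := by
  have h : R i ∈ Icc (0 : ℝ) 1 ∧ R j ∈ Icc (0 : ℝ) 1 :=
    ⟨⟨h0.le, by linarith⟩, by linarith, h2.le⟩
  obtain ⟨k1, k2⟩ := moreInc_addProb (U := Y) (u := y) hM hinc hμ h0 h1 h2 h.1 h.2
  obtain ⟨c1, c2⟩ := hO γ _ (M.addProb Y y _ h.1) _ (M.addProb Y y _ h.2)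
  rw [compareCall, dif_pos h]
  refine ⟨_, rfl, ?_⟩
  split_ifs with hb
  · refine Or.inl ⟨rfl, le_of_not_gt fun hlt => ?_⟩
    have hc := c2 (k2 hlt)
    simp [hb] at hc
  · exact Or.inr ⟨rfl, le_of_not_gt fun hlt => hb (c1 (k1 hlt))⟩

lemma runs_searchStep (hM : M.Cvx γ) (hinc : M.inc γ.toReal ≠ ⊤) (hμ : M.opt γ = {μ})
    (hO : O.Correct) (hε : 0 < ε) {n : ℕ} {R : ℕ → ℝ} (hR : SearchInv ε (μ.pr Y y) (n + 1) R)
    (hlt : R 0 < R 4) :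
    Runs (compareCall O M γ Y y) 1 searchStep R 6 1 (SearchInv ε (μ.pr Y y) n) := by
  obtain ⟨r0, r8, r9, r2, r3, r4, rx, xr, rs⟩ := hR
  have hw : 0 < R 4 := by linarith
  refine Runs.block_mul (Runs.block_sub (Runs.block_add ?_))
  set R₁ := store (store (store R 5 _) 6 _) 5 _ with hR₁
  have e5 : R₁ 5 = R 2 + R 4 / 3 := by simp [hR₁, store_apply, r8]; ring
  have e6 : R₁ 6 = R 3 - R 4 / 3 := by simp [hR₁, store_apply, r8]; ring
  -- Third points of a nondegenerate interval inside `[0, 1]` avoid 0 and 1, where the inconsistency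
  -- may be infinite.
  obtain ⟨v, hv, hcase⟩ := exists_compareCall (i := 5) (j := 6) (R := R₁) (Y := Y) (y := y)
    hM hinc hμ hO (by rw [e5]; linarith) (by rw [e5, e6]; linarith) (by rw [e6]; linarith)
  rw [e5, e6] at hcase
  refine Runs.block_call hv le_rfl (Runs.cons (b := 2) (j := 0) (a := 1) (k := 0)
    (Runs.ifLt (a := 1) ?_ ?_))
  · intro hv0
    rcases hcase with ⟨rfl, hx⟩ | ⟨rfl, hx⟩
    · refine Runs.move (Runs.block_sub (Runs.nil ?_))
      rw [pow_succ] at rs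
      constructor <;> simp [hR₁, store_apply, r0, r8, r9] <;> linarith
    · simp [hR₁, store_apply, r9] at hv0
  · intro hv0
    rcases hcase with ⟨rfl, hx⟩ | ⟨rfl, hx⟩
    · simp [hR₁, store_apply, r9] at hv0
    · refine Runs.move (Runs.block_sub (Runs.nil ?_))
      rw [pow_succ] at rs
      constructor <;> simp [hR₁, store_apply, r0, r8, r9] <;> linarith

lemma runs_searchProg (hM : M.Cvx γ) (hinc : M.inc γ.toReal ≠ ⊤) (hμ : M.opt γ = {μ})
    (hO : O.Correct) (hε : 0 < ε) {n : ℕ} (hn : 1 / ε ≤ (3 / 2) ^ n) :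
    Runs (compareCall O M γ Y y) 1 searchProg (initMem ε 0) (n * 7 + 5) n
      fun R => |R 0 - μ.pr Y y| ≤ ε := by
  have hn' : 1 ≤ ε * (3 / 2) ^ n := by
    rw [div_le_iff₀ hε] at hn
    linarith
  refine (Runs.block_const (Runs.block_const (Runs.block_sub (a := n * 7 + 1 + 1) (k := n * 1 + 0)
    (Runs.cons (Runs.whileLt (a := 6) (k := 1) (SearchInv ε (μ.pr Y y)) ?_ ?_ ?_ n ?_))))).mono
    (by lia) (by lia) fun _ h => h
  · intro R hR
    have := hR.small
    rw [hR.eps]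
    simpa using this
  · intro n R hR hlt
    exact runs_searchStep hM hinc hμ hO hε hR hlt
  · intro m R hR hlt
    refine Runs.block_move (Runs.nil ?_)
    rw [store_same]
    have := hR.len
    rw [hR.eps, not_lt] at hlt
    rw [abs_le]
    constructor <;> linarith [hR.le_x, hR.x_le]
  · constructor <;> simp [store_apply, initMem, μ.pr_nonneg, μ.pr_le_one, hn']

theorem exists_searchProg :
    ∃ (P : Prog ℕ (ℕ × ℕ)) (C : ℝ), P.LogFree ∧
      ∀ (G : VarGraph) (M : PDG G) (γ : TradeOff), M.Cvx γ → M.inc γ.toReal ≠ ⊤ →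
        ∃ μ : G.Dist, M.opt γ = {μ} ∧
          ∀ (Y : Finset G.Var) (y : G.Setting Y) (ε : ℝ), 0 < ε →
            ∀ O : Comparer, O.Correct →
              ∃ (R : ℕ → ℝ) (t k : ℕ),
                Exec (compareCall O M γ Y y) P (initMem ε 0) R t k ∧
                |R 0 - μ.pr Y y| ≤ ε ∧
                (t : ℝ) ≤ C * Real.log (2 + 1 / ε) ∧
                (k : ℝ) ≤ C * Real.log (2 + 1 / ε) := by
  -- The time is at most `8 n + 5` with `n ≤ 5 L` and `L ≥ 1/2`, where `L = log (2 + 1 / ε)`.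
  refine ⟨searchProg, 50, by simp [searchProg, searchStep, Prog.block, Prog.LogFree], ?_⟩
  intro G M γ hM hinc
  obtain ⟨μ, -, hμ, -⟩ := exists_opt hM hinc
  refine ⟨μ, hμ, fun Y y ε hε O hO => ?_⟩
  obtain ⟨n, hn, hnL⟩ := exists_pow_three_halves (one_div_pos.2 hε)
  have hL := half_le_log_two_add (one_div_pos.2 hε).le
  obtain ⟨R, t, k, h1, h2, h3, h4⟩ := runs_searchProg (Y := Y) (y := y) hM hinc hμ hO hε hn
  refine ⟨R, t, k, h1, h4, ?_, ?_⟩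
  · have : (t : ℝ) ≤ n * 7 + 5 + n * 1 := by exact_mod_cast h2
    linarith
  · have : (k : ℝ) ≤ n := by exact_mod_cast h3
    linarith

end
end

noncomputable section

/-! ## Conditional inference by approximate inconsistency calculation -/

/-- Calls that evaluate functions `F b`, up to a requested precision, at arguments that are not too
close to `0` and `1`; here `F b` decreases towards `x b` and then increases, at a minimal rate. -/
structure BowlCalls (sb : Bool × ℕ × ℕ → (ℕ → ℝ) → Option (ℝ × ℕ)) (F : Bool → ℝ → ℝ)
    (x : Bool → ℝ) (g ζ : ℝ) (c : ℕ) : Prop where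
  left : ∀ b p q, 0 < p → p < q → q < 1 → q ≤ x b →
    g * (q - p) * (x b - p) / (16 * x b) ≤ F b p - F b q
  right : ∀ b p q, 0 < p → p < q → q < 1 → x b ≤ p →
    g * (q - p) * (q - x b) / (16 * q) ≤ F b q - F b p
  call : ∀ b i j R, ζ ≤ R i → R i ≤ 1 - ζ → ζ ≤ R j → R j ≤ 1 →
    ∃ r n, sb (b, i, j) R = some (r, n) ∧ |F b (R i) - r| < R j ∧ n ≤ c
  nonneg : ∀ b, 0 ≤ x b
  le_one : ∀ b, x b ≤ 1
  g_pos : 0 < g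
  g_le : g ≤ 1

/-- Registers holding the constants. -/
structure Consts (g e : ℝ) (R : ℕ → ℝ) : Prop where
  r2 : R 2 = g
  r3 : R 3 = e
  r5 : R 5 = 1
  r6 : R 6 = 1 / 2
  r7 : R 7 = 1 / 128
  r22 : R 22 = 1 / 3

lemma Consts.of_eq {g e : ℝ} {R R' : ℕ → ℝ} (h : Consts g e R)
    (h1 : ∀ r, r < 8 → R' r = R r) (h2 : R' 22 = R 22) : Consts g e R' :=
  ⟨(h1 2 (by norm_num)).trans h.r2, (h1 3 (by norm_num)).trans h.r3,
    (h1 5 (by norm_num)).trans h.r5, (h1 6 (by norm_num)).trans h.r6,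
    (h1 7 (by norm_num)).trans h.r7, h2.trans h.r22⟩

/-- Compare the probability in register `9`, and half of it, with the optimal one. -/
def probe : Prog ℕ (Bool × ℕ × ℕ) :=
  .block [.mul 10 9 6, .mul 11 2 9, .mul 11 11 7, .call 12 (false, 9, 11), .call 13 (false, 10, 11)]

variable {sb : Bool × ℕ × ℕ → (ℕ → ℝ) → Option (ℝ × ℕ)} {F : Bool → ℝ → ℝ} {x : Bool → ℝ}
  {g e ζ : ℝ} {c : ℕ}

/-- Let `p` be the number in register 9. If `x ≥ p` or `x ≤ p / 2`, the values at `p` and `p / 2`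
differ by at least `g p / 64` in a known direction, and two errors below `g p / 128` cannot hide
this. If `p / 2 < x < p`, both conclusions are true. -/
lemma runs_probe (H : BowlCalls sb F x g ζ c) {R : ℕ → ℝ} (hR : Consts g e R) (hζ : 0 < ζ)
    (h1 : 2 * ζ ≤ R 9) (h2 : R 9 ≤ 1 - ζ) (h3 : ζ ≤ g * R 9 / 128) :
    Runs sb c probe R 3 2 fun R' => (∀ r, r < 10 ∨ 13 < r → R' r = R r) ∧
      (R' 13 < R' 12 → x false < R 9) ∧ (¬ R' 13 < R' 12 → R 9 / 2 < x false) := by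
  have hp0 : 0 < R 9 := by linarith
  refine Runs.block_mul (Runs.block_mul (Runs.block_mul ?_))
  set R₁ := store (store (store R 10 _) 11 _) 11 _ with hR₁
  have e9 : R₁ 9 = R 9 := by simp [hR₁, store_apply]
  have e10 : R₁ 10 = R 9 / 2 := by simp [hR₁, store_apply, hR.r6]; ring
  have e11 : R₁ 11 = g * R 9 / 128 := by simp [hR₁, store_apply, hR.r2, hR.r7]; ring
  have hg := H.g_le
  have hg0 := H.g_pos
  have hgp : g * R 9 ≤ 1 := by nlinarith
  obtain ⟨a, n, ha, ha', hn⟩ := H.call false 9 11 R₁ (by rw [e9]; linarith) (by rw [e9]; linarith)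
    (by rw [e11]; exact h3) (by rw [e11]; linarith)
  refine Runs.block_call ha hn ?_
  set R₂ := store R₁ 12 a with hR₂
  have f10 : R₂ 10 = R 9 / 2 := by simp [hR₂, store_apply, e10]
  have f11 : R₂ 11 = g * R 9 / 128 := by simp [hR₂, store_apply, e11]
  obtain ⟨b, m, hb, hb', hm⟩ := H.call false 10 11 R₂ (by rw [f10]; linarith)
    (by rw [f10]; linarith) (by rw [f11]; exact h3) (by rw [f11]; linarith)
  rw [e9, e11, abs_lt] at ha'
  rw [f10, f11, abs_lt] at hb'
  refine Runs.block_call hb hm (Runs.nil ⟨?_, ?_, ?_⟩)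
  · intro r hr
    rw [store_of_ne _ _ (by lia), hR₂, store_of_ne _ _ (by lia), hR₁, store_of_ne _ _ (by lia),
      store_of_ne _ _ (by lia), store_of_ne _ _ (by lia)]
  · simp only [hR₂, store_apply]
    norm_num
    intro hlt
    by_contra! hx
    have key := H.left false (R 9 / 2) (R 9) (by linarith) (by linarith) (by linarith) hx
    have hx0 : 0 < x false := by linarith
    have : g * R 9 / 64 ≤ g * (R 9 - R 9 / 2) * (x false - R 9 / 2) / (16 * x false) := by
      rw [le_div_iff₀ (by positivity)]
      nlinarith [mul_pos hg0 hp0]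
    linarith
  · simp only [hR₂, store_apply]
    norm_num
    intro hlt
    by_contra! hx
    have key := H.right false (R 9 / 2) (R 9) (by linarith) (by linarith) (by linarith) hx
    have : g * R 9 / 64 ≤ g * (R 9 - R 9 / 2) * (R 9 - x false) / (16 * R 9) := by
      rw [le_div_iff₀ (by positivity)]
      nlinarith [mul_pos hg0 hp0]
    linarith

/-- The numbers `1/2, 1/4, 1/16, …`. -/
def halfPow (m : ℕ) : ℝ := (1 / 2) ^ 2 ^ m

lemma halfPow_zero : halfPow 0 = 1 / 2 := by simp [halfPow]

lemma halfPow_succ (m : ℕ) : halfPow (m + 1) = halfPow m * halfPow m := by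
  rw [halfPow, halfPow, pow_succ, mul_two, pow_add]

lemma halfPow_pos (m : ℕ) : 0 < halfPow m := by unfold halfPow; positivity

lemma halfPow_le_half (m : ℕ) : halfPow m ≤ 1 / 2 := by
  induction m with
  | zero => exact halfPow_zero.le
  | succ m ih => rw [halfPow_succ]; nlinarith [halfPow_pos m]

lemma halfPow_succ_le (m : ℕ) : halfPow (m + 1) ≤ halfPow m := by
  rw [halfPow_succ]; nlinarith [halfPow_pos m, halfPow_le_half m]

/-- Repeated squaring of the probability until it is below the optimal one. -/
def gallop : Prog ℕ (Bool × ℕ × ℕ) :=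
  .block [probe, .whileLt 13 12 (.block [.move 8 9, .mul 9 9 9, .add 14 14 5, probe])]

/-- The state after `m` squarings. -/
structure GallopInv (g e x : ℝ) (N n : ℕ) (R : ℕ → ℝ) : Prop where
  consts : Consts g e R
  exists_count : ∃ m : ℕ, n + m = N ∧ R 14 = m ∧ R 9 = halfPow m ∧
    R 8 = (if m = 0 then 1 else halfPow (m - 1))
  x_le : x ≤ R 8
  lt : R 13 < R 12 → x < R 9
  gt : ¬ R 13 < R 12 → R 9 / 2 < x

/-- The state of the bisection of the exponent with `n` steps left. -/
structure BisectInv (g e x : ℝ) (N n : ℕ) (R : ℕ → ℝ) : Prop where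
  consts : Consts g e R
  exists_count : ∃ j : ℕ, R 14 = j ∧ j - 1 = n ∧ n ≤ N
  x_le : x ≤ R 8
  le_one : R 8 ≤ 1
  lt_x : R 8 * halfPow n / 2 < x
  x_le_pow : n = 0 ∨ x ≤ halfPow n

/-- Stopping after squaring `h = halfPow k` leaves `h² / 2 < x ≤ h`. Stopping at once leaves `1/4 <
x ≤ 1`, and there is nothing to bisect. -/
lemma GallopInv.bisectInv {x : ℝ} {N n : ℕ} {R : ℕ → ℝ} (h : GallopInv g e x N n R)
    (h0 : ¬ R 13 < R 12) : ∃ m ≤ N, BisectInv g e x N m R := by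
  obtain ⟨hc, ⟨m, hm, h14, h9, h8⟩, hx, -, hgt⟩ := h
  have hgt := hgt h0
  cases m with
  | zero =>
    rw [if_pos rfl] at h8
    refine ⟨0, Nat.zero_le _, hc, ⟨0, h14, rfl, Nat.zero_le _⟩, hx, h8.le, ?_, Or.inl rfl⟩
    rw [h9] at hgt
    rwa [h8, one_mul]
  | succ k =>
    rw [if_neg (Nat.succ_ne_zero k), Nat.add_sub_cancel] at h8
    refine ⟨k, by lia, hc, ⟨k + 1, h14, rfl, by lia⟩, hx, ?_, ?_, Or.inr (h8 ▸ hx)⟩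
    · rw [h8]; linarith [halfPow_le_half k]
    · rw [h9, halfPow_succ] at hgt
      rwa [h8]

/-- The lower bounds on arguments and precisions of calls that are needed. -/
structure SmallEnough (g e x ζ : ℝ) : Prop where
  pos : 0 < ζ
  sq : 2 * ζ ≤ x ^ 2
  gsq : 128 * ζ ≤ g * x ^ 2
  half : 128 * ζ ≤ g * (1 / 2)
  quarter : 4 * ζ ≤ 1
  len : ζ ≤ e * x / 48
  prec : ζ ≤ g * e ^ 2 * x / 73728

end

/-! ### Locating the scale of a probability, and ternary search with inexact values. -/

noncomputable section

variable {sb : Bool × ℕ × ℕ → (ℕ → ℝ) → Option (ℝ × ℕ)} {F : Bool → ℝ → ℝ} {x : Bool → ℝ}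
  {g e ζ : ℝ} {c : ℕ}

/-- A number is squared only if it exceeds `x`, so every argument stays above `x²` and the
precisions stay above a multiple of `g x²`. The loop must end by the time `halfPow N ≤ x`. -/
lemma runs_gallop (H : BowlCalls sb F x g ζ c) {R : ℕ → ℝ} (hR : Consts g e R)
    (hs : SmallEnough g e (x false) ζ) (hx0 : 0 < x false)
    {N : ℕ} (hN : halfPow N ≤ x false) (h8 : R 8 = 1) (h9 : R 9 = 1 / 2) (h14 : R 14 = 0) :
    Runs sb c gallop R (7 * N + 4) (2 * N + 2) fun R' =>
      ∃ m ≤ N, BisectInv g e (x false) N m R' := by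
  have hζ := hs.pos
  have hqu := hs.quarter
  have h1 := runs_probe H hR hζ (by rw [h9]; linarith) (by rw [h9]; linarith)
    (by rw [h9]; linarith [hs.half])
  refine (Runs.cons (b := 3) (j := 2) (a := N * (6 + 1) + 1 + 0) (k := N * 2 + 0)
    (h1.mono le_rfl le_rfl fun R₁ ⟨hsame, hlt, hgt⟩ => Runs.cons (Runs.whileLt (a := 6) (k := 2)
      (GallopInv g e (x false) N) ?_ ?_ ?_ N ?_))).mono (by lia) (by lia) fun _ h => h
  · intro R hR hlt
    obtain ⟨m, hm, -, h9, -⟩ := hR.exists_count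
    have := hR.lt hlt
    rw [h9, show m = N by lia] at this
    linarith
  · intro n R hR hlt
    obtain ⟨m, hm, h14, h9, h8⟩ := hR.exists_count
    have hx := hR.lt hlt
    have hpos := halfPow_pos m
    have hle := halfPow_le_half m
    rw [h9] at hx
    have hsq : x false ^ 2 ≤ halfPow m * halfPow m := by nlinarith
    refine Runs.block_move (Runs.block_mul (Runs.block_add ?_))
    set R₁ := store (store (store R 8 _) 9 _) 14 _ with hR₁
    have e8 : R₁ 8 = halfPow m := by simp [hR₁, store_apply, h9]
    have e9 : R₁ 9 = halfPow (m + 1) := by simp [hR₁, store_apply, h9, halfPow_succ]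
    have e14 : R₁ 14 = m + 1 := by simp [hR₁, store_apply, h14, hR.consts.r5]
    have hc : Consts g e R₁ := hR.consts.of_eq (fun r hr => by
      rw [hR₁, store_of_ne _ _ (by lia), store_of_ne _ _ (by lia), store_of_ne _ _ (by lia)])
      (by simp [hR₁, store_apply])
    have h2 := runs_probe H hc hζ (by rw [e9, halfPow_succ]; linarith [hs.sq])
      (by rw [e9]; linarith [halfPow_le_half (m + 1)])
      (by rw [e9, halfPow_succ, le_div_iff₀ (by norm_num)]
          linarith [mul_le_mul_of_nonneg_left hsq H.g_pos.le, hs.gsq])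
    refine (Runs.cons (a := 0) (k := 0) (h2.mono le_rfl le_rfl
      fun R₂ ⟨hsame, hlt, hgt⟩ => Runs.nil ?_)).mono (by lia) (by lia) fun _ h => h
    refine ⟨hc.of_eq (fun r hr => hsame r (by lia)) (hsame 22 (by lia)), ⟨m + 1, by lia, ?_, ?_, ?_⟩,
      ?_, ?_, ?_⟩
    · rw [hsame 14 (by lia), e14]; push_cast; ring
    · rw [hsame 9 (by lia), e9]
    · rw [hsame 8 (by lia), e8]; simp
    · rw [hsame 8 (by lia), e8]; exact hx.le
    · rwa [hsame 9 (by lia)]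
    · rwa [hsame 9 (by lia)]
  · intro n R hR hlt
    exact Runs.nil (hR.bisectInv hlt)
  · refine ⟨hR.of_eq (fun r hr => hsame r (by lia)) (hsame 22 (by lia)), ⟨0, by lia, ?_, ?_, ?_⟩,
      ?_, ?_, ?_⟩
    · rw [hsame 14 (by lia), h14]; simp
    · rw [hsame 9 (by lia), h9, halfPow_zero]
    · rw [hsame 8 (by lia), h8]; simp
    · rw [hsame 8 (by lia), h8]; exact H.le_one false
    · rwa [hsame 9 (by lia)]
    · rwa [hsame 9 (by lia)]

/-- Bisection of the exponent of the optimal probability. -/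
def bisect : Prog ℕ (Bool × ℕ × ℕ) :=
  .whileLt 5 14 (.block [.sub 14 14 5, .move 15 6, .move 16 5,
    .whileLt 16 14 (.block [.mul 15 15 15, .add 16 16 5]),
    .mul 9 8 15, probe, .ifLt 13 12 (.move 8 9) .skip])

/-- Earlier powers are not stored, so `halfPow n` is rebuilt from `1/2` at every bisection step.
This costs quadratically many operations in total but no calls. -/
lemma runs_squarings {R : ℕ → ℝ} {n : ℕ} (h5 : R 5 = 1) (h14 : R 14 = n + 1) (h15 : R 15 = 1 / 2)
    (h16 : R 16 = 1) :
    Runs sb c (.whileLt 16 14 (.block [.mul 15 15 15, .add 16 16 5])) R (3 * n + 1) 0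
      fun R' => (∀ r, r ≠ 15 → r ≠ 16 → R' r = R r) ∧ R' 15 = halfPow n := by
  refine (Runs.whileLt (a := 2) (k := 0) (fun l R' => (∀ r, r ≠ 15 → r ≠ 16 → R' r = R r) ∧
    ∃ i : ℕ, l + i = n ∧ R' 16 = i + 1 ∧ R' 15 = halfPow i) ?_ ?_ ?_ n ?_).mono
    (by lia) (by lia) fun _ h => h
  · rintro R' ⟨hsame, i, hi, e16, -⟩
    rw [e16, hsame 14 (by lia) (by lia), h14, show i = n by lia]
    exact lt_irrefl _
  · rintro l R' ⟨hsame, i, hi, e16, e15⟩ hlt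
    refine Runs.block_mul (Runs.block_add (Runs.nil ⟨fun r h1 h2 => ?_, i + 1, by lia, ?_, ?_⟩))
    · rw [store_of_ne _ _ h2, store_of_ne _ _ h1, hsame r h1 h2]
    · have := hsame 5 (by lia) (by lia)
      simp [store_apply, e16, this, h5]
    · simp [store_apply, e15, halfPow_succ]
  · rintro l R' ⟨hsame, i, hi, e16, e15⟩ hlt
    refine ⟨hsame, ?_⟩
    rw [e16, hsame 14 (by lia) (by lia), h14] at hlt
    have : ¬ (i < n) := fun h => hlt (by exact_mod_cast Nat.succ_lt_succ h)
    rw [e15, show i = n by lia]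
  · exact ⟨fun _ _ _ => rfl, 0, by lia, by rw [h16]; simp, by rw [h15, halfPow_zero]⟩

/-- With `h = halfPow n` and `h² = halfPow (n + 1)`, a probe at `R 8 · h` splits `R 8 · h² / 2 < x ≤
R 8`; either outcome restores the invariant with `h` in place of `h²`. Finally `halfPow 0 = 1/2`
leaves `R 8 / 4 < x`. The bound of `x` by the current power keeps the probed points above `x²`. -/
lemma runs_bisect (H : BowlCalls sb F x g ζ c) {R : ℕ → ℝ}
    (hs : SmallEnough g e (x false) ζ) (hx0 : 0 < x false) {N m : ℕ}
    (hR : BisectInv g e (x false) N m R) (hm : m ≤ N) :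
    Runs sb c bisect R (N * (3 * N + 11) + 1) (2 * N) fun R' => Consts g e R' ∧
      x false ≤ R' 8 ∧ R' 8 ≤ 1 ∧ R' 8 < 4 * x false := by
  have hζ := hs.pos
  refine (Runs.whileLt (a := 3 * N + 10) (k := 2) (BisectInv g e (x false) N) ?_ ?_ ?_ m hR).mono
    (Nat.succ_le_succ (Nat.mul_le_mul_right _ hm)) (by lia) fun _ h => h
  · intro R hR hlt
    obtain ⟨j, h14, hj, -⟩ := hR.exists_count
    rw [hR.consts.r5, h14] at hlt
    have : 1 < j := by exact_mod_cast hlt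
    lia
  · rintro n R ⟨hc, ⟨j, h14, hj, hnN⟩, hx, h1, hlx, hxp⟩ hlt
    have hxp := hxp.resolve_left (Nat.succ_ne_zero n)
    obtain rfl : j = n + 2 := by lia
    have hpos := halfPow_pos n
    have hle := halfPow_le_half n
    rw [show 3 * N + 10 = 3 * N + 7 + 1 + 1 + 1 by rfl]
    refine Runs.block_sub (Runs.block_move (Runs.block_move ?_))
    set R₁ := store (store (store R 14 _) 15 _) 16 _ with hR₁
    have h2 := runs_squarings (sb := sb) (c := c) (R := R₁) (n := n)
      (by simp [hR₁, store_apply, hc.r5])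
      (by simp [hR₁, store_apply, hc.r5, h14]; ring) (by simp [hR₁, store_apply, hc.r6])
      (by simp [hR₁, store_apply, hc.r5])
    refine (Runs.cons (a := 6) (k := 2) (h2.mono le_rfl le_rfl fun R₂ ⟨hsame, h15⟩ =>
      Runs.block_mul (a := 5) ?_)).mono (a := 3 * n + 1 + 6) (by lia) (by lia) fun _ h => h
    have k8 : R₂ 8 = R 8 := by
      rw [hsame 8 (by lia) (by lia)]; simp [hR₁, store_apply]
    have hc₂ : Consts g e R₂ := hc.of_eq (fun r hr => by
      rw [hsame r (by lia) (by lia), hR₁, store_of_ne _ _ (by lia), store_of_ne _ _ (by lia),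
        store_of_ne _ _ (by lia)]) (by
      rw [hsame 22 (by lia) (by lia)]; simp [hR₁, store_apply])
    have k14 : R₂ 14 = n + 1 := by
      rw [hsame 14 (by lia) (by lia)]; simp [hR₁, store_apply, hc.r5, h14]; ring
    set R₃ := store R₂ 9 _ with hR₃
    have e9 : R₃ 9 = R 8 * halfPow n := by simp [hR₃, store_apply, h15, k8]
    have hc₃ : Consts g e R₃ := hc₂.of_eq (fun r hr => by rw [hR₃, store_of_ne _ _ (by lia)])
      (by simp [hR₃, store_apply])
    have hsq : x false ^ 2 ≤ R 8 * halfPow n := by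
      have := halfPow_succ_le n
      rw [sq]
      exact mul_le_mul hx (hxp.trans this) hx0.le (by linarith)
    have hmid : R 8 * halfPow n ≤ 1 / 2 := by nlinarith
    have h3 := runs_probe H hc₃ hζ (by rw [e9]; linarith [hs.sq])
      (by rw [e9]; linarith [hs.quarter])
      (by rw [e9, le_div_iff₀ (by norm_num)]
          linarith [mul_le_mul_of_nonneg_left hsq H.g_pos.le, hs.gsq])
    refine (Runs.cons (a := 2) (k := 0) (h3.mono le_rfl le_rfl
      fun R₄ ⟨hsame₄, hlt₄, hgt₄⟩ => Runs.cons (b := 2) (j := 0) (a := 0) (k := 0)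
        (Runs.ifLt (a := 1) ?_ ?_)))
    · intro hcmp
      have hxm := hlt₄ hcmp
      rw [e9] at hxm
      refine Runs.move (Runs.nil ?_)
      have k9 : R₄ 9 = R 8 * halfPow n := by rw [hsame₄ 9 (by lia), e9]
      refine ⟨hc₃.of_eq (fun r hr => ?_) ?_, ⟨n + 1, ?_, by lia, by lia⟩, ?_, ?_, ?_, ?_⟩
      · rw [store_of_ne _ _ (by lia), hsame₄ r (by lia)]
      · rw [store_of_ne _ _ (by lia), hsame₄ 22 (by lia)]
      · rw [store_of_ne _ _ (by lia), hsame₄ 14 (by lia), hR₃, store_of_ne _ _ (by lia), k14]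
        push_cast; ring
      · rw [store_same, k9]; exact hxm.le
      · rw [store_same, k9]; linarith
      · rw [store_same, k9, mul_assoc, ← halfPow_succ]; exact hlx
      · exact Or.inr (hxp.trans (halfPow_succ_le n))
    · intro hcmp
      have hxm := hgt₄ hcmp
      rw [e9] at hxm
      refine Runs.skip (Runs.nil ?_)
      have k8' : R₄ 8 = R 8 := by
        rw [hsame₄ 8 (by lia), hR₃, store_of_ne _ _ (by lia), k8]
      refine ⟨hc₃.of_eq (fun r hr => hsame₄ r (by lia)) (hsame₄ 22 (by lia)),
        ⟨n + 1, ?_, by lia, by lia⟩, ?_, ?_, ?_, ?_⟩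
      · rw [hsame₄ 14 (by lia), hR₃, store_of_ne _ _ (by lia), k14]; push_cast; ring
      · rwa [k8']
      · rwa [k8']
      · rwa [k8']
      · exact Or.inr (hxp.trans (halfPow_succ_le n))
  · rintro n R ⟨hc, ⟨j, h14, hj, hnN⟩, hx, h1, hlx, hxp⟩ hlt
    refine ⟨hc, hx, h1, ?_⟩
    rw [hc.r5, h14] at hlt
    -- By truncated subtraction `j = 0` and `j = 1` both mean that no bisection is left.
    have : ¬ 1 < j := fun h => hlt (by exact_mod_cast h)
    obtain rfl : n = 0 := by lia
    rw [halfPow_zero] at hlx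
    linarith

/-- One step of the search for the minimum of `F b` in the interval between registers `17`
and `18`. -/
def ternaryStep (b : Bool) : Prog ℕ (Bool × ℕ × ℕ) :=
  .block [.mul 10 19 22, .add 20 17 10, .sub 21 18 10, .call 12 (b, 20, 11), .call 13 (b, 21, 11),
    .ifLt 12 13 (.move 18 21) (.move 17 20), .sub 19 18 17]

/-- Search for the minimum of `F b` in the interval from zero to the number in register `8`, up to
the precision in register `23`; calls have the precision in register `11`. -/
def ternary (b : Bool) : Prog ℕ (Bool × ℕ × ℕ) :=
  .block [.const 17 0, .move 18 8, .move 19 8, .whileLt 23 19 (ternaryStep b)]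

/-- The state of the search for `x` after which `n` more steps are sufficient. -/
structure TernaryInv (R₀ : ℕ → ℝ) (x η : ℝ) (n : ℕ) (R : ℕ → ℝ) : Prop where
  same : ∀ r, r < 10 ∨ r = 11 ∨ 21 < r → R r = R₀ r
  nonneg : 0 ≤ R 17
  le_hi : R 18 ≤ R₀ 8
  len : R 19 = R 18 - R 17
  le_x : R 17 ≤ x
  x_le : x ≤ R 18
  small : R 19 ≤ η * (3 / 2) ^ n

/-- While the loop runs the interval is longer than η. If `x` is outside the middle third, the
values at the third points differ by at least `g (η/3)² / (16 hi)` with `hi = R 8`, in a known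
direction. The precision `g η² / (288 hi)` is half of that, so errors cannot reverse the comparison;
if `x` is in the middle third, either answer is safe. -/
lemma runs_ternary (H : BowlCalls sb F x g ζ c) {R : ℕ → ℝ} {η : ℝ} (hR : Consts g e R) (b : Bool)
    (hη : 0 < η) (hx : x b ≤ R 8) (h8 : R 8 ≤ 1) (h23 : R 23 = η)
    (h11 : R 11 = g * η ^ 2 / (288 * R 8)) (hζ : 0 < ζ) (hζη : 3 * ζ ≤ η) (hζ11 : ζ ≤ R 11)
    (h11' : R 11 ≤ 1) {N : ℕ} (hN : R 8 ≤ η * (3 / 2) ^ N) :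
    Runs sb c (ternary b) R (7 * N + 4) (2 * N) fun R' =>
      (∀ r, r < 10 ∨ r = 11 ∨ 21 < r → R' r = R r) ∧ 0 ≤ R' 17 ∧ |R' 17 - x b| ≤ η := by
  refine (Runs.block_const (Runs.block_move (Runs.block_move (a := N * (6 + 1) + 1 + 0)
    (k := N * 2 + 0) (Runs.cons (Runs.whileLt (a := 6) (k := 2) (TernaryInv R (x b) η)
    ?_ ?_ ?_ N ?_))))).mono (by lia) (by lia) fun _ h => h
  · intro R' hR'
    have := hR'.small
    rw [hR'.same 23 (by lia), h23]
    simpa using this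
  · rintro n R' ⟨hsame, h17, h18, h19, hl, hu, hsm⟩ hlt
    rw [hsame 23 (by lia), h23] at hlt
    have hw : 0 < R' 19 := by linarith
    have k22 : R' 22 = 1 / 3 := by rw [hsame 22 (by lia), hR.r22]
    refine Runs.block_mul (Runs.block_add (Runs.block_sub ?_))
    set R₁ := store (store (store R' 10 _) 20 _) 21 _ with hR₁
    have e20 : R₁ 20 = R' 17 + R' 19 / 3 := by simp [hR₁, store_apply, k22]; ring
    have e21 : R₁ 21 = R' 18 - R' 19 / 3 := by simp [hR₁, store_apply, k22]; ring
    have e11 : R₁ 11 = R 11 := by rw [← hsame 11 (by lia)]; simp [hR₁, store_apply]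
    have eo : ∀ r, r ≠ 10 → r ≠ 20 → r ≠ 21 → R₁ r = R' r := fun r h1 h2 h3 => by
      rw [hR₁, store_of_ne _ _ h3, store_of_ne _ _ h2, store_of_ne _ _ h1]
    clear_value R₁
    obtain ⟨a, m, ha, ha', hm⟩ := H.call b 20 11 R₁ (by rw [e20]; linarith) (by rw [e20]; linarith)
      (by rw [e11]; exact hζ11) (by rw [e11]; exact h11')
    refine Runs.block_call ha hm ?_
    set R₂ := store R₁ 12 a with hR₂
    have f21 : R₂ 21 = R' 18 - R' 19 / 3 := by simp [hR₂, store_apply, e21]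
    have f11 : R₂ 11 = R 11 := by simp [hR₂, store_apply, e11]
    obtain ⟨d, m', hd, hd', hm'⟩ := H.call b 21 11 R₂ (by rw [f21]; linarith)
      (by rw [f21]; linarith) (by rw [f11]; exact hζ11) (by rw [f11]; exact h11')
    refine Runs.block_call hd hm' ?_
    rw [e20, e11, abs_lt] at ha'
    rw [f21, f11, abs_lt] at hd'
    have hw2 : η ^ 2 ≤ R' 19 ^ 2 := pow_le_pow_left₀ hη.le hlt.le 2
    have hprec : ∀ y, 0 < y → y ≤ R 8 → 2 * R 11 ≤ g * (R' 19 / 3) * (R' 19 / 3) / (16 * y) := by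
      intro y hy hy8
      rw [h11]
      calc 2 * (g * η ^ 2 / (288 * R 8)) = g * η ^ 2 / (144 * R 8) := by ring
        _ ≤ g * R' 19 ^ 2 / (144 * y) := by
            have := H.g_pos
            gcongr
        _ = _ := by ring
    have hmid : R' 18 - R' 19 / 3 - (R' 17 + R' 19 / 3) = R' 19 / 3 := by linarith
    have hleft : R' 18 - R' 19 / 3 ≤ x b → d < a := by
      intro hx'
      have key := H.left b (R' 17 + R' 19 / 3) (R' 18 - R' 19 / 3) (by linarith) (by linarith)
        (by linarith) hx'
      have hxb : 0 < x b := by linarith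
      have h2 := hprec (x b) hxb hx
      have h3 : g * (R' 19 / 3) * (R' 19 / 3) / (16 * x b) ≤
          g * (R' 18 - R' 19 / 3 - (R' 17 + R' 19 / 3)) * (x b - (R' 17 + R' 19 / 3))
            / (16 * x b) := by
        have := H.g_pos
        rw [hmid]
        gcongr
        linarith
      linarith
    have hright : x b ≤ R' 17 + R' 19 / 3 → a < d := by
      intro hx'
      have key := H.right b (R' 17 + R' 19 / 3) (R' 18 - R' 19 / 3) (by linarith) (by linarith)
        (by linarith) hx'
      have hy : 0 < R' 18 - R' 19 / 3 := by linarith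
      have h2 := hprec _ hy (by linarith)
      have h3 : g * (R' 19 / 3) * (R' 19 / 3) / (16 * (R' 18 - R' 19 / 3)) ≤
          g * (R' 18 - R' 19 / 3 - (R' 17 + R' 19 / 3)) * (R' 18 - R' 19 / 3 - x b)
            / (16 * (R' 18 - R' 19 / 3)) := by
        have := H.g_pos
        rw [hmid]
        gcongr
        linarith
      linarith
    rw [pow_succ] at hsm
    have g17 : R₁ 17 = R' 17 := eo 17 (by lia) (by lia) (by lia)
    have g18 : R₁ 18 = R' 18 := eo 18 (by lia) (by lia) (by lia)
    refine Runs.cons (b := 2) (j := 0) (a := 1) (k := 0) (Runs.ifLt (a := 1) ?_ ?_)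
    · intro hcmp
      have hcmp' : a < d := by simpa [hR₂, store_apply] using hcmp
      have hxu : x b ≤ R' 18 - R' 19 / 3 := le_of_not_ge fun h => absurd (hleft h) hcmp'.not_gt
      refine Runs.move (Runs.block_sub (Runs.nil ?_))
      refine ⟨fun r hr => ?_, ?_, ?_, ?_, ?_, ?_, ?_⟩
      · rw [store_of_ne _ _ (by lia), store_of_ne _ _ (by lia), store_of_ne _ _ (by lia), hR₂,
          store_of_ne _ _ (by lia), eo r (by lia) (by lia) (by lia), hsame r hr]
      all_goals simp [hR₂, store_apply, e21, g17]; try linarith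
    · intro hcmp
      have hcmp' : ¬ a < d := by simpa [hR₂, store_apply] using hcmp
      have hxl : R' 17 + R' 19 / 3 ≤ x b := le_of_not_ge fun h => hcmp' (hright h)
      refine Runs.move (Runs.block_sub (Runs.nil ?_))
      refine ⟨fun r hr => ?_, ?_, ?_, ?_, ?_, ?_, ?_⟩
      · rw [store_of_ne _ _ (by lia), store_of_ne _ _ (by lia), store_of_ne _ _ (by lia), hR₂,
          store_of_ne _ _ (by lia), eo r (by lia) (by lia) (by lia), hsame r hr]
      all_goals simp [hR₂, store_apply, e20, g18]; try linarith
  · rintro n R' ⟨hsame, h17, h18, h19, hl, hu, hsm⟩ hlt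
    rw [hsame 23 (by lia), h23] at hlt
    refine Runs.nil ⟨hsame, h17, ?_⟩
    rw [abs_le]
    constructor <;> linarith
  · refine ⟨fun r hr => ?_, ?_, ?_, ?_, ?_, ?_, ?_⟩
    · rw [store_of_ne _ _ (by lia), store_of_ne _ _ (by lia), store_of_ne _ _ (by lia)]
    all_goals simp [store_apply, hx, hN, H.nonneg b]
end

/-! ### The complete program for conditional probabilities. -/

noncomputable section

/-- Computation of the parameters of the search from the scale of the probability. -/
def scaleParams : Prog ℕ (Bool × ℕ × ℕ) :=
  .block [.mul 23 3 8, .const 25 (1 / 16), .mul 23 23 25, .mul 11 2 3, .mul 11 11 23,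
    .const 25 (1 / 4608), .mul 11 11 25]

/-- The initial computation of constants. -/
def setup : Prog ℕ (Bool × ℕ × ℕ) :=
  .block [.const 5 1, .const 6 (1 / 2), .const 7 (1 / 128), .const 22 (1 / 3),
    .ifLt 1 5 (.move 2 1) (.move 2 5), .ifLt 0 5 (.move 3 0) (.move 3 5), .move 8 5, .move 9 6]

/-- The reduction of conditional inference to approximate inconsistency calculation. -/
def inferProg : Prog ℕ (Bool × ℕ × ℕ) :=
  .block [setup, gallop, bisect, scaleParams, ternary false, .move 24 17, ternary true,
    .div 0 17 24]

variable {sb : Bool × ℕ × ℕ → (ℕ → ℝ) → Option (ℝ × ℕ)} {F : Bool → ℝ → ℝ} {x : Bool → ℝ}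
  {g e ζ : ℝ} {c : ℕ}

lemma runs_setup (ε γ : ℝ) :
    Runs sb c setup (initMem ε γ) 10 0 fun R => Consts (min γ 1) (min ε 1) R ∧ R 8 = 1 ∧
      R 9 = 1 / 2 ∧ R 14 = 0 := by
  have key : ∀ (d y : ℕ) (R : ℕ → ℝ) (L : List (Prog ℕ (Bool × ℕ × ℕ))) (a : ℕ)
      (Post : (ℕ → ℝ) → Prop), R 5 = 1 →
      Runs sb c (.block L) (store R d (min (R y) 1)) a 0 Post →
      Runs sb c (.block (.ifLt y 5 (.move d y) (.move d 5) :: L)) R (a + 2) 0 Post := by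
    intro d y R L a Post h5 h
    refine (Runs.cons (b := 2) (j := 0) (a := a) (k := 0) (Runs.ifLt (a := 1) (fun hlt =>
      Runs.move (a := 0) ?_) fun hlt => Runs.move (a := 0) ?_)).mono (by lia) (by lia) fun _ h => h
    · rw [h5] at hlt
      rwa [min_eq_left hlt.le] at h
    · rw [h5] at hlt
      rw [min_eq_right (not_lt.1 hlt)] at h
      rwa [h5]
  refine Runs.block_const (Runs.block_const (Runs.block_const (Runs.block_const
    (key _ _ _ _ 4 _ ?_ (key _ _ _ _ 2 _ ?_ (Runs.block_move (Runs.block_move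
      (Runs.nil ⟨⟨?_, ?_, ?_, ?_, ?_, ?_⟩, ?_, ?_, ?_⟩))))))))
  all_goals simp [store_apply, initMem]

/-- The numerator `(b - y) z - y (a - z)` of the error is at most `2 η z` since `y ≤ z`. Errors that
are small relative to `z` therefore suffice, however small `y` is. -/
lemma abs_div_sub_div_le {a b y z ε e η : ℝ} (hz : 0 < z) (hy : 0 ≤ y) (hyz : y ≤ z)
    (he : 0 < e) (he1 : e ≤ 1) (heε : e ≤ ε) (hη : η ≤ e * z / 4) (ha : |a - z| ≤ η)
    (hb : |b - y| ≤ η) : a ≠ 0 ∧ |b / a - y / z| ≤ ε := by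
  rw [abs_le] at ha hb
  have hez : e * z ≤ z := by nlinarith
  have ha0 : 3 * z / 4 ≤ a := by linarith
  have hap : 0 < a := by linarith
  refine ⟨hap.ne', ?_⟩
  have h1 : b / a - y / z = ((b - y) * z - y * (a - z)) / (a * z) := by
    field_simp
    ring
  have hηz : η * z ≤ e * z / 4 * z := mul_le_mul_of_nonneg_right hη hz.le
  have h2 : |(b - y) * z - y * (a - z)| ≤ e * z * z / 2 := by
    rw [abs_le]
    constructor <;> nlinarith
  rw [h1, abs_div, abs_of_pos (mul_pos hap hz), div_le_iff₀ (by positivity)]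
  calc _ ≤ _ := h2
    _ ≤ e * (a * z) := by nlinarith [mul_pos he hz]
    _ ≤ ε * (a * z) := mul_le_mul_of_nonneg_right heε (by positivity)

/-- Write `x` for the probability of the evidence. From `x ≤ hi < 4 x` the choice `η = e hi / 16`
gives `η < e x / 4`. The conjunction is no more probable than the evidence, so its search reuses the
interval and the precision, and no scale has to be found for it. -/
lemma runs_inferProg {ε γ : ℝ} (H : BowlCalls sb F x (min γ 1) ζ c) (hε : 0 < ε)
    (hs : SmallEnough (min γ 1) (min ε 1) (x false) ζ) (hx0 : 0 < x false)
    (hxx : x true ≤ x false) {N n : ℕ} (hN : halfPow N ≤ x false)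
    (hn : 16 / min ε 1 ≤ (3 / 2) ^ n) :
    Runs sb c inferProg (initMem ε γ) (N * (3 * N + 18) + 14 * n + 32) (4 * N + 4 * n + 2)
      fun R => |R 0 - x true / x false| ≤ ε := by
  set g := min γ 1
  set e := min ε 1
  have he : 0 < e := lt_min hε one_pos
  have he1 : e ≤ 1 := min_le_right _ _
  have hg := H.g_pos
  have hg1 := H.g_le
  have hζ := hs.pos
  refine (Runs.cons (b := 10) (j := 0) (a := N * (3 * N + 18) + 14 * n + 22)
    (k := 4 * N + 4 * n + 2) ((runs_setup ε γ).mono le_rfl le_rfl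
    fun R₁ ⟨hc₁, h8, h9, h14⟩ => ?_)).mono (by lia) (by lia) fun _ h => h
  refine (Runs.cons (a := N * (3 * N + 11) + 14 * n + 18) (k := 2 * N + 4 * n)
    ((runs_gallop H hc₁ hs hx0 hN h8 h9 h14).mono le_rfl le_rfl
    fun R₂ ⟨m, hm, hR₂⟩ => ?_)).mono (by lia) (by lia) fun _ h => h
  refine (Runs.cons (a := 14 * n + 17) (k := 4 * n)
    ((runs_bisect H hs hx0 hR₂ hm).mono le_rfl le_rfl
    fun R₃ ⟨hc₃, hx8, h81, h84⟩ => ?_)).mono (by lia) (by lia) fun _ h => h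
  set hi := R₃ 8 with hhi
  have hi0 : 0 < hi := by linarith
  refine (Runs.cons (b := 7) (j := 0) (a := 14 * n + 10) (k := 4 * n)
    (Runs.block_mul (Runs.block_const (Runs.block_mul (Runs.block_mul (Runs.block_mul
    (Runs.block_const (Runs.block_mul (Runs.nil ?_))))))))).mono
    (by lia) (by lia) fun _ h => h
  set R₄ := store (store (store (store (store (store (store R₃ 23 _) 25 _) 23 _) 11 _) 11 _) 25 _)
    11 _ with hR₄
  have k23 : R₄ 23 = e * hi / 16 := by simp [hR₄, store_apply, hc₃.r3]; ring
  have k11 : R₄ 11 = g * e ^ 2 * hi / 73728 := by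
    simp [hR₄, store_apply, hc₃.r3, hc₃.r2]; ring
  have k8 : R₄ 8 = hi := by simp [hR₄, store_apply, hhi]
  have hc₄ : Consts g e R₄ := by
    obtain ⟨r2, r3, r5, r6, r7, r22⟩ := hc₃
    constructor <;> simp [store_apply, *]
  clear_value R₄
  have hlen : 3 * ζ ≤ e * hi / 16 := by
    have := hs.len
    have := mul_le_mul_of_nonneg_left hx8 he.le
    linarith
  have hge : g * e ^ 2 ≤ 1 := by
    calc g * e ^ 2 ≤ 1 * 1 ^ 2 := by gcongr
      _ = 1 := by norm_num
  have hprec : ζ ≤ g * e ^ 2 * hi / 73728 := by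
    have := hs.prec
    have := mul_le_mul_of_nonneg_left hx8 (by positivity : 0 ≤ g * e ^ 2)
    linarith
  have hprec1 : g * e ^ 2 * hi / 73728 ≤ 1 := by
    have : g * e ^ 2 * hi ≤ 1 := by nlinarith
    linarith
  -- `73728 = 288 · 16²`: register 11 holds the precision that `runs_ternary` requires for `η = e hi
  -- / 16`.
  have h11eq : g * e ^ 2 * hi / 73728 = g * (e * hi / 16) ^ 2 / (288 * hi) := by
    field_simp; ring
  have hnn : hi ≤ e * hi / 16 * (3 / 2) ^ n := by
    rw [div_le_iff₀ he] at hn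
    nlinarith
  -- Register 24 is exempt because it keeps the first result during the second search.
  have tern : ∀ (b : Bool) (R : ℕ → ℝ), (∀ r, r < 10 ∨ r = 11 ∨ 24 ≠ r ∧ 21 < r → R r = R₄ r) →
      Runs sb c (ternary b) R (7 * n + 4) (2 * n) fun R' =>
      (∀ r, r < 10 ∨ r = 11 ∨ 21 < r → R' r = R r) ∧ 0 ≤ R' 17 ∧ |R' 17 - x b| ≤ e * hi / 16 := by
    intro b R hR
    have j8 : R 8 = hi := (hR 8 (by lia)).trans k8
    have j11 : R 11 = _ := (hR 11 (by lia)).trans k11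
    exact runs_ternary H (hc₄.of_eq (fun r hr => hR r (by lia)) (hR 22 (by lia))) b
      (by positivity) (by rw [j8]; cases b <;> linarith) (by rw [j8]; exact h81)
      ((hR 23 (by lia)).trans k23) (by rw [j8, j11, h11eq]) hζ hlen (by rw [j11]; exact hprec)
      (by rw [j11]; exact hprec1) (by rw [j8]; exact hnn)
  refine (Runs.cons (a := 7 * n + 6) (k := 2 * n) ((tern false R₄ fun _ _ => rfl).mono le_rfl le_rfl
    fun R₅ ⟨hs₅, hn₅, hx₅⟩ => ?_)).mono (by lia) (by lia) fun _ h => h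
  refine Runs.block_move (a := 7 * n + 5) ?_
  refine (Runs.cons (a := 1) (k := 0) ((tern true (store R₅ 24 (R₅ 17)) ?_).mono le_rfl le_rfl
    fun R₆ ⟨hs₆, hn₆, hx₆⟩ => ?_)).mono (by lia) (by lia) fun _ h => h
  · intro r hr
    rw [store_of_ne _ _ (by lia), hs₅ r (by lia)]
  · have j24 : R₆ 24 = R₅ 17 := by rw [hs₆ 24 (by lia), store_same]
    obtain ⟨ha0, hfin⟩ := abs_div_sub_div_le (ε := ε) hx0 (H.nonneg true) hxx he he1
      (min_le_left _ _) (by nlinarith : e * hi / 16 ≤ e * x false / 4) hx₅ hx₆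
    refine Runs.block_div (by rwa [j24]) (Runs.nil ?_)
    rwa [store_same, j24]

end

/-! ### Digits of answers, and the total cost of conditional inference. -/

noncomputable section

/-- A bound for the time charged for a call. -/
def callCost (I ζ : ℝ) : ℕ := 1 + (Nat.size ⌊|I| + 1 / ζ + 1⌋₊ + Nat.size ⌈1 / ζ⌉₊)

lemma size_le_log {m : ℕ} {Z : ℝ} (hZ : 1 ≤ Z) (hm : (m : ℝ) ≤ Z) :
    (Nat.size m : ℝ) ≤ 1 + 2 * Real.log Z := by
  have hlog := Real.log_nonneg hZ
  have h2 := Real.log_two_gt_d9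
  rcases Nat.eq_zero_or_pos (Nat.size m) with h | h
  · rw [h]
    simp only [Nat.cast_zero]
    linarith
  · obtain ⟨s, hs⟩ : ∃ s, Nat.size m = s + 1 := ⟨_, (Nat.succ_pred_eq_of_pos h).symm⟩
    have h1 : 2 ^ s ≤ m := Nat.lt_size.1 (by lia)
    have h3 : (2 : ℝ) ^ s ≤ Z := le_trans (by exact_mod_cast h1) hm
    have h4 := Real.log_le_log (by positivity) h3
    rw [Real.log_pow] at h4
    rw [hs]
    push_cast
    have : (s : ℝ) * (1 / 2) ≤ s * Real.log 2 := by gcongr; linarith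
    linarith

/-- Everything is polynomial in `W ≥ 2`: both numbers whose digits are counted are at most `73729 W²
≤ W ^ 19`, as `73729 ≤ 2 ^ 17`. The cost is thus at most `3 + 76 log W`, and `3 ≤ 6 log W`. -/
lemma callCost_le {I g e x : ℝ} (hg : 0 < g) (hg1 : g ≤ 1) (he : 0 < e) (he1 : e ≤ 1) (hx : 0 < x)
    (hx1 : x ≤ 1) :
    (callCost I (g * e ^ 2 * x ^ 2 / 73728) : ℝ) ≤ 82 * Real.log ((2 + |I|) / (g * e * x)) := by
  set ζ := g * e ^ 2 * x ^ 2 / 73728 with hζ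
  have hI := abs_nonneg I
  have hζ0 : 0 < ζ := by positivity
  set W := (2 + |I|) / (g * e * x) with hW
  have hgex : g * e * x ≤ 1 := by
    calc g * e * x ≤ 1 * 1 * 1 := by gcongr
      _ = 1 := by norm_num
  have hW2 : 2 ≤ W := by
    rw [hW, le_div_iff₀ (by positivity)]
    nlinarith
  have hζ1 : ζ ≤ 1 := by
    rw [hζ, div_le_one (by norm_num)]
    calc g * e ^ 2 * x ^ 2 ≤ 1 * 1 ^ 2 * 1 ^ 2 := by gcongr
      _ ≤ 73728 := by norm_num
  set Z := |I| + 1 / ζ + 2 with hZ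
  have hinv : 0 < 1 / ζ := by positivity
  have hZ1 : 1 ≤ Z := by linarith
  have hZW : Z ≤ W ^ 19 := by
    have h1 : (2 + |I|) ≤ (2 + |I|) / (g * e * x) := by
      rw [le_div_iff₀ (by positivity)]
      nlinarith
    have h2 : 1 / ζ ≤ 73728 * W ^ 2 := by
      rw [hζ, hW]
      rw [div_le_iff₀ (by positivity)]
      have : 73728 * ((2 + |I|) / (g * e * x)) ^ 2 * (g * e ^ 2 * x ^ 2 / 73728)
          = (2 + |I|) ^ 2 / g := by field_simp
      rw [this, le_div_iff₀ hg]
      nlinarith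
    have h3 : Z ≤ 73729 * W ^ 2 := by nlinarith
    calc Z ≤ 73729 * W ^ 2 := h3
      _ ≤ 2 ^ 17 * W ^ 2 := by gcongr; norm_num
      _ ≤ W ^ 17 * W ^ 2 := by gcongr
      _ = W ^ 19 := by ring
  have hlog : Real.log Z ≤ 19 * Real.log W := by
    have := Real.log_le_log (by linarith) hZW
    rw [Real.log_pow] at this
    exact_mod_cast this
  have h5 := size_le_log (m := ⌊|I| + 1 / ζ + 1⌋₊) hZ1
    ((Nat.floor_le (by positivity)).trans (by linarith))
  have h6 := size_le_log (m := ⌈1 / ζ⌉₊) hZ1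
    ((Nat.ceil_lt_add_one hinv.le).le.trans (by linarith))
  have h7 := Real.log_two_gt_d9
  have h8 := Real.log_le_log two_pos hW2
  rw [callCost]
  push_cast
  linarith

section

open VarGraph PDG

variable {G : VarGraph} {M : PDG G} {γ : ℝ} {μ : G.Dist} {X Y : Finset G.Var}
  {v : G.Setting (X ∪ Y)} {O : IncSolver}

/-- The optimal probability of the event of a call. -/
def eventPr (μ : G.Dist) (X Y : Finset G.Var) (v : G.Setting (X ∪ Y)) : Bool → ℝ
  | true => μ.pr (X ∪ Y) v
  | false => μ.pr X (v.sub Finset.subset_union_left)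

/-- The inconsistency asked for by a call. -/
def eventInc (M : PDG G) (γ : ℝ) (X Y : Finset G.Var) (v : G.Setting (X ∪ Y)) : Bool → ℝ → ℝ
  | true => M.addInc (X ∪ Y) v γ
  | false => M.addInc X (v.sub Finset.subset_union_left) γ

lemma eventPr_true_le : eventPr μ X Y v true ≤ eventPr μ X Y v false := by
  refine Finset.sum_le_sum fun w _ => ?_
  split_ifs with h1 h2
  · exact le_rfl
  · refine absurd ?_ h2
    rw [← h1]
    rfl
  · exact μ.nonneg _
  · exact le_rfl

/-- The argument keeps distance ζ from 0 and 1, so the exact value is between `I` and `I + 1 / ζ`,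
and the answer errs by less than 1. -/
lemma answer_le {I F r p δ ζ y : ℝ} (hζ : 0 < ζ) (hp : ζ ≤ p) (hp' : p ≤ 1 - ζ) (hδ : ζ ≤ δ)
    (hδ1 : δ ≤ 1) (hy : y ∈ Icc (0 : ℝ) 1) (hF : I ≤ F) (hF' : F ≤ I + binKL y p)
    (hr : |F - r| < δ) : 1 + answerBits r δ ≤ callCost I ζ := by
  have h1 := binKL_le hy hζ hp (by linarith)
  have h2 : |r| ≤ |I| + 1 / ζ + 1 := by
    rw [abs_lt] at hr
    rw [abs_le]
    constructor <;> cases abs_cases I <;> linarith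
  exact Nat.add_le_add_left (Nat.add_le_add (Nat.size_le_size (Nat.floor_le_floor h2))
    (Nat.size_le_size (Nat.ceil_le_ceil (one_div_le_one_div_of_le hζ hδ)))) 1

lemma bowlCalls_incCall (hM : M.Cvx (.real γ)) (hμ : μ ∈ M.Feas)
    (hmin : ∀ ν ∈ M.Feas, M.val γ μ ≤ M.val γ ν) (hO : O.Correct) {ζ : ℝ} (hζ : 0 < ζ) :
    BowlCalls (incCall O M γ X Y v) (eventInc M γ X Y v) (eventPr μ X Y v) (min γ 1) ζ
      (callCost (M.val γ μ) ζ) where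
  left b p q h1 h2 h3 h4 := by
    cases b <;> exact addInc_sub_ge_of_le hM hμ hmin h1 h2 h3 h4
  right b p q h1 h2 h3 h4 := by
    cases b <;> exact addInc_sub_ge_of_ge hM hμ hmin h1 h2 h3 h4
  nonneg b := by cases b <;> exact μ.pr_nonneg _ _
  le_one b := by cases b <;> exact μ.pr_le_one _ _
  g_pos := lt_min hM.2.1 one_pos
  g_le := min_le_right _ _
  call b i j R h1 h2 h3 h4 := by
    have hp : R i ∈ Ioo (0 : ℝ) 1 := ⟨by linarith, by linarith⟩
    have hp' : R i ∈ Icc (0 : ℝ) 1 ∧ 0 < R j := ⟨Ioo_subset_Icc_self hp, by linarith⟩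
    have key : ∀ (U : Finset G.Var) (u : G.Setting U),
        |M.addInc U u γ (R i) - O _ (M.addProb U u _ hp'.1) γ (R j)| < R j ∧
        1 + answerBits (O _ (M.addProb U u _ hp'.1) γ (R j)) (R j) ≤ callCost (M.val γ μ) ζ := by
      intro U u
      have ha := hO _ (M.addProb U u _ hp'.1) γ (R j) hM.2.1.le hp'.2 _
        (addInc_spec hM hμ hmin hp hp'.1)
      refine ⟨ha, answer_le hζ h1 h2 h3 h4 (μ.pr_mem U u) ?_ (addInc_le hM hμ hmin hp hμ) ha⟩
      refine le_trans ?_ (addInc_ge hM hμ hmin hp)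
      have : 0 < min γ 1 := lt_min hM.2.1 one_pos
      exact le_add_of_nonneg_right (by positivity)
    rw [incCall, dif_pos hp']
    cases b
    · exact ⟨_, _, rfl, key X (v.sub Finset.subset_union_left)⟩
    · exact ⟨_, _, rfl, key (X ∪ Y) v⟩

/-- The probes need precisions of order `g x²` and the final searches of order `g e² x`; the product
form lies below both. -/
lemma smallEnough {g e x : ℝ} (hg : 0 < g) (hg1 : g ≤ 1) (he : 0 < e) (he1 : e ≤ 1) (hx : 0 < x)
    (hx1 : x ≤ 1) : SmallEnough g e x (g * e ^ 2 * x ^ 2 / 73728) := by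
  have hx2 : x ^ 2 ≤ 1 := pow_le_one₀ hx.le hx1
  have he2 : e ^ 2 ≤ 1 := pow_le_one₀ he.le he1
  have hee : e ^ 2 ≤ e := by nlinarith
  have hxx : x ^ 2 ≤ x := by nlinarith
  have e1 : g * e ^ 2 * x ^ 2 ≤ g * x ^ 2 := by
    calc g * e ^ 2 * x ^ 2 ≤ g * 1 * x ^ 2 := by gcongr
      _ = _ := by ring
  have e2 : g * x ^ 2 ≤ x ^ 2 := by nlinarith [sq_nonneg x]
  have e3 : g * x ^ 2 ≤ g := by nlinarith
  have e4 : g * e ^ 2 * x ^ 2 ≤ e * x := by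
    calc g * e ^ 2 * x ^ 2 ≤ 1 * e * x := by gcongr
      _ = _ := by ring
  have e5 : g * e ^ 2 * x ^ 2 ≤ g * e ^ 2 * x := by gcongr
  have e6 : 0 < g * e ^ 2 * x ^ 2 := by positivity
  have e7 : 0 < e * x := by positivity
  refine ⟨by positivity, ?_, ?_, ?_, ?_, ?_, ?_⟩ <;> linarith

/-- The claim `halfPow N ≤ x` is `2 ^ N log 2 ≥ log (1 / x)`; as `log 2 > 1/2`, it suffices that `2
^ N ≥ 2 log (1 / x)`, so `N` is doubly logarithmic. -/
lemma exists_halfPow_le {x : ℝ} (hx : 0 < x) (hx1 : x ≤ 1) :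
    ∃ N : ℕ, halfPow N ≤ x ∧ (N : ℝ) ≤ 10 * Real.log (2 + Real.log (1 / x)) := by
  have hB : 0 ≤ Real.log (1 / x) := Real.log_nonneg ((one_le_div hx).2 hx1)
  set B := Real.log (1 / x) with hBd
  obtain ⟨N, hN, hN'⟩ := exists_pow_three_halves (y := 2 * B + 1) (by linarith)
  refine ⟨N, ?_, ?_⟩
  · have h2 : 2 * B ≤ 2 ^ N := by
      have : (3 / 2 : ℝ) ^ N ≤ 2 ^ N := by gcongr; norm_num
      linarith
    rw [← Real.log_le_log_iff (halfPow_pos N) hx, halfPow, Real.log_pow, one_div, Real.log_inv]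
    have h3 : Real.log x = -B := by rw [hBd, one_div, Real.log_inv, neg_neg]
    have h4 := Real.log_two_gt_d9
    rw [h3]
    push_cast
    nlinarith
  · have h1 : Real.log (2 + (2 * B + 1)) ≤ 2 * Real.log (2 + B) := by
      have := Real.log_le_log (by linarith) (by nlinarith : 2 + (2 * B + 1) ≤ (2 + B) ^ 2)
      rw [Real.log_pow] at this
      exact_mod_cast this
    linarith

lemma exists_pow_of_inv {e : ℝ} (he : 0 < e) (he1 : e ≤ 1) :
    ∃ n : ℕ, 16 / e ≤ (3 / 2) ^ n ∧ (n : ℝ) ≤ 25 * Real.log (2 / e) := by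
  obtain ⟨n, hn, hn'⟩ := exists_pow_three_halves (y := 16 / e) (by positivity)
  refine ⟨n, hn, ?_⟩
  have h0 : 1 ≤ 1 / e := (one_le_div he).2 he1
  have h1 : 2 + 16 / e ≤ (2 / e) ^ 5 := by
    have e1 : 16 / e = 16 * (1 / e) := by ring
    have e2 : (2 / e) ^ 5 = 32 * (1 / e) ^ 5 := by ring
    have e3 : 1 / e ≤ (1 / e) ^ 5 := le_self_pow₀ h0 (by norm_num)
    rw [e1, e2]
    linarith
  have h2 := Real.log_le_log (by positivity) h1
  rw [Real.log_pow] at h2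
  push_cast at h2
  linarith

/-- Here `A = log (2 / e)`, `B = log (1 / x)`, `LB = log (2 + B)`, and `L` is the larger logarithm
of the time bound. The quadratic term in `N` is harmless, since `LB ≤ 1 + B` bounds `N` by a
multiple of either factor. For the calls, `A + LB` is at most a multiple of `A · LB` because both
are at least `1/2`. -/
lemma cost_bounds {A B LB L N n c t k : ℝ} (hA : 1 / 2 ≤ A) (hB : 0 ≤ B) (hLB : 1 / 2 ≤ LB)
    (hLB' : LB ≤ 1 + B) (hL : A + B ≤ L) (hN0 : 0 ≤ N) (hN : N ≤ 10 * LB)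
    (hn : n ≤ 25 * A) (hc : c ≤ 82 * L) (hc0 : 0 ≤ c)
    (ht : t ≤ N * (3 * N + 18) + 14 * n + 32 + (4 * N + 4 * n + 2) * c)
    (hk : k ≤ 4 * N + 4 * n + 2) : t ≤ 30000 * L * (A + B) ∧ k ≤ 30000 * A * LB := by
  constructor
  · have hD : 1 / 2 ≤ A + B := by linarith
    have hN' : N ≤ 30 * (A + B) := by linarith
    have hn' : n ≤ 25 * (A + B) := by linarith
    set D := A + B
    have hL0 : 1 / 2 ≤ L := by linarith
    have h1 : (4 * N + 4 * n + 2) * c ≤ 224 * D * (82 * L) :=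
      mul_le_mul (by linarith) hc hc0 (by linarith)
    have h2 : N * (3 * N + 18) ≤ 30 * D * (126 * L) :=
      mul_le_mul hN' (by linarith) (by linarith) (by linarith)
    have h3 : 1 / 4 ≤ D * L := by nlinarith
    have h4 : D ≤ 2 * (D * L) := by nlinarith
    nlinarith
  · have h1 : LB ≤ 2 * (A * LB) := by nlinarith
    have h2 : A ≤ 2 * (A * LB) := by nlinarith
    nlinarith

theorem exists_inferProg :
    ∃ (P : Prog ℕ (Bool × ℕ × ℕ)) (C : ℝ), P.LogFree ∧
      ∀ (G : VarGraph) (M : PDG G) (γ : ℝ), M.Cvx (.real γ) → M.inc γ ≠ ⊤ →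
        ∃ μ : G.Dist, M.opt (.real γ) = {μ} ∧
          ∀ (X Y : Finset G.Var) (v : G.Setting (X ∪ Y)) (ε px : ℝ),
            px = μ.pr X (v.sub Finset.subset_union_left) → 0 < px → 0 < ε →
            ∀ O : IncSolver, O.Correct →
              ∃ (R : ℕ → ℝ) (t k : ℕ),
                Exec (incCall O M γ X Y v) P (initMem ε γ) R t k ∧
                |R 0 - μ.condPr X Y v| ≤ ε ∧
                (t : ℝ) ≤
                  C * Real.log ((2 + |(M.inc γ).toReal|) / (min γ 1 * min ε 1 * px)) *
                    Real.log (2 / (min ε 1 * px)) ∧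
                (k : ℝ) ≤ C * Real.log (2 / min ε 1) * Real.log (2 + Real.log (1 / px)) := by
  refine ⟨inferProg, 30000, by simp [inferProg, setup, gallop, bisect, scaleParams, ternary,
    ternaryStep, probe, Prog.block, Prog.LogFree], ?_⟩
  intro G M γ hM hinc
  obtain ⟨μ, hμ, hopt, hmin⟩ := exists_opt hM hinc
  refine ⟨μ, hopt, ?_⟩
  rintro X Y v ε px rfl hx hε O hO
  set x := μ.pr X (v.sub Finset.subset_union_left) with hxd
  have hx1 : x ≤ 1 := μ.pr_le_one _ _
  rw [inc_eq (γ := γ) hM.1 hμ hmin, EReal.toReal_coe]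
  have hg : 0 < min γ 1 := lt_min hM.2.1 one_pos
  have he : 0 < min ε 1 := lt_min hε one_pos
  have hg1 : min γ 1 ≤ 1 := min_le_right _ _
  have he1 : min ε 1 ≤ 1 := min_le_right _ _
  obtain ⟨N, hN, hNle⟩ := exists_halfPow_le hx hx1
  obtain ⟨n, hn, hnle⟩ := exists_pow_of_inv he he1
  obtain ⟨R, t, k, h1, h2, h3, h4⟩ := runs_inferProg
    (bowlCalls_incCall (X := X) (Y := Y) (v := v) hM hμ hmin hO
      (ζ := min γ 1 * min ε 1 ^ 2 * x ^ 2 / 73728) (by positivity)) hε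
    (smallEnough hg hg1 he he1 hx hx1) hx eventPr_true_le hN hn
  refine ⟨R, t, k, h1, h4, ?_⟩
  have hB : 0 ≤ Real.log (1 / x) := Real.log_nonneg ((one_le_div hx).2 hx1)
  have hAB : Real.log (2 / (min ε 1 * x)) = Real.log (2 / min ε 1) + Real.log (1 / x) := by
    rw [← Real.log_mul (by positivity) (by positivity)]
    congr 1
    field_simp
  have hA : 1 / 2 ≤ Real.log (2 / min ε 1) := by
    have h := Real.log_le_log two_pos ((le_div_iff₀ he).2 (by linarith) : (2 : ℝ) ≤ 2 / min ε 1)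
    have := Real.log_two_gt_d9
    linarith
  have hLB' : Real.log (2 + Real.log (1 / x)) ≤ 1 + Real.log (1 / x) := by
    have := Real.log_le_sub_one_of_pos (by linarith : 0 < 2 + Real.log (1 / x))
    linarith
  have hL : Real.log (2 / min ε 1) + Real.log (1 / x)
      ≤ Real.log ((2 + |M.val γ μ|) / (min γ 1 * min ε 1 * x)) := by
    rw [← hAB]
    refine Real.log_le_log (by positivity) (div_le_div₀ (by positivity) ?_ (by positivity) ?_)
    · linarith [abs_nonneg (M.val γ μ)]
    · rw [mul_assoc]
      exact mul_le_of_le_one_left (by positivity) hg1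
  rw [hAB]
  refine cost_bounds (N := N) (n := n) (B := Real.log (1 / x)) hA hB (half_le_log_two_add hB) hLB' hL
    (Nat.cast_nonneg _) hNle hnle (callCost_le hg hg1 he he1 hx hx1)
    (Nat.cast_nonneg _) ?_ ?_
  · exact_mod_cast h2
  · exact_mod_cast h3

end
end

noncomputable section

/-! ## Tree decompositions and the entropy of optimal distributions -/

section RunningIntersection

variable {ι V : Type} [DecidableEq V] (cl : ι → Finset V)

/-- The union of the clusters in a list. -/
def covered : List ι → Finset V
  | [] => ∅
  | i :: L => cl i ∪ covered L

/-- The running intersection property of a list of clusters, read from its end. -/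
def RunInt : List ι → Prop
  | [] => True
  | i :: L => RunInt L ∧ (L ≠ [] → ∃ p ∈ L, ∀ j ∈ L, cl i ∩ cl j ⊆ cl p)

variable {cl}

lemma mem_covered {x : V} {L : List ι} : x ∈ covered cl L ↔ ∃ i ∈ L, x ∈ cl i := by
  induction L with
  | nil => simp [covered]
  | cons i L ih => simp [covered, ih]

end RunningIntersection

namespace TreeDecomp

variable {G : VarGraph} (D : TreeDecomp G)

/-- A list closed under tree paths is a subtree, and as long as nodes are missing some edge from `p`
to `i` leaves it. The path from `i` to any listed `j` then runs through `p`, so `p` contains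
whatever the cluster of `i` shares with that of `j`. -/
lemma exists_runInt_of_le (n : ℕ) (hn : n ≤ Fintype.card D.Node) :
    ∃ l : List D.Node, l.Nodup ∧ l.length = n ∧ RunInt D.cluster l ∧
      ∀ i ∈ l, ∀ j ∈ l, ∀ q : D.tree.Walk i j, q.IsPath → ∀ k ∈ q.support, k ∈ l := by
  classical
  induction n with
  | zero => exact ⟨[], List.nodup_nil, rfl, trivial, by simp⟩
  | succ n ih =>
    obtain ⟨l, hnd, hlen, hrun, hpath⟩ := ih (by lia)
    have huniq : ∀ {i j : D.Node} (p q : D.tree.Walk i j), p.IsPath → q.IsPath → p = q :=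
      fun p q hp hq => congrArg Subtype.val
      ((D.isTree.isAcyclic.subsingleton_path _ _).elim ⟨p, hp⟩ ⟨q, hq⟩)
    cases n with
    | zero =>
      obtain ⟨r⟩ := D.isTree.connected.nonempty
      obtain rfl := List.length_eq_zero_iff.1 hlen
      refine ⟨[r], by simp, rfl, ⟨trivial, by simp⟩, ?_⟩
      intro i hi j hj q hq k hk
      rw [List.mem_singleton] at hi hj
      subst hi hj
      rw [huniq q .nil hq .nil] at hk
      simpa using hk
    | succ n =>
      obtain ⟨p₀, hp₀⟩ : ∃ p, p ∈ l := List.exists_mem_of_length_pos (by lia)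
      obtain ⟨q₀, hq₀⟩ : ∃ q, q ∉ l := by
        by_contra! hall
        have : Fintype.card D.Node ≤ l.length := by
          rw [← List.toFinset_card_of_nodup hnd, ← Finset.card_univ]
          exact Finset.card_le_card fun x _ => List.mem_toFinset.2 (hall x)
        lia
      obtain ⟨w⟩ := D.isTree.connected.preconnected p₀ q₀
      obtain ⟨d, -, hd1, hd2⟩ := w.exists_boundary_dart {x | x ∈ l} (by simpa using hp₀)
        (by simpa using hq₀)
      obtain ⟨⟨p, i⟩, hadj⟩ := d
      replace hd1 : p ∈ l := by simpa using hd1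
      replace hd2 : i ∉ l := by simpa using hd2
      replace hadj : D.tree.Adj p i := hadj
      have key : ∀ j ∈ l, ∃ q : D.tree.Walk i j, q.IsPath ∧ p ∈ q.support ∧
          ∀ k ∈ q.support, k ∈ i :: l := by
        intro j hj
        obtain ⟨q, hq⟩ := D.isTree.connected.exists_isPath p j
        have hsupp := hpath p hd1 j hj q hq
        refine ⟨.cons hadj.symm q, ?_, by simp, ?_⟩
        · rw [SimpleGraph.Walk.cons_isPath_iff]
          exact ⟨hq, fun h => hd2 (hsupp i h)⟩
        · intro k hk
          rw [SimpleGraph.Walk.support_cons, List.mem_cons] at hk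
          rcases hk with rfl | hk
          · simp
          · exact List.mem_cons_of_mem _ (hsupp k hk)
      refine ⟨i :: l, List.nodup_cons.2 ⟨hd2, hnd⟩, by simp [hlen], ⟨hrun, fun _ => ⟨p, hd1, ?_⟩⟩, ?_⟩
      · intro j hj
        obtain ⟨q, hq, hpq, -⟩ := key j hj
        exact D.path_subset i j q hq p hpq
      · intro a ha b hb q hq k hk
        rw [List.mem_cons] at ha hb
        rcases ha with rfl | ha <;> rcases hb with rfl | hb
        · rw [huniq q .nil hq .nil] at hk
          simp_all
        · obtain ⟨q', hq', -, hsupp⟩ := key b hb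
          rw [huniq q q' hq hq'] at hk
          exact hsupp k hk
        · obtain ⟨q', hq', -, hsupp⟩ := key a ha
          rw [huniq q q'.reverse hq hq'.reverse] at hk
          exact hsupp k (by simpa using hk)
        · exact List.mem_cons_of_mem _ (hpath a ha b hb q hq k hk)

/-- The nodes of a tree decomposition can be listed with the running intersection property. -/
lemma exists_runInt : ∃ l : List D.Node, l.Nodup ∧ (∀ i, i ∈ l) ∧ RunInt D.cluster l := by
  classical
  obtain ⟨l, hnd, hlen, hrun, -⟩ := D.exists_runInt_of_le _ le_rfl
  refine ⟨l, hnd, fun i => ?_, hrun⟩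
  have : l.toFinset = Finset.univ := by
    rw [← Finset.card_eq_iff_eq_univ, List.toFinset_card_of_nodup hnd, hlen]
  rw [← List.mem_toFinset, this]
  exact Finset.mem_univ i

end TreeDecomp

namespace VarGraph

variable {G : VarGraph}

/-- Some world with a given restriction. -/
def Setting.extend {U : Finset G.Var} (u : G.Setting U) : G.World :=
  fun x => if h : x ∈ U then u ⟨x, h⟩ else Classical.arbitrary _

lemma restrict_extend {U : Finset G.Var} (u : G.Setting U) : restrict U u.extend = u := by
  funext x
  exact dif_pos x.2

namespace Dist

variable {μ ν ρ : G.Dist} {U : Finset G.Var}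

lemma sum_mul_eq_sum_pr (μ : G.Dist) (f : G.World → ℝ)
    (hf : ∀ w w', restrict U w = restrict U w' → f w = f w') :
    ∑ w, μ.1 w * f w = ∑ u : G.Setting U, μ.pr U u * f u.extend := by
  rw [μ.sum_pr_mul U fun u => f u.extend]
  exact Finset.sum_congr rfl fun w _ => by rw [hf w _ (restrict_extend _).symm]

/-- The distributions agree on the variables in `U`. -/
def AgreeOn (μ ν : G.Dist) (U : Finset G.Var) : Prop := ∀ u, μ.pr U u = ν.pr U u

lemma AgreeOn.sum_eq (h : AgreeOn μ ν U) (f : G.World → ℝ)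
    (hf : ∀ w w', restrict U w = restrict U w' → f w = f w') :
    ∑ w, μ.1 w * f w = ∑ w, ν.1 w * f w := by
  rw [sum_mul_eq_sum_pr μ f hf, sum_mul_eq_sum_pr ν f hf]
  exact Finset.sum_congr rfl fun u _ => by rw [h]

lemma restrict_mono {S : Finset G.Var} (hS : S ⊆ U) {w w' : G.World}
    (h : restrict U w = restrict U w') : restrict S w = restrict S w' :=
  (restrict_eq_iff S w w').2 fun x hx => (restrict_eq_iff U w w').1 h x (hS hx)

lemma pr_eq_sum_mul (μ : G.Dist) (S : Finset G.Var) (s : G.Setting S) :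
    μ.pr S s = ∑ w, μ.1 w * if restrict S w = s then 1 else 0 :=
  Finset.sum_congr rfl fun w _ => by split_ifs <;> simp

lemma pr2_eq_sum_mul (μ : G.Dist) (S T : Finset G.Var) (s : G.Setting S) (t : G.Setting T) :
    μ.pr2 S T s t = ∑ w, μ.1 w * if restrict S w = s ∧ restrict T w = t then 1 else 0 :=
  Finset.sum_congr rfl fun w _ => by split_ifs <;> simp

lemma AgreeOn.mono (h : AgreeOn μ ν U) {S : Finset G.Var} (hS : S ⊆ U) : AgreeOn μ ν S := by
  intro s
  rw [pr_eq_sum_mul, pr_eq_sum_mul]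
  exact h.sum_eq _ fun w w' hw => by rw [restrict_mono hS hw]

lemma AgreeOn.pr2_eq (h : AgreeOn μ ν U) {S T : Finset G.Var} (hS : S ⊆ U) (hT : T ⊆ U) (s t) :
    μ.pr2 S T s t = ν.pr2 S T s t := by
  rw [pr2_eq_sum_mul, pr2_eq_sum_mul]
  exact h.sum_eq _ fun w w' hw => by rw [restrict_mono hS hw, restrict_mono hT hw]

lemma AgreeOn.ent_eq (h : AgreeOn μ ν U) : μ.ent U = ν.ent U := by
  simp only [ent, h _]

lemma AgreeOn.symm (h : AgreeOn μ ν U) : AgreeOn ν μ U := fun u => (h u).symm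

/-- The joint weight of a pair of worlds that agree on `S`, the second one being chosen
independently of the first one given `S`. -/
def glueWeight (μ ν : G.Dist) (S : Finset G.Var) (w₁ w₂ : G.World) : ℝ :=
  if restrict S w₁ = restrict S w₂ then μ.1 w₁ * ν.1 w₂ / μ.pr S (restrict S w₁) else 0

lemma sum_glueWeight_right {S : Finset G.Var} (h : AgreeOn μ ν S) (w₁ : G.World) :
    ∑ w₂, glueWeight μ ν S w₁ w₂ = μ.1 w₁ := by
  have : ∀ w₂, glueWeight μ ν S w₁ w₂ = μ.1 w₁ / μ.pr S (restrict S w₁) *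
      if restrict S w₂ = restrict S w₁ then ν.1 w₂ else 0 := by
    intro w₂
    by_cases hw : restrict S w₁ = restrict S w₂
    · rw [glueWeight, if_pos hw, if_pos hw.symm]; ring
    · rw [glueWeight, if_neg hw, if_neg (Ne.symm hw), mul_zero]
  rw [Finset.sum_congr rfl fun w _ => this w, ← Finset.mul_sum]
  change μ.1 w₁ / μ.pr S (restrict S w₁) * ν.pr S (restrict S w₁) = μ.1 w₁
  rw [← h]
  by_cases h0 : μ.pr S (restrict S w₁) = 0
  · have := μ.le_pr S w₁
    rw [h0] at this ⊢
    simp [le_antisymm this (μ.nonneg _)]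
  · field_simp

lemma sum_glueWeight_left {S : Finset G.Var} (h : AgreeOn μ ν S) (w₂ : G.World) :
    ∑ w₁, glueWeight μ ν S w₁ w₂ = ν.1 w₂ := by
  have : ∀ w₁, glueWeight μ ν S w₁ w₂ = ν.1 w₂ / μ.pr S (restrict S w₂) *
      if restrict S w₁ = restrict S w₂ then μ.1 w₁ else 0 := by
    intro w₁
    by_cases hw : restrict S w₁ = restrict S w₂
    · rw [glueWeight, if_pos hw, if_pos hw, hw]; ring
    · rw [glueWeight, if_neg hw, if_neg hw, mul_zero]
  rw [Finset.sum_congr rfl fun w _ => this w, ← Finset.mul_sum]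
  change ν.1 w₂ / μ.pr S (restrict S w₂) * μ.pr S (restrict S w₂) = ν.1 w₂
  by_cases h0 : μ.pr S (restrict S w₂) = 0
  · have := ν.le_pr S w₂
    rw [← h, h0] at this
    rw [h0]
    simp [le_antisymm this (ν.nonneg _)]
  · field_simp

/-- Two distributions that agree on the common variables of `A` and `B` can be glued. -/
lemma exists_glue {A B : Finset G.Var} (h : AgreeOn μ ν (A ∩ B)) :
    ∃ ρ : G.Dist, AgreeOn ρ μ A ∧ AgreeOn ρ ν B ∧ ∀ w : G.World,
      ρ.pr (A ∪ B) (restrict (A ∪ B) w) = μ.pr A (restrict A w) * ν.pr B (restrict B w)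
        / μ.pr (A ∩ B) (restrict (A ∩ B) w) := by
  -- Draw `w₁` from μ and `w₂` from ν, conditionally independent given `A ∩ B`; read the variables
  -- of `A` off `w₁` and all others off `w₂`. Under positive weight both agree on `A ∩ B`, so all of
  -- `B` may be read off `w₂`.
  set κ := glueWeight μ ν (A ∩ B) with hκ
  have hsum : ∀ f : G.World → ℝ, ∑ w, (∑ w₁, ∑ w₂, κ w₁ w₂ *
      if A.piecewise w₁ w₂ = w then 1 else 0) * f w
      = ∑ w₁, ∑ w₂, κ w₁ w₂ * f (A.piecewise w₁ w₂) := by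
    intro f
    simp only [Finset.sum_mul]
    rw [Finset.sum_comm]
    refine Finset.sum_congr rfl fun w₁ _ => ?_
    rw [Finset.sum_comm]
    refine Finset.sum_congr rfl fun w₂ _ => ?_
    simp
  have hκ0 : ∀ w₁ w₂, 0 ≤ κ w₁ w₂ := by
    intro w₁ w₂
    rw [hκ, glueWeight]
    split_ifs
    · exact div_nonneg (mul_nonneg (μ.nonneg _) (ν.nonneg _)) (μ.pr_nonneg _ _)
    · exact le_rfl
  have hval : ∀ w₁ w₂, κ w₁ w₂ ≠ 0 → ∀ x ∈ B, A.piecewise w₁ w₂ x = w₂ x := by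
    intro w₁ w₂ hne x hx
    by_cases hxA : x ∈ A
    · rw [Finset.piecewise_eq_of_mem _ _ _ hxA]
      by_contra hxne
      refine hne (if_neg fun he => hxne ?_)
      exact (restrict_eq_iff _ _ _).1 he x (Finset.mem_inter.2 ⟨hxA, hx⟩)
    · rw [Finset.piecewise_eq_of_notMem _ _ _ hxA]
  refine ⟨⟨fun w => ∑ w₁, ∑ w₂, κ w₁ w₂ * if A.piecewise w₁ w₂ = w then 1 else 0, ?_, ?_⟩, ?_, ?_, ?_⟩
  · intro w
    exact Finset.sum_nonneg fun w₁ _ => Finset.sum_nonneg fun w₂ _ =>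
      mul_nonneg (hκ0 _ _) (by split_ifs <;> norm_num)
  · have := hsum fun _ => 1
    simp only [mul_one] at this
    rw [this, Finset.sum_congr rfl fun w₁ _ => sum_glueWeight_right h w₁, μ.sum_eq_one]
  · intro u
    rw [pr_eq_sum_mul, hsum, pr_eq_sum_mul]
    refine Finset.sum_congr rfl fun w₁ _ => ?_
    rw [← sum_glueWeight_right h w₁, Finset.sum_mul]
    refine Finset.sum_congr rfl fun w₂ _ => ?_
    have : restrict A (A.piecewise w₁ w₂) = restrict A w₁ :=
      (restrict_eq_iff _ _ _).2 fun x hx => Finset.piecewise_eq_of_mem _ _ _ hx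
    rw [this]
  · intro u
    rw [pr_eq_sum_mul, hsum, pr_eq_sum_mul, Finset.sum_comm]
    refine Finset.sum_congr rfl fun w₂ _ => ?_
    rw [← sum_glueWeight_left h w₂, Finset.sum_mul]
    refine Finset.sum_congr rfl fun w₁ _ => ?_
    by_cases h0 : κ w₁ w₂ = 0
    · rw [h0, ← hκ, h0, zero_mul, zero_mul]
    · rw [(restrict_eq_iff B _ w₂).2 (hval w₁ w₂ h0)]
  · intro w
    rw [pr_eq_sum_mul, hsum, pr_eq_sum_mul μ, pr_eq_sum_mul ν, Finset.sum_mul_sum, Finset.sum_div]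
    refine Finset.sum_congr rfl fun w₁ _ => ?_
    rw [Finset.sum_div]
    refine Finset.sum_congr rfl fun w₂ _ => ?_
    by_cases h12 : restrict A w₁ = restrict A w ∧ restrict B w₂ = restrict B w
    · obtain ⟨h1, h2⟩ := h12
      have hA := (restrict_eq_iff _ _ _).1 h1
      have hB := (restrict_eq_iff _ _ _).1 h2
      have hS : restrict (A ∩ B) w₁ = restrict (A ∩ B) w₂ := (restrict_eq_iff _ _ _).2 fun x hx => by
        rw [hA x (Finset.mem_of_mem_inter_left hx), hB x (Finset.mem_of_mem_inter_right hx)]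
      have hu : restrict (A ∪ B) (A.piecewise w₁ w₂) = restrict (A ∪ B) w := by
        refine (restrict_eq_iff _ _ _).2 fun x hx => ?_
        by_cases hxA : x ∈ A
        · rw [Finset.piecewise_eq_of_mem _ _ _ hxA, hA x hxA]
        · rw [Finset.piecewise_eq_of_notMem _ _ _ hxA]
          exact hB x ((Finset.mem_union.1 hx).resolve_left hxA)
      rw [if_pos h1, if_pos h2, if_pos hu, hκ, glueWeight, if_pos hS,
        restrict_mono Finset.inter_subset_left h1]
      ring
    · have : (μ.1 w₁ * if restrict A w₁ = restrict A w then 1 else 0) *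
          (ν.1 w₂ * if restrict B w₂ = restrict B w then 1 else 0) = 0 := by
        rw [not_and_or] at h12
        rcases h12 with h1 | h1 <;> simp [h1]
      rw [this, zero_div]
      by_cases h0 : κ w₁ w₂ = 0
      · rw [h0, zero_mul]
      rw [if_neg, mul_zero]
      intro hu
      have hu := (restrict_eq_iff _ _ _).1 hu
      refine h12 ⟨(restrict_eq_iff _ _ _).2 fun x hx => ?_, (restrict_eq_iff _ _ _).2 fun x hx => ?_⟩
      · rw [← hu x (Finset.mem_union_left _ hx), Finset.piecewise_eq_of_mem _ _ _ hx]
      · rw [← hu x (Finset.mem_union_right _ hx), hval w₁ w₂ h0 x hx]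

end Dist

end VarGraph
end

/-! ### Junction distributions and maximal entropy. -/

noncomputable section

namespace VarGraph.Dist

variable {G : VarGraph} {ι : Type}

/-- Clusters are glued one at a time along `cl i ∩ covered cl L`. One cluster of `L` contains this
separator, so agreement with μ on that cluster is enough for gluing. The separators are chosen
before μ because the program built from them must serve all instances. -/
lemma exists_junction [DecidableEq ι] (cl : ι → Finset G.Var) (L : List ι) (hnd : L.Nodup)
    (hrun : RunInt cl L) :
    ∃ sep : ι → Finset G.Var, (∀ i, sep i ⊆ cl i) ∧ ∀ μ : G.Dist, ∃ ρ : G.Dist,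
      (∀ i ∈ L, AgreeOn ρ μ (cl i)) ∧ ∀ w,
        ρ.pr (covered cl L) (restrict _ w)
          = (L.map fun i => μ.pr (cl i) (restrict _ w) / μ.pr (sep i) (restrict _ w)).prod := by
  induction L with
  | nil =>
    refine ⟨fun _ => ∅, fun _ => Finset.empty_subset _, fun μ => ⟨μ, by simp, fun w => ?_⟩⟩
    rw [List.map_nil, List.prod_nil]
    exact μ.pr_empty _
  | cons i L ih =>
    obtain ⟨hi, hnd⟩ := List.nodup_cons.1 hnd
    obtain ⟨sep, hsub, hsep⟩ := ih hnd hrun.1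
    refine ⟨Function.update sep i (cl i ∩ covered cl L), fun j => ?_, fun μ => ?_⟩
    · by_cases hj : j = i
      · subst hj
        rw [Function.update_self]
        exact Finset.inter_subset_left
      · rw [Function.update_of_ne hj]
        exact hsub j
    · obtain ⟨ρ, hagree, hprod⟩ := hsep μ
      have hS : AgreeOn μ ρ (cl i ∩ covered cl L) := by
        by_cases hL : L = []
        · subst hL
          have : cl i ∩ covered cl [] = ∅ := by simp [covered]
          rw [this]
          intro u
          rw [pr_empty, pr_empty]
        · obtain ⟨p, hp, hint⟩ := hrun.2 hL
          refine (hagree p hp).symm.mono fun x hx => ?_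
          obtain ⟨hxi, hx⟩ := Finset.mem_inter.1 hx
          obtain ⟨j, hj, hxj⟩ := mem_covered.1 hx
          exact hint j hj (Finset.mem_inter.2 ⟨hxi, hxj⟩)
      obtain ⟨ρ', h1, h2, h3⟩ := exists_glue hS
      refine ⟨ρ', fun j hj => ?_, fun w => ?_⟩
      · rcases List.mem_cons.1 hj with rfl | hj
        · exact h1
        · intro u
          rw [← hagree j hj u]
          exact h2.mono (fun x hx => mem_covered.2 ⟨j, hj, hx⟩) u
      · refine (h3 w).trans ?_
        rw [List.map_cons, List.prod_cons, hprod w, Function.update_self, div_mul_eq_mul_div]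
        congr 3
        refine List.map_congr_left fun j hj => ?_
        rw [Function.update_of_ne (ne_of_mem_of_not_mem hj hi)]

lemma pr_univ (μ : G.Dist) (w : G.World) :
    μ.pr Finset.univ (restrict Finset.univ w) = μ.1 w := by
  rw [pr, Finset.sum_eq_single w]
  · simp
  · intro w' _ hne
    exact if_neg fun h => hne (funext fun x => (restrict_eq_iff _ _ _).1 h x (Finset.mem_univ x))
  · simp

lemma pr_pos {μ : G.Dist} {w : G.World} (h : μ.1 w ≠ 0) (U : Finset G.Var) :
    0 < μ.pr U (restrict U w) :=
  (lt_of_le_of_ne (μ.nonneg w) h.symm).trans_le (μ.le_pr U w)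

lemma entropy_eq (μ : G.Dist) : μ.entropy = -∑ w, μ.1 w * Real.log (μ.1 w) := by
  rw [entropy, ← Finset.sum_neg_distrib]
  exact Finset.sum_congr rfl fun w _ => by rw [Real.negMulLog]; ring

/-- The logarithm of a junction distribution is a sum of functions of single clusters, so its mean
is the same for all ν with the same marginals. Taking `ν = ρ` gives `H(ρ)`, and `ν = μ` gives `H(ρ)
- H(μ)` as a relative entropy, hence nonnegative. -/
lemma sum_mul_log_junction [Fintype ι] {A B : ι → Finset G.Var} {μ ρ ν : G.Dist}
    (hρ : ∀ w, ρ.1 w = ∏ i, μ.pr (A i) (restrict _ w) / μ.pr (B i) (restrict _ w))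
    (hA : ∀ i, AgreeOn ν μ (A i)) (hB : ∀ i, AgreeOn ν μ (B i)) :
    ∑ w, ν.1 w * Real.log (ρ.1 w) = -∑ i, (μ.ent (A i) - μ.ent (B i)) := by
  have h : ∀ w, ν.1 w * Real.log (ρ.1 w) = ∑ i, (ν.1 w * Real.log (ν.pr (A i) (restrict _ w))
      - ν.1 w * Real.log (ν.pr (B i) (restrict _ w))) := by
    intro w
    by_cases h0 : ν.1 w = 0
    · simp [h0]
    · rw [hρ, Real.log_prod fun i _ => ?_, Finset.mul_sum]
      · refine Finset.sum_congr rfl fun i _ => ?_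
        rw [← hA, ← hB, Real.log_div (pr_pos h0 _).ne' (pr_pos h0 _).ne', mul_sub]
      · rw [← hA, ← hB]
        exact (div_pos (pr_pos h0 _) (pr_pos h0 _)).ne'
  rw [Finset.sum_congr rfl fun w _ => h w, Finset.sum_comm, ← Finset.sum_neg_distrib]
  refine Finset.sum_congr rfl fun i _ => ?_
  rw [Finset.sum_sub_distrib, ← (hA i).ent_eq, ← (hB i).ent_eq, ent_eq, ent_eq]
  ring

/-- The junction distribution has the largest entropy among the distributions with the same
cluster marginals. -/
lemma exists_entropy_eq_sum (D : TreeDecomp G) : ∃ sep : D.Node → Finset G.Var,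
    (∀ i, sep i ⊆ D.cluster i) ∧ ∀ μ : G.Dist, ∃ ρ : G.Dist,
      (∀ i, AgreeOn ρ μ (D.cluster i)) ∧
      ρ.entropy = ∑ i, (μ.ent (D.cluster i) - μ.ent (sep i)) ∧ μ.entropy ≤ ρ.entropy := by
  classical
  obtain ⟨l, hnd, hall, hrun⟩ := D.exists_runInt
  obtain ⟨sep, hsub, hsep⟩ := exists_junction D.cluster l hnd hrun
  refine ⟨sep, hsub, fun μ => ?_⟩
  obtain ⟨ρ, hagree, hprod⟩ := hsep μ
  have hcov : covered D.cluster l = Finset.univ := by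
    refine Finset.eq_univ_iff_forall.2 fun x => ?_
    obtain ⟨i, hi⟩ := D.var_mem x
    exact mem_covered.2 ⟨i, hall i, hi⟩
  have huniv : l.toFinset = Finset.univ :=
    Finset.eq_univ_iff_forall.2 fun i => List.mem_toFinset.2 (hall i)
  rw [hcov] at hprod
  have hρ : ∀ w, ρ.1 w = ∏ i, μ.pr (D.cluster i) (restrict _ w) / μ.pr (sep i) (restrict _ w) := by
    intro w
    rw [← pr_univ, hprod, ← huniv, List.prod_toFinset _ hnd]
  have hent : ρ.entropy = ∑ i, (μ.ent (D.cluster i) - μ.ent (sep i)) := by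
    rw [entropy_eq, sum_mul_log_junction hρ (fun i => hagree i (hall i))
      (fun i => (hagree i (hall i)).mono (hsub i)), neg_neg]
  have hac : ∀ w, ρ.1 w = 0 → μ.1 w = 0 := by
    intro w hw
    by_contra h0
    rw [hρ] at hw
    obtain ⟨i, -, hi⟩ := Finset.prod_eq_zero_iff.1 hw
    exact (div_pos (pr_pos h0 _) (pr_pos h0 _)).ne' hi
  refine ⟨ρ, fun i => hagree i (hall i), hent, ?_⟩
  have hkl := kl_nonneg μ ρ hac
  have : μ.kl ρ = -μ.entropy - ∑ w, μ.1 w * Real.log (ρ.1 w) := by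
    rw [kl, entropy_eq, neg_neg, ← Finset.sum_sub_distrib]
    refine Finset.sum_congr rfl fun w _ => ?_
    by_cases h0 : μ.1 w = 0
    · simp [h0]
    · rw [klTerm, Real.log_div h0 (fun h => h0 (hac w h)), mul_sub]
  rw [this, sum_mul_log_junction hρ (fun i u => rfl) (fun i u => rfl), ← hent] at hkl
  linarith

end VarGraph.Dist

namespace PDG

open VarGraph Dist

variable {G : VarGraph} {M : PDG G}

/-- The entropy of an optimal distribution splits along a tree decomposition. -/
lemma exists_entropy_opt (D : TreeDecomp G) : ∃ sep : D.Node → Finset G.Var,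
    (∀ i, sep i ⊆ D.cluster i) ∧ ∀ (M : PDG G) (γ : ℝ), 0 < γ → ∀ μ ∈ M.Feas,
      (∀ ν ∈ M.Feas, M.val γ μ ≤ M.val γ ν) →
        μ.entropy = ∑ i, (μ.ent (D.cluster i) - μ.ent (sep i)) := by
  obtain ⟨sep, hsub, hsep⟩ := exists_entropy_eq_sum D
  refine ⟨sep, hsub, fun M γ hγ μ hμ hmin => ?_⟩
  obtain ⟨ρ, hagree, hent, hle⟩ := hsep μ
  have hp2 : ∀ a s t, ρ.pr2 (G.src a) (G.tgt a) s t = μ.pr2 (G.src a) (G.tgt a) s t := fun a =>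
    (hagree (D.home a)).pr2_eq (D.src_subset a) (D.tgt_subset a)
  have hp : ∀ a s, ρ.pr (G.src a) s = μ.pr (G.src a) s := fun a =>
    (hagree (D.home a)).mono (D.src_subset a)
  have hρ : ρ ∈ M.Feas := by
    intro a
    simpa only [hp2, hp] using hμ a
  have h1 : ∀ a, ρ.condEntropy (G.src a) (G.tgt a) = μ.condEntropy (G.src a) (G.tgt a) := by
    intro a
    simp only [condEntropy, hp2, hp]
  have h2 : ∀ a, M.logLik a ρ = M.logLik a μ := fun a =>
    (hagree (D.home a)).sum_eq (fun w => Real.log (M.cpd a (VarGraph.restrict (G.src a) w)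
      (VarGraph.restrict (G.tgt a) w))) fun w w' hw => by
        rw [restrict_mono (D.src_subset a) hw, restrict_mono (D.tgt_subset a) hw]
  -- Every arc lies in a cluster, so ρ is feasible and its score differs from that of μ only in the
  -- entropy term; optimality of μ with `γ > 0` rules out a larger entropy of ρ.
  have hval : M.val γ ρ = M.val γ μ + γ * μ.entropy - γ * ρ.entropy := by
    simp only [val, h1, h2]
    ring
  have := hmin ρ hρ
  rw [← hent]
  nlinarith

end PDG
end

noncomputable section

/-! ## The inconsistency as a function of the cluster marginals -/

/-- `x log x` has infinite slope at 0 but is Hölder of exponent `1/2`: the difference is at least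
`(b - a) log (b - a) ≥ -2 √(b - a)` and at most `b (b - a)`. The bound `b ≤ 2` leaves room for
approximate probabilities above 1. -/
lemma mul_log_sub_le {a b s : ℝ} (ha : 0 ≤ a) (hab : a ≤ b) (hb : b ≤ 2) (hs0 : 0 ≤ s) (hs : s ≤ 1)
    (hd : b - a ≤ s ^ 2) : |b * Real.log b - a * Real.log a| ≤ 2 * s := by
  rcases hab.eq_or_lt with rfl | hab
  · simpa using hs0
  have hb0 : 0 < b := ha.trans_lt hab
  have hd0 : 0 < b - a := sub_pos.2 hab
  have hss : s ^ 2 ≤ s := by nlinarith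
  have hlogb : Real.log b ≤ b - 1 := Real.log_le_sub_one_of_pos hb0
  have hmono : a * Real.log a ≤ a * Real.log b ∧ a * Real.log b - a * Real.log a ≤ b - a := by
    rcases ha.eq_or_lt with rfl | ha
    · simpa using hb0.le
    refine ⟨mul_le_mul_of_nonneg_left (Real.log_le_log ha hab.le) ha.le, ?_⟩
    have h := Real.log_le_sub_one_of_pos (div_pos hb0 ha)
    rw [Real.log_div hb0.ne' ha.ne'] at h
    have := mul_le_mul_of_nonneg_left h ha.le
    have he : a * (b / a - 1) = b - a := by field_simp
    linarith
  have hlower : -(2 * s) ≤ (b - a) * Real.log (b - a) := by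
    set r := √(b - a) with hr
    have hr0 : 0 < r := Real.sqrt_pos.2 hd0
    have hrd : r ^ 2 = b - a := Real.sq_sqrt hd0.le
    have hrs : r ≤ s := Real.sqrt_le_iff.2 ⟨hs0, hd⟩
    have h := Real.one_sub_inv_le_log_of_pos hr0
    have hlog : Real.log (b - a) = 2 * Real.log r := by
      rw [← hrd, Real.log_pow]; norm_num
    rw [hlog, ← hrd]
    have h2 := mul_le_mul_of_nonneg_left h (sq_nonneg r)
    have he : r ^ 2 * (1 - r⁻¹) = r ^ 2 - r := by field_simp
    nlinarith [sq_nonneg r]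
  have hlogd : (b - a) * Real.log (b - a) ≤ (b - a) * Real.log b :=
    mul_le_mul_of_nonneg_left (Real.log_le_log hd0 (by linarith)) hd0.le
  rw [abs_le]
  constructor
  · linarith [hmono.1]
  · have h1 : (b - a) * Real.log b ≤ (b - a) * (b - 1) := mul_le_mul_of_nonneg_left hlogb hd0.le
    nlinarith [hmono.2]

lemma abs_mul_log_sub_le {x y s : ℝ} (hx : 0 ≤ x) (hy : 0 ≤ y) (hy1 : y ≤ 1) (hs0 : 0 ≤ s)
    (hs : s ≤ 1) (h : |x - y| ≤ s ^ 2) : |x * Real.log x - y * Real.log y| ≤ 2 * s := by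
  rw [abs_le] at h
  rcases le_total x y with hxy | hxy
  · rw [abs_sub_comm]
    exact mul_log_sub_le hx hxy (by linarith) hs0 hs (by linarith)
  · exact mul_log_sub_le hy hxy (by nlinarith) hs0 hs h.2

namespace VarGraph

variable {G : VarGraph} {C : Finset G.Var}

/-- The mass that the table `q` gives to the settings that agree with `c` on `U`. -/
def blockMass (U : Finset G.Var) (q : G.Setting C → ℝ) (u : G.Setting U) : ℝ :=
  ∑ c, if restrict U c.extend = u then q c else 0

/-- The negated entropy of `U` computed from a table of probabilities of settings of `C`. -/
def fragment (U : Finset G.Var) (q : G.Setting C → ℝ) : ℝ :=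
  ∑ c, q c * Real.log (blockMass U q (restrict U c.extend))

/-- Grouping by blocks gives the form suited to estimates; the definition has the form that is
evaluated with a bounded number of steps per setting of the cluster. -/
lemma fragment_eq (U : Finset G.Var) (q : G.Setting C → ℝ) :
    fragment U q = ∑ u ∈ Finset.univ.image fun c : G.Setting C => restrict U c.extend,
      blockMass U q u * Real.log (blockMass U q u) := by
  rw [fragment, ← Finset.sum_fiberwise_of_maps_to
    (fun c _ => Finset.mem_image_of_mem (fun c : G.Setting C => restrict U c.extend)
      (Finset.mem_univ c))]
  refine Finset.sum_congr rfl fun u _ => ?_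
  have : blockMass U q u = ∑ c with restrict U c.extend = u, q c := (Finset.sum_filter _ _).symm
  nth_rewrite 1 [this]
  rw [Finset.sum_mul]
  exact Finset.sum_congr rfl fun c hc => by rw [(Finset.mem_filter.1 hc).2]

lemma blockMass_nonneg {U : Finset G.Var} {q : G.Setting C → ℝ} (hq : ∀ c, 0 ≤ q c)
    (u : G.Setting U) : 0 ≤ blockMass U q u :=
  Finset.sum_nonneg fun c _ => by split_ifs; exacts [hq c, le_rfl]

/-- A block mass sums at most `card` entries and so errs by at most `card · δ ≤ s²`, and there are
at most `card` blocks. Only the exact table `p` is normalized. -/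
lemma abs_fragment_sub_le {U : Finset G.Var} {q p : G.Setting C → ℝ} {δ s : ℝ}
    (hq : ∀ c, 0 ≤ q c) (hp : ∀ c, 0 ≤ p c) (hp1 : ∑ c, p c = 1) (hpq : ∀ c, |q c - p c| ≤ δ)
    (hs0 : 0 ≤ s) (hs : s ≤ 1) (hδ : Fintype.card (G.Setting C) * δ ≤ s ^ 2) :
    |fragment U q - fragment U p| ≤ Fintype.card (G.Setting C) * (2 * s) := by
  have hδ0 : ∀ c : G.Setting C, 0 ≤ δ := fun c => (abs_nonneg _).trans (hpq c)
  rw [fragment_eq, fragment_eq, ← Finset.sum_sub_distrib]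
  refine (Finset.abs_sum_le_sum_abs _ _).trans ?_
  refine (Finset.sum_le_card_nsmul _ _ (2 * s) fun u _ => ?_).trans ?_
  · refine abs_mul_log_sub_le (blockMass_nonneg hq u) (blockMass_nonneg hp u) ?_ hs0 hs ?_
    · rw [← hp1]
      exact Finset.sum_le_sum fun c _ => by split_ifs; exacts [le_rfl, hp c]
    · rw [blockMass, blockMass, ← Finset.sum_sub_distrib]
      refine (Finset.abs_sum_le_sum_abs _ _).trans (le_trans ?_ hδ)
      refine (Finset.sum_le_card_nsmul _ _ δ fun c _ => ?_).trans (by simp)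
      split_ifs
      · exact hpq c
      · simpa using hδ0 c
  · rw [nsmul_eq_mul]
    refine mul_le_mul_of_nonneg_right ?_ (by linarith)
    exact_mod_cast Finset.card_image_le

lemma Dist.fragment_pr {U : Finset G.Var} (hU : U ⊆ C) (μ : G.Dist) :
    fragment U (μ.pr C) = -μ.ent U := by
  have hb : ∀ u, blockMass U (μ.pr C) u = μ.pr U u := by
    intro u
    rw [pr_eq_sum_mul, sum_mul_eq_sum_pr (U := C) μ (fun w => if restrict U w = u then 1 else 0)
      fun w w' hw => by rw [restrict_mono hU hw]]
    exact Finset.sum_congr rfl fun c _ => by split_ifs <;> simp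
  rw [ent_eq, neg_neg, sum_mul_eq_sum_pr (U := C) μ
    (fun w => Real.log (μ.pr U (restrict U w))) fun w w' hw => by rw [restrict_mono hU hw]]
  exact Finset.sum_congr rfl fun c _ => by rw [hb]

end VarGraph

namespace TreeDecomp

open VarGraph

variable {G : VarGraph} (D : TreeDecomp G)

lemma card_setting_le_size (i : D.Node) : Fintype.card (G.Setting (D.cluster i)) ≤ D.size :=
  Finset.single_le_sum (f := fun i => Fintype.card (G.Setting (D.cluster i)))
    (fun _ _ => Nat.zero_le _) (Finset.mem_univ i)

lemma card_node_le_size : Fintype.card D.Node ≤ D.size := by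
  rw [Fintype.card_eq_sum_ones]
  exact Finset.sum_le_sum fun i _ => Fintype.card_pos

lemma card_arc_le_arcSize : Fintype.card G.Arc ≤ D.arcSize := by
  rw [Fintype.card_eq_sum_ones]
  exact Finset.sum_le_sum fun i _ => Fintype.card_pos

lemma one_le_size : 1 ≤ D.size := by
  obtain ⟨i⟩ := D.isTree.connected.nonempty
  exact (Nat.succ_le_iff.2 (Fintype.card_pos_iff.2 ⟨i⟩)).trans D.card_node_le_size

end TreeDecomp

namespace PDG

open VarGraph

variable {G : VarGraph} (M : PDG G) (D : TreeDecomp G)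

/-- The logarithm of the conditional probability that the arc `a` assigns to a setting of its
cluster. -/
def logCpd (a : G.Arc) (c : G.Setting (D.cluster (D.home a))) : ℝ :=
  Real.log (M.cpd a (VarGraph.restrict (G.src a) c.extend) (VarGraph.restrict (G.tgt a) c.extend))

/-- The contribution of the arc `a` to the score, computed from tables of cluster probabilities. -/
def arcVal (γ : ℝ) (q : ∀ i, G.Setting (D.cluster i) → ℝ) (a : G.Arc) : ℝ :=
  ((M.beta a).toReal - γ * M.alpha a) *
      (fragment (G.src a ∪ G.tgt a) (q (D.home a)) - fragment (G.src a) (q (D.home a)))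
    - (M.beta a).toReal * ∑ c, q (D.home a) c * M.logCpd D a c

/-- The score computed from tables of cluster probabilities. -/
def junctionVal (sep : D.Node → Finset G.Var) (γ : ℝ) (q : ∀ i, G.Setting (D.cluster i) → ℝ) : ℝ :=
  ∑ a, M.arcVal D γ q a + γ * ∑ i, (fragment (D.cluster i) (q i) - fragment (sep i) (q i))

/-- A bound for the sensitivity of the score to errors in the tables. -/
def sensitivity (γ : ℝ) : ℝ :=
  ∑ a, (2 * ((M.beta a).toReal + γ * (M.alpha a ^ 2 + 1)) + (M.beta a).toReal * ∑ c, -M.logCpd D a c)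
    + γ * (2 * Fintype.card D.Node)

variable {M}

lemma toReal_beta_nonneg (hM : M.Proper) (a : G.Arc) : 0 ≤ (M.beta a).toReal :=
  EReal.toReal_nonneg (hM a).1

lemma logCpd_nonpos (a : G.Arc) (c) : M.logCpd D a c ≤ 0 :=
  Real.log_nonpos (M.cpd_nonneg _ _ _) (M.cpd_le_one _ _ _)

lemma sensitivity_nonneg (hM : M.Proper) {γ : ℝ} (hγ : 0 ≤ γ) : 0 ≤ M.sensitivity D γ := by
  refine add_nonneg (Finset.sum_nonneg fun a _ => ?_) (by positivity)
  have := toReal_beta_nonneg hM a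
  have : 0 ≤ ∑ c, -M.logCpd D a c :=
    Finset.sum_nonneg fun c _ => neg_nonneg.2 (logCpd_nonpos D a c)
  positivity

/-- The factor γ in the hypothesis makes it trivial at `γ = 0`; the splitting of the entropy is
derived for positive γ only. -/
lemma val_eq_junctionVal {sep : D.Node → Finset G.Var} (hsep : ∀ i, sep i ⊆ D.cluster i) {γ : ℝ}
    {μ : G.Dist} (h : γ * μ.entropy = γ * ∑ i, (μ.ent (D.cluster i) - μ.ent (sep i))) :
    M.val γ μ = M.junctionVal D sep γ fun i => μ.pr (D.cluster i) := by
  have h1 : ∀ a, M.logLik a μ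
      = ∑ c, μ.pr (D.cluster (D.home a)) c * M.logCpd D a c := fun a =>
    Dist.sum_mul_eq_sum_pr (U := D.cluster (D.home a)) μ
      (fun w => Real.log (M.cpd a (VarGraph.restrict (G.src a) w) (VarGraph.restrict (G.tgt a) w)))
      fun w w' hw => by
        rw [Dist.restrict_mono (D.src_subset a) hw, Dist.restrict_mono (D.tgt_subset a) hw]
  rw [val, h, junctionVal, sub_eq_add_neg, ← mul_neg, ← Finset.sum_neg_distrib]
  congr 1
  · refine Finset.sum_congr rfl fun a _ => ?_
    rw [arcVal, ← h1, Dist.fragment_pr (Finset.union_subset (D.src_subset a) (D.tgt_subset a)),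
      Dist.fragment_pr (D.src_subset a), Dist.condEntropy_eq]
    ring
  · congr 1
    refine Finset.sum_congr rfl fun i _ => ?_
    rw [Dist.fragment_pr subset_rfl, Dist.fragment_pr (hsep i)]
    ring

lemma abs_junctionVal_sub_le (hM : M.Proper) {γ : ℝ} (hγ : 0 ≤ γ) (sep : D.Node → Finset G.Var)
    {q p : ∀ i, G.Setting (D.cluster i) → ℝ} {δ s : ℝ}
    (hq : ∀ i c, 0 ≤ q i c) (hp : ∀ i c, 0 ≤ p i c) (hp1 : ∀ i, ∑ c, p i c = 1)
    (hpq : ∀ i c, |q i c - p i c| ≤ δ) (hs0 : 0 ≤ s) (hs : s ≤ 1) (hδ0 : 0 ≤ δ)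
    (hδ : D.size * δ ≤ s ^ 2) :
    |M.junctionVal D sep γ q - M.junctionVal D sep γ p| ≤ D.size * (2 * s) * M.sensitivity D γ := by
  set E := (D.size : ℝ) * (2 * s) with hE
  have hE0 : 0 ≤ E := by positivity
  have hcard : ∀ i, (Fintype.card (G.Setting (D.cluster i)) : ℝ) ≤ D.size := fun i => by
    exact_mod_cast D.card_setting_le_size i
  have hN : (1 : ℝ) ≤ D.size := by exact_mod_cast D.one_le_size
  have hδE : δ ≤ E := by nlinarith
  have hfrag : ∀ i U, |fragment U (q i) - fragment U (p i)| ≤ E := fun i U =>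
    (abs_fragment_sub_le (hq i) (hp i) (hp1 i) (hpq i) hs0 hs
      ((mul_le_mul_of_nonneg_right (hcard i) hδ0).trans hδ)).trans
      (mul_le_mul_of_nonneg_right (hcard i) (by linarith))
  have hfrag2 : ∀ i U U', |(fragment U (q i) - fragment U' (q i))
      - (fragment U (p i) - fragment U' (p i))| ≤ 2 * E := fun i U U' => by
    rw [sub_sub_sub_comm]
    exact (abs_sub _ _).trans (by linarith [hfrag i U, hfrag i U'])
  rw [junctionVal, junctionVal, add_sub_add_comm, ← Finset.sum_sub_distrib, ← mul_sub,
    ← Finset.sum_sub_distrib, sensitivity, mul_add E, Finset.mul_sum Finset.univ _ E]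
  refine (abs_add_le _ _).trans (add_le_add ((Finset.abs_sum_le_sum_abs _ _).trans
    (Finset.sum_le_sum fun a _ => ?_)) ?_)
  · have hb := toReal_beta_nonneg hM a
    set b := (M.beta a).toReal
    have hlin : |∑ c, q (D.home a) c * M.logCpd D a c - ∑ c, p (D.home a) c * M.logCpd D a c|
        ≤ E * ∑ c, -M.logCpd D a c := by
      rw [← Finset.sum_sub_distrib, Finset.mul_sum]
      refine (Finset.abs_sum_le_sum_abs _ _).trans (Finset.sum_le_sum fun c _ => ?_)
      rw [← sub_mul, abs_mul, abs_of_nonpos (logCpd_nonpos D a c)]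
      exact mul_le_mul_of_nonneg_right ((hpq _ c).trans hδE) (neg_nonneg.2 (logCpd_nonpos D a c))
    -- `α² + 1` replaces `|α|`, so that the program computes the bound without a case distinction.
    have hcoef : |b - γ * M.alpha a| ≤ b + γ * (M.alpha a ^ 2 + 1) := by
      rw [abs_le]
      constructor <;> nlinarith [mul_nonneg hγ (sq_nonneg (M.alpha a - 1)),
        mul_nonneg hγ (sq_nonneg (M.alpha a + 1)), mul_nonneg hγ (sq_nonneg (M.alpha a))]
    have he : M.arcVal D γ q a - M.arcVal D γ p a = (b - γ * M.alpha a) *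
        ((fragment (G.src a ∪ G.tgt a) (q (D.home a)) - fragment (G.src a) (q (D.home a)))
          - (fragment (G.src a ∪ G.tgt a) (p (D.home a)) - fragment (G.src a) (p (D.home a))))
        - b * (∑ c, q (D.home a) c * M.logCpd D a c - ∑ c, p (D.home a) c * M.logCpd D a c) := by
      rw [arcVal, arcVal]; ring
    rw [he]
    refine (abs_sub _ _).trans ?_
    rw [abs_mul, abs_mul, abs_of_nonneg hb]
    have h1 := mul_le_mul hcoef (hfrag2 (D.home a) (G.src a ∪ G.tgt a) (G.src a)) (abs_nonneg _)
      (by positivity)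
    have h2 := mul_le_mul_of_nonneg_left hlin hb
    linarith
  · rw [abs_mul, abs_of_nonneg hγ]
    have : |∑ i, ((fragment (D.cluster i) (q i) - fragment (sep i) (q i))
        - (fragment (D.cluster i) (p i) - fragment (sep i) (p i)))|
        ≤ Fintype.card D.Node * (2 * E) := by
      refine (Finset.abs_sum_le_sum_abs _ _).trans ?_
      refine (Finset.sum_le_card_nsmul _ _ _ fun i _ => hfrag2 i _ _).trans ?_
      rw [nsmul_eq_mul, Finset.card_univ]
    have := mul_le_mul_of_nonneg_left this hγ
    linarith

/-- The inconsistency can be computed from sufficiently accurate cluster probabilities. -/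
lemma exists_junctionVal : ∃ sep : D.Node → Finset G.Var,
    ∀ (M : PDG G) (γ : TradeOff), M.Cvx γ → M.inc γ.toReal ≠ ⊤ →
      ∃ μ ∈ M.opt γ, ∃ r : ℝ, M.inc γ.toReal = (r : EReal) ∧
        ∀ ε, 0 < ε → ∀ s δ, s = ε / (4 * D.size * (M.sensitivity D γ.toReal + ε)) →
          δ = s ^ 2 / D.size → ∀ q : ∀ i, G.Setting (D.cluster i) → ℝ, (∀ i c, 0 ≤ q i c) →
          (∀ i c, |q i c - μ.pr (D.cluster i) c| ≤ δ) →
          |r - M.junctionVal D sep γ.toReal q| < ε := by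
  obtain ⟨sep, hsub, hsep⟩ := exists_entropy_opt D
  refine ⟨sep, fun M γ hM hinc => ?_⟩
  obtain ⟨μ, hμ, hopt, hmin⟩ := exists_opt hM hinc
  have hγ : 0 ≤ γ.toReal := by
    cases γ with
    | zeroPlus => exact le_rfl
    | real g => exact hM.2.1.le
  have hval : M.val γ.toReal μ = M.junctionVal D sep γ.toReal fun i => μ.pr (D.cluster i) := by
    refine val_eq_junctionVal D hsub ?_
    rcases hγ.eq_or_lt with h | h
    · rw [← h, zero_mul, zero_mul]
    · rw [hsep M _ h μ hμ hmin]
  refine ⟨μ, hopt ▸ rfl, _, inc_eq hM.1 hμ hmin, ?_⟩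
  rintro ε hε s δ hs rfl q hq hpq
  have hW := sensitivity_nonneg D hM.1 hγ
  set W := M.sensitivity D γ.toReal
  have hN : (1 : ℝ) ≤ D.size := by exact_mod_cast D.one_le_size
  have hs0 : 0 ≤ s := by rw [hs]; positivity
  -- Adding ε to the sensitivity keeps the denominator positive and `s ≤ 1`, while the error stays
  -- at most `ε / 2`.
  have hsN : D.size * (2 * s) * (W + ε) = ε / 2 := by rw [hs]; field_simp; norm_num
  have hs1 : s ≤ 1 := by
    rw [hs, div_le_one (by positivity)]
    nlinarith
  rw [hval, abs_sub_comm]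
  refine (abs_junctionVal_sub_le D hM.1 hγ sep hq (fun i c => μ.pr_nonneg _ c)
    (fun i => μ.sum_pr _) hpq hs0 hs1 (by positivity) ?_).trans_lt ?_
  · rw [mul_div_cancel₀ _ (by positivity)]
  · have : (0 : ℝ) ≤ D.size * (2 * s) * ε := by positivity
    linarith

end PDG
end

noncomputable section

/-! ## Calculating the inconsistency by inference -/

namespace Runs

variable {ρ κ : Type} {sb : κ → (ρ → ℝ) → Option (ℝ × ℕ)} {c : ℕ} {R : ρ → ℝ}
  {Post : (ρ → ℝ) → Prop}

lemma block_log {P : List (Prog ρ κ)} {a k : ℕ} {d x : ρ} (h0 : 0 < R x)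
    (h : Runs sb c (Prog.block P) (store R d (Real.log (R x))) a k Post) :
    Runs sb c (Prog.block (.log d x :: P)) R (a + 1) k Post := prim (log (a := 0) h0) h

/-- A loop over the elements of a list, with an invariant that depends on the elements left. -/
lemma forEach {ι : Type} {f : ι → Prog ρ κ} (a k : ι → ℕ) (I : List ι → (ρ → ℝ) → Prop)
    (h : ∀ j t R, I (j :: t) R → Runs sb c (f j) R (a j) (k j) (I t)) (l : List ι) (h0 : I l R) :
    Runs sb c (Prog.block (l.map f)) R (l.map a).sum (l.map k).sum (I []) := by
  induction l generalizing R with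
  | nil => exact nil h0
  | cons j t ih =>
    rw [List.map_cons, List.map_cons, List.map_cons, List.sum_cons, List.sum_cons]
    exact cons ((h j t R h0).mono le_rfl le_rfl fun R' h' => ih h')

lemma forAll {ι : Type} [Fintype ι] {f : ι → Prog ρ κ} (a k : ι → ℕ)
    (I : List ι → (ρ → ℝ) → Prop)
    (h : ∀ j t R, I (j :: t) R → Runs sb c (f j) R (a j) (k j) (I t))
    (h0 : I Finset.univ.toList R) (hpost : ∀ R', I [] R' → Post R') :
    Runs sb c (Prog.block (Finset.univ.toList.map f)) R (∑ j, a j) (∑ j, k j) Post := by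
  rw [← Finset.sum_map_toList, ← Finset.sum_map_toList]
  exact (forEach a k I h _ h0).mono le_rfl le_rfl hpost

end Runs

lemma store_self {ρ : Type} (R : ρ → ℝ) (d : ρ) : store R d (R d) = R := by
  classical
  funext r
  rw [store_apply]
  split_ifs with h
  · rw [h]
  · rfl

namespace TreeDecomp

variable {G : VarGraph}

/-- The working registers: the answers to the calls, block masses, and some scalars. -/
inductive WorkReg (D : TreeDecomp G) : Type
  | prob (x : Σ i : D.Node, G.Setting (D.cluster i))
  | mass (x : Σ U : Finset G.Var, G.Setting U)
  | acc
  | coef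
  | tmp
  | zero
  | one
  | delta

variable (D : TreeDecomp G)

/-- Only the distinctness of the registers matters. The result register `.inr 0` may be among them,
which is harmless because it is written last. -/
lemma exists_workReg_embedding : Nonempty (D.WorkReg ↪ ℕ) := by
  let f : D.WorkReg → (Σ i : D.Node, G.Setting (D.cluster i)) ⊕ (Σ U : Finset G.Var, G.Setting U) ⊕
      Fin 6
    | .prob x => .inl x
    | .mass x => .inr (.inl x)
    | .acc => .inr (.inr 0)
    | .coef => .inr (.inr 1)
    | .tmp => .inr (.inr 2)
    | .zero => .inr (.inr 3)
    | .one => .inr (.inr 4)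
    | .delta => .inr (.inr 5)
  have hf : Function.Injective f := by
    intro x y h
    cases x <;> cases y <;> simp_all [f]
  obtain ⟨g, hg⟩ := exists_injective_nat ((Σ i : D.Node, G.Setting (D.cluster i)) ⊕
    (Σ U : Finset G.Var, G.Setting U) ⊕ Fin 6)
  exact ⟨⟨g ∘ f, hg.comp hf⟩⟩

/-- Programs that may use inference on the PDG. -/
abbrev InferProg : Type :=
  Prog (InputName G ⊕ ℕ) ((Σ i : D.Node, G.Setting (D.cluster i)) × (InputName G ⊕ ℕ))

variable {D} (e : D.WorkReg ↪ ℕ)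

/-- Add `coef * y * log x` to the accumulator. -/
def logTermProg (x y : InputName G ⊕ ℕ) : D.InferProg :=
  .ifLt (.inr (e .zero)) x
    (.block [.log (.inr (e .tmp)) x, .mul (.inr (e .tmp)) (.inr (e .tmp)) y,
      .mul (.inr (e .tmp)) (.inr (e .tmp)) (.inr (e .coef)),
      .add (.inr (e .acc)) (.inr (e .acc)) (.inr (e .tmp))]) .skip

/-- The location of the mass of the block of `c` on `U`. -/
def massReg (U : Finset G.Var) {C : Finset G.Var} (c : G.Setting C) : InputName G ⊕ ℕ :=
  .inr (e (.mass ⟨U, VarGraph.restrict U c.extend⟩))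

/-- Add `coef` times the negated entropy of `U` to the accumulator. -/
def fragmentProg (i : D.Node) (U : Finset G.Var) : D.InferProg :=
  .block [.block (Finset.univ.toList.map fun c : G.Setting (D.cluster i) => .const (massReg e U c) 0),
    .block (Finset.univ.toList.map fun c : G.Setting (D.cluster i) =>
      .add (massReg e U c) (massReg e U c) (.inr (e (.prob ⟨i, c⟩)))),
    .block (Finset.univ.toList.map fun c : G.Setting (D.cluster i) =>
      logTermProg e (massReg e U c) (.inr (e (.prob ⟨i, c⟩))))]

/-- The register with the conditional probability that `a` assigns to a setting of its cluster. -/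
def cpdReg (a : G.Arc) (c : G.Setting (D.cluster (D.home a))) : InputName G ⊕ ℕ :=
  .inl (.cpd a (VarGraph.restrict (G.src a) c.extend) (VarGraph.restrict (G.tgt a) c.extend))

/-- Add the contribution of the arc `a` to the sensitivity. -/
def arcSensProg (a : G.Arc) : D.InferProg :=
  .block [.mul (.inr (e .tmp)) (.inl (.alpha a)) (.inl (.alpha a)),
    .add (.inr (e .tmp)) (.inr (e .tmp)) (.inr (e .one)),
    .mul (.inr (e .tmp)) (.inl .gamma) (.inr (e .tmp)),
    .add (.inr (e .tmp)) (.inl (.beta a)) (.inr (e .tmp)),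
    .add (.inr (e .acc)) (.inr (e .acc)) (.inr (e .tmp)),
    .add (.inr (e .acc)) (.inr (e .acc)) (.inr (e .tmp)),
    .sub (.inr (e .coef)) (.inr (e .zero)) (.inl (.beta a)),
    .block (Finset.univ.toList.map fun c : G.Setting (D.cluster (D.home a)) =>
      logTermProg e (cpdReg a c) (.inr (e .one)))]

/-- Ask for a cluster probability; negative answers are replaced by zero. -/
def askProg (x : Σ i : D.Node, G.Setting (D.cluster i)) : D.InferProg :=
  .block [.call (.inr (e (.prob x))) (x, .inr (e .delta)),
    .ifLt (.inr (e (.prob x))) (.inr (e .zero)) (.move (.inr (e (.prob x))) (.inr (e .zero))) .skip]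

/-- Add the contribution of the arc `a` to the score. -/
def arcValProg (a : G.Arc) : D.InferProg :=
  .block [.mul (.inr (e .tmp)) (.inl .gamma) (.inl (.alpha a)),
    .sub (.inr (e .coef)) (.inl (.beta a)) (.inr (e .tmp)),
    fragmentProg e (D.home a) (G.src a ∪ G.tgt a),
    .sub (.inr (e .coef)) (.inr (e .zero)) (.inr (e .coef)),
    fragmentProg e (D.home a) (G.src a),
    .sub (.inr (e .coef)) (.inr (e .zero)) (.inl (.beta a)),
    .block (Finset.univ.toList.map fun c : G.Setting (D.cluster (D.home a)) =>
      logTermProg e (cpdReg a c) (.inr (e (.prob ⟨D.home a, c⟩))))]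

/-- Add the contribution of the node `i` to the score. -/
def nodeValProg (sep : D.Node → Finset G.Var) (i : D.Node) : D.InferProg :=
  .block [.move (.inr (e .coef)) (.inl .gamma), fragmentProg e i (D.cluster i),
    .sub (.inr (e .coef)) (.inr (e .zero)) (.inr (e .coef)), fragmentProg e i (sep i)]

variable (D) in
/-- Compute the precision of the calls, given the sensitivity up to the contribution of the
nodes. -/
def precisionProg : List (D.InferProg) :=
  [.const (.inr (e .tmp)) (2 * Fintype.card D.Node : ℕ),
    .mul (.inr (e .tmp)) (.inl .gamma) (.inr (e .tmp)),
    .add (.inr (e .acc)) (.inr (e .acc)) (.inr (e .tmp)),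
    .add (.inr (e .acc)) (.inr (e .acc)) (.inl .eps),
    .const (.inr (e .tmp)) (4 * D.size : ℕ),
    .mul (.inr (e .acc)) (.inr (e .tmp)) (.inr (e .acc)),
    .div (.inr (e .acc)) (.inl .eps) (.inr (e .acc)),
    .mul (.inr (e .acc)) (.inr (e .acc)) (.inr (e .acc)),
    .const (.inr (e .tmp)) (D.size : ℕ),
    .div (.inr (e .delta)) (.inr (e .acc)) (.inr (e .tmp))]

/-- The reduction of inconsistency calculation to inference. -/
def incProg (sep : D.Node → Finset G.Var) : D.InferProg :=
  .block [.const (.inr (e .one)) 1,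
    .block (Finset.univ.toList.map (arcSensProg e)),
    .block (precisionProg D e),
    .block (Finset.univ.toList.map (askProg e)),
    .const (.inr (e .acc)) 0,
    .block (Finset.univ.toList.map (arcValProg e)),
    .block (Finset.univ.toList.map (nodeValProg e sep)),
    .move (.inr 0) (.inr (e .acc))]

variable {e}

lemma store_work (R : InputName G ⊕ ℕ → ℝ) (x y : D.WorkReg) (v : ℝ) [Decidable (y = x)] :
    store R (.inr (e x)) v (.inr (e y)) = if y = x then v else R (.inr (e y)) := by
  classical
  rw [store_apply]
  exact if_congr (by simp) rfl rfl

lemma store_inl (R : InputName G ⊕ ℕ → ℝ) (x : D.WorkReg) (v : ℝ) (n : InputName G) :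
    store R (.inr (e x)) v (.inl n) = R (.inl n) := store_of_ne R v (by simp)

/-- The input registers and the constants are as they should be. -/
structure Ready (e : D.WorkReg ↪ ℕ) (M : PDG G) (γ : TradeOff) (ε : ℝ) (R : InputName G ⊕ ℕ → ℝ) :
    Prop where
  input : ∀ n, R (.inl n) = inputMem M γ ε (.inl n)
  zero : R (.inr (e .zero)) = 0
  one : R (.inr (e .one)) = 1

/-- Moreover, the answers to the calls are those in the table `q`. -/
structure Loaded (e : D.WorkReg ↪ ℕ) (M : PDG G) (γ : TradeOff) (ε : ℝ)
    (q : ∀ i, G.Setting (D.cluster i) → ℝ) (R : InputName G ⊕ ℕ → ℝ) : Prop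
    extends Ready e M γ ε R where
  prob : ∀ i c, R (.inr (e (.prob ⟨i, c⟩))) = q i c

/-- The registers that may be overwritten freely. -/
def WorkReg.Scratch : D.WorkReg → Prop
  | .mass _ | .acc | .coef | .tmp => True
  | _ => False

variable {M : PDG G} {γ : TradeOff} {ε : ℝ} {q : ∀ i, G.Setting (D.cluster i) → ℝ}
  {R : InputName G ⊕ ℕ → ℝ} {sb : (Σ i : D.Node, G.Setting (D.cluster i)) × (InputName G ⊕ ℕ) →
    (InputName G ⊕ ℕ → ℝ) → Option (ℝ × ℕ)} {Post : (InputName G ⊕ ℕ → ℝ) → Prop}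

lemma Ready.store {x : D.WorkReg} {v : ℝ} (h : Ready e M γ ε R) (h0 : x ≠ .zero) (h1 : x ≠ .one) :
    Ready e M γ ε (store R (.inr (e x)) v) := by
  classical
  exact ⟨fun n => by rw [store_inl, h.input], by rw [store_work, if_neg h0.symm, h.zero],
    by rw [store_work, if_neg h1.symm, h.one]⟩

lemma Loaded.store {x : D.WorkReg} {v : ℝ} (h : Loaded e M γ ε q R) (hx : x.Scratch) :
    Loaded e M γ ε q (store R (.inr (e x)) v) := by
  classical
  refine ⟨h.toReady.store ?_ ?_, fun i c => ?_⟩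
  · rintro rfl; exact hx
  · rintro rfl; exact hx
  · rw [store_work, if_neg, h.prob]
    rintro rfl; exact hx

/-- The skipping branch agrees with `Real.log 0 = 0`. `Post` must hold for every content of the
temporary register, since the two branches leave different ones. -/
lemma runs_logTermProg {x y : InputName G ⊕ ℕ} (h0 : R (.inr (e .zero)) = 0) (hx : 0 ≤ R x)
    (hy : y ≠ .inr (e .tmp))
    (h : ∀ v, Post (store (store R (.inr (e .tmp)) v) (.inr (e .acc))
      (R (.inr (e .acc)) + R (.inr (e .coef)) * (R y * Real.log (R x))))) :
    Runs sb 1 (logTermProg e x y) R 5 0 Post := by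
  classical
  refine Runs.ifLt (a := 4) (fun hlt => ?_) fun hlt => ?_
  · rw [h0] at hlt
    refine Runs.block_log hlt (Runs.block_mul (Runs.block_mul (Runs.block_add (Runs.nil (a := 0) ?_))))
    have hss : ∀ u v, store (store R (.inr (e .tmp)) u) (.inr (e .tmp)) v
        = store R (.inr (e .tmp)) v := fun u v => by
      funext r; simp only [store_apply]; split_ifs <;> rfl
    simp only [hss, store_work, store_of_ne R _ hy, if_true, reduceCtorEq, if_false]
    convert h _ using 2
    ring
  · refine Runs.skip ?_
    rw [h0] at hlt
    have : R x = 0 := le_antisymm (not_lt.1 hlt) hx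
    have h := h (R (.inr (e .tmp)))
    rw [this, Real.log_zero, mul_zero, mul_zero, add_zero, store_self, store_self] at h
    exact h

/-- Settings in the same block share a register, so the masses arise by adding each entry in place.
Invariant of that pass: the content of a register plus the entries of its block still to come is the
mass. -/
lemma runs_fragmentProg {i : D.Node} {U : Finset G.Var} {A κ : ℝ} (hR : Loaded e M γ ε q R)
    (hq : ∀ i c, 0 ≤ q i c) (hA : R (.inr (e .acc)) = A) (hκ : R (.inr (e .coef)) = κ)
    (h : ∀ R', Loaded e M γ ε q R' → R' (.inr (e .coef)) = κ →
      R' (.inr (e .acc)) = A + κ * VarGraph.fragment U (q i) → Post R') :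
    Runs sb 1 (fragmentProg e i U) R (7 * Fintype.card (G.Setting (D.cluster i))) 0 Post := by
  classical
  set N := Fintype.card (G.Setting (D.cluster i)) with hN
  have hcost : ∀ n : ℕ, ∑ _c : G.Setting (D.cluster i), n = n * N := fun n => by
    rw [Finset.sum_const, Finset.card_univ, smul_eq_mul, mul_comm]
  have step1 : ∀ {Q : (InputName G ⊕ ℕ → ℝ) → Prop}, (∀ R', Loaded e M γ ε q R' →
      R' (.inr (e .coef)) = κ → R' (.inr (e .acc)) = A →
      (∀ c : G.Setting (D.cluster i), R' (massReg e U c) = 0) → Q R') →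
      Runs sb 1 (.block (Finset.univ.toList.map fun c : G.Setting (D.cluster i) =>
        .const (massReg e U c) 0)) R (1 * N) (0 * N) Q := by
    intro Q hQ
    rw [← hcost, ← hcost]
    refine Runs.forAll (fun _ => 1) (fun _ => 0) (fun t R => Loaded e M γ ε q R ∧
      R (.inr (e .coef)) = κ ∧ R (.inr (e .acc)) = A ∧
      ∀ c, c ∉ t → R (massReg e U c) = 0) ?_ ⟨hR, hκ, hA, by simp⟩
      (fun R' h' => hQ R' h'.1 h'.2.1 h'.2.2.1 fun c => h'.2.2.2 c (by simp))
    rintro c t R ⟨h1, h2, h3, h4⟩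
    refine Runs.const (a := 0) ⟨h1.store trivial, ?_, ?_, fun c' hc' => ?_⟩
    · rw [massReg, store_work, if_neg (by simp), h2]
    · rw [massReg, store_work, if_neg (by simp), h3]
    · rw [store_apply]
      split_ifs with hcc
      · simp
      · refine h4 c' fun hmem => ?_
        rcases List.mem_cons.1 hmem with rfl | hmem
        exacts [hcc rfl, hc' hmem]
  have step2 : ∀ {R : InputName G ⊕ ℕ → ℝ} {Q : (InputName G ⊕ ℕ → ℝ) → Prop},
      Loaded e M γ ε q R → R (.inr (e .coef)) = κ → R (.inr (e .acc)) = A →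
      (∀ c : G.Setting (D.cluster i), R (massReg e U c) = 0) → (∀ R', Loaded e M γ ε q R' →
      R' (.inr (e .coef)) = κ → R' (.inr (e .acc)) = A →
      (∀ c : G.Setting (D.cluster i), R' (massReg e U c)
        = VarGraph.blockMass U (q i) (VarGraph.restrict U c.extend)) → Q R') →
      Runs sb 1 (.block (Finset.univ.toList.map fun c : G.Setting (D.cluster i) =>
        .add (massReg e U c) (massReg e U c) (.inr (e (.prob ⟨i, c⟩))))) R (1 * N) (0 * N) Q := by
    intro R Q hR hκ hA h0 hQ
    rw [← hcost, ← hcost]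
    refine Runs.forAll (fun _ => 1) (fun _ => 0) (fun t R => Loaded e M γ ε q R ∧
      R (.inr (e .coef)) = κ ∧ R (.inr (e .acc)) = A ∧
      ∀ c : G.Setting (D.cluster i), R (massReg e U c) + (t.map fun c' : G.Setting (D.cluster i) =>
        if VarGraph.restrict U c'.extend = VarGraph.restrict U c.extend then q i c' else 0).sum
        = VarGraph.blockMass U (q i) (VarGraph.restrict U c.extend)) ?_
      ⟨hR, hκ, hA, fun c => by rw [h0, zero_add, Finset.sum_map_toList]; rfl⟩
      (fun R' h' => hQ R' h'.1 h'.2.1 h'.2.2.1 fun c => by simpa using h'.2.2.2 c)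
    rintro c t R ⟨h1, h2, h3, h4⟩
    refine Runs.add (a := 0) ⟨h1.store trivial, ?_, ?_, fun c' => ?_⟩
    · rw [massReg, store_work, if_neg (by simp), h2]
    · rw [massReg, store_work, if_neg (by simp), h3]
    · have h4 := h4 c'
      rw [List.map_cons, List.sum_cons] at h4
      rw [← h4, h1.prob]
      by_cases hcc : VarGraph.restrict U c.extend = VarGraph.restrict U c'.extend
      · have : massReg e U c = massReg e U c' := by rw [massReg, massReg, hcc]
        rw [this, store_same, if_pos hcc]
        ring
      · have : massReg e U c' ≠ massReg e U c := fun hh => hcc (by simpa [massReg] using hh.symm)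
        rw [store_of_ne _ _ this, if_neg hcc]
        ring
  have step3 : ∀ {R : InputName G ⊕ ℕ → ℝ},
      Loaded e M γ ε q R → R (.inr (e .coef)) = κ → R (.inr (e .acc)) = A →
      (∀ c : G.Setting (D.cluster i), R (massReg e U c)
        = VarGraph.blockMass U (q i) (VarGraph.restrict U c.extend)) →
      Runs sb 1 (.block (Finset.univ.toList.map fun c : G.Setting (D.cluster i) =>
        logTermProg e (massReg e U c) (.inr (e (.prob ⟨i, c⟩))))) R (5 * N) (0 * N) Post := by
    intro R hR hκ hA h0
    rw [← hcost, ← hcost]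
    refine Runs.forAll (fun _ => 5) (fun _ => 0) (fun t R => Loaded e M γ ε q R ∧
      R (.inr (e .coef)) = κ ∧ (∀ c : G.Setting (D.cluster i), R (massReg e U c)
        = VarGraph.blockMass U (q i) (VarGraph.restrict U c.extend)) ∧
      R (.inr (e .acc)) + κ * (t.map fun c : G.Setting (D.cluster i) => q i c *
        Real.log (VarGraph.blockMass U (q i) (VarGraph.restrict U c.extend))).sum
        = A + κ * VarGraph.fragment U (q i)) ?_
      ⟨hR, hκ, h0, by rw [hA, Finset.sum_map_toList]; rfl⟩
      (fun R' h' => h R' h'.1 h'.2.1 (by simpa using h'.2.2.2))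
    rintro c t R ⟨h1, h2, h3, h4⟩
    refine runs_logTermProg h1.zero (by rw [h3]; exact VarGraph.blockMass_nonneg (hq i) _) (by simp)
      fun v => ⟨(h1.store (x := .tmp) trivial).store (x := .acc) trivial, ?_, fun c' => ?_, ?_⟩
    · rw [store_work, if_neg (by simp), store_work, if_neg (by simp), h2]
    · rw [← h3 c']
      unfold massReg
      rw [store_work, if_neg (by simp), store_work, if_neg (by simp)]
    · rw [store_same, h2, h3, h1.prob, ← h4, List.map_cons, List.sum_cons]
      ring
  refine (Runs.cons (step1 fun R₁ a1 a2 a3 a4 => Runs.cons (step2 a1 a2 a3 a4 fun R₂ b1 b2 b3 b4 =>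
    Runs.cons ((step3 b1 b2 b3 b4).mono le_rfl le_rfl fun R' h' =>
      Runs.nil (a := 0) (k := 0) h')))).mono (by lia) (by lia) fun _ h => h

end TreeDecomp
end

/-! ### Correctness and cost of the program for the inconsistency. -/

noncomputable section

namespace VarGraph.Dist

variable {G : VarGraph}

/-- A call asks about the variables `∅ ∪ C`, which equals `C` only propositionally; this removes the
transport. -/
lemma pr_congr {U W : Finset G.Var} (h : U = W) (μ : G.Dist) (c : G.Setting W)
    (hU : ∀ x ∈ U, x ∈ W) : μ.pr U (fun x => c ⟨x.1, hU x.1 x.2⟩) = μ.pr W c := by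
  subst h
  rfl

end VarGraph.Dist

namespace TreeDecomp

variable {G : VarGraph} {D : TreeDecomp G} {e : D.WorkReg ↪ ℕ} {M : PDG G} {γ : TradeOff} {ε : ℝ}
  {q : ∀ i, G.Setting (D.cluster i) → ℝ} {R : InputName G ⊕ ℕ → ℝ}
  {sb : (Σ i : D.Node, G.Setting (D.cluster i)) × (InputName G ⊕ ℕ) →
    (InputName G ⊕ ℕ → ℝ) → Option (ℝ × ℕ)} {Post : (InputName G ⊕ ℕ → ℝ) → Prop}

/-- `J` is abstract because the loop is used in two contexts: with unit weights for the sensitivity,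
before any call, and with the answers as weights for the score. -/
lemma runs_logLik {a : G.Arc} {A κ : ℝ} (J : (InputName G ⊕ ℕ → ℝ) → Prop)
    (hJ : ∀ {R} {x : D.WorkReg} {v}, J R → x.Scratch → J (store R (.inr (e x)) v))
    (hReady : ∀ {R}, J R → Ready e M γ ε R) (y : G.Setting (D.cluster (D.home a)) → D.WorkReg)
    (z : G.Setting (D.cluster (D.home a)) → ℝ) (hyz : ∀ {R}, J R → ∀ c, R (.inr (e (y c))) = z c)
    (hy : ∀ c, y c ≠ .tmp) (hR : J R) (hA : R (.inr (e .acc)) = A) (hκ : R (.inr (e .coef)) = κ)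
    (h : ∀ R', J R' → R' (.inr (e .acc)) = A + κ * ∑ c, z c * M.logCpd D a c → Post R') :
    Runs sb 1 (.block (Finset.univ.toList.map fun c : G.Setting (D.cluster (D.home a)) =>
      logTermProg e (cpdReg a c) (.inr (e (y c))))) R
      (5 * Fintype.card (G.Setting (D.cluster (D.home a)))) 0 Post := by
  classical
  have := Runs.forAll (sb := sb) (c := 1) (R := R) (Post := Post)
    (f := fun c : G.Setting (D.cluster (D.home a)) => logTermProg e (cpdReg a c) (.inr (e (y c))))
    (fun _ => 5) (fun _ => 0) (fun t R => J R ∧ R (.inr (e .coef)) = κ ∧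
      R (.inr (e .acc)) + κ * (t.map fun c => z c * M.logCpd D a c).sum
        = A + κ * ∑ c, z c * M.logCpd D a c) ?_ ⟨hR, hκ, by rw [hA, Finset.sum_map_toList]⟩
      (fun R' h' => h R' h'.1 (by simpa using h'.2.2))
  · simpa [mul_comm] using this
  rintro c t R ⟨h1, h2, h3⟩
  have hc : R (cpdReg a c) = M.cpd a _ _ := (hReady h1).input _
  refine runs_logTermProg (hReady h1).zero (hc ▸ M.cpd_nonneg _ _ _) (by simpa using hy c)
    fun v => ⟨hJ (x := .acc) (hJ (x := .tmp) h1 trivial) trivial, ?_, ?_⟩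
  · rw [store_work, if_neg (by simp), store_work, if_neg (by simp), h2]
  · rw [store_same, h2, hyz h1, hc, ← h3, List.map_cons, List.sum_cons]
    change _ + κ * (z c * M.logCpd D a c) + _ = _
    ring

lemma runs_arcSensProg {a : G.Arc} {A : ℝ} (hR : Ready e M γ ε R) (hA : R (.inr (e .acc)) = A)
    (h : ∀ R', Ready e M γ ε R' → R' (.inr (e .acc)) = A +
      (2 * ((M.beta a).toReal + γ.toReal * (M.alpha a ^ 2 + 1))
        + (M.beta a).toReal * ∑ c, -M.logCpd D a c) → Post R') :
    Runs sb 1 (arcSensProg e a) R (5 * Fintype.card (G.Setting (D.cluster (D.home a))) + 7) 0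
      Post := by
  classical
  have h1 : R (.inl (.alpha a)) = M.alpha a := hR.input _
  have h2 : R (.inl (.beta a)) = (M.beta a).toReal := hR.input _
  have h3 : R (.inl .gamma) = γ.toReal := hR.input _
  refine Runs.block_mul <| Runs.block_add <| Runs.block_mul <| Runs.block_add <| Runs.block_add <|
    Runs.block_add <| Runs.block_sub <| ?_
  refine (Runs.cons (a := 0) (k := 0) (Runs.mono (runs_logLik (M := M) (γ := γ) (ε := ε)
    (Ready e M γ ε) (fun {R x v} hR hx => hR.store ?_ ?_) (fun hR => hR) (fun _ => .one) (fun _ => 1)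
    (fun hR _ => hR.one) (by simp) ?_ rfl rfl fun R' h' hacc => h R' h' ?_) le_rfl le_rfl
      fun R' h' => Runs.nil h')).mono le_rfl le_rfl fun _ h => h
  · rintro rfl; exact hx
  · rintro rfl; exact hx
  · repeat' first | exact hR | refine Ready.store ?_ (by simp) (by simp)
  · rw [hacc]
    simp only [store_work, store_inl, reduceCtorEq, if_true, if_false, h1, h2, h3, hR.one, hR.zero,
      hA, one_mul, Finset.sum_neg_distrib]
    ring

/-- Replacing a negative answer by zero does not take it farther from a probability, and the
estimates for tables need nonnegative entries. -/
lemma runs_askProg {O : InferSolver} {x : Σ i : D.Node, G.Setting (D.cluster i)} {μ : G.Dist}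
    (hO : O.Correct) (hM : M.Cvx γ) (hinc : M.inc γ.toReal ≠ ⊤) (hμ : μ ∈ M.opt γ)
    (h0 : R (.inr (e .zero)) = 0) (hδ : 0 < R (.inr (e .delta)))
    (h : ∀ v, 0 ≤ v → |v - μ.pr (D.cluster x.1) x.2| ≤ R (.inr (e .delta)) →
      Post (store R (.inr (e (.prob x))) v)) :
    Runs (inferCall O D M γ) 1 (askProg e x) R 2 1 Post := by
  classical
  have hp := hO G M γ hM hinc ∅ (D.cluster x.1) (fun y => x.2 ⟨y.1, by simpa using y.2⟩) _ hδ μ hμ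
    (by rw [VarGraph.Dist.pr_empty]; exact one_pos)
  rw [VarGraph.Dist.condPr, VarGraph.Dist.pr_empty, div_one,
    VarGraph.Dist.pr_congr (Finset.empty_union _) μ x.2 (by simp)] at hp
  have hcall : inferCall O D M γ (x, .inr (e .delta)) R = some (_, 1) := if_pos hδ
  refine Runs.block_call hcall le_rfl ?_
  set v := O G M γ ∅ (D.cluster x.1) (fun y => x.2 ⟨y.1, by simpa using y.2⟩) (R (.inr (e .delta)))
  refine (Runs.cons (a := 0) (k := 0) (Runs.ifLt (a := 1) (k := 0) (fun hlt => ?_) fun hlt => ?_)).mono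
    le_rfl le_rfl fun _ h => h
  · rw [store_same, store_work, if_neg (by simp), h0] at hlt
    refine Runs.move (a := 0) (Runs.nil ?_)
    have : store (store R (.inr (e (.prob x))) v) (.inr (e (.prob x)))
        (store R (.inr (e (.prob x))) v (.inr (e .zero))) = store R (.inr (e (.prob x))) 0 := by
      rw [store_work, if_neg (by simp), h0]
      funext r
      simp only [store_apply]
      split_ifs <;> rfl
    rw [this]
    refine h 0 le_rfl ?_
    have := μ.pr_nonneg (D.cluster x.1) x.2
    rw [abs_le] at hp ⊢
    constructor <;> linarith
  · rw [store_same, store_work, if_neg (by simp), h0] at hlt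
    exact Runs.skip (Runs.nil (h v (not_lt.1 hlt) hp))

lemma runs_arcValProg {a : G.Arc} {A : ℝ} (hR : Loaded e M γ ε q R) (hq : ∀ i c, 0 ≤ q i c)
    (hA : R (.inr (e .acc)) = A)
    (h : ∀ R', Loaded e M γ ε q R' → R' (.inr (e .acc)) = A + M.arcVal D γ.toReal q a → Post R') :
    Runs sb 1 (arcValProg e a) R (19 * Fintype.card (G.Setting (D.cluster (D.home a))) + 4) 0
      Post := by
  classical
  have h1 : R (.inl (.alpha a)) = M.alpha a := hR.input _
  have h2 : R (.inl (.beta a)) = (M.beta a).toReal := hR.input _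
  have h3 : R (.inl .gamma) = γ.toReal := hR.input _
  set N := Fintype.card (G.Setting (D.cluster (D.home a)))
  refine Runs.mono (Runs.block_mul <| Runs.block_sub <| Runs.cons <|
    runs_fragmentProg ((hR.store (x := .tmp) trivial).store (x := .coef) trivial) hq
    (A := A) (κ := (M.beta a).toReal - γ.toReal * M.alpha a)
    (by simp [store_work, hA]) (by simp [store_work, store_inl, h1, h2, h3])
    fun R₁ a1 a2 a3 => Runs.block_sub <| Runs.cons <|
    runs_fragmentProg (a1.store (x := .coef) trivial) hq
    (A := R₁ (.inr (e .acc))) (κ := -((M.beta a).toReal - γ.toReal * M.alpha a))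
    (by simp [store_work]) (by rw [store_same, a1.zero, a2, zero_sub])
    fun R₂ b1 b2 b3 => Runs.block_sub <| Runs.cons (a := 0) (k := 0) <|
    runs_logLik (M := M) (γ := γ) (ε := ε) (Loaded e M γ ε q) (fun hR hx => hR.store hx)
    (fun hR => hR.toReady) (fun c => .prob ⟨D.home a, c⟩) (q (D.home a))
    (fun hR c => hR.prob _ c) (by simp) (b1.store (x := .coef) trivial)
    (A := R₂ (.inr (e .acc))) (κ := -(M.beta a).toReal)
    (by simp [store_work]) (by
      rw [store_same, b1.zero, zero_sub]
      exact congrArg Neg.neg (b1.input _))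
    fun R' h' hacc => Runs.nil (h R' h' ?_)) (by lia) (by lia) fun _ h => h
  rw [hacc, b3, a3, PDG.arcVal]
  ring

lemma runs_nodeValProg {sep : D.Node → Finset G.Var} {i : D.Node} {A : ℝ}
    (hR : Loaded e M γ ε q R) (hq : ∀ i c, 0 ≤ q i c) (hA : R (.inr (e .acc)) = A)
    (h : ∀ R', Loaded e M γ ε q R' → R' (.inr (e .acc)) = A + γ.toReal *
      (VarGraph.fragment (D.cluster i) (q i) - VarGraph.fragment (sep i) (q i)) → Post R') :
    Runs sb 1 (nodeValProg e sep i) R (14 * Fintype.card (G.Setting (D.cluster i)) + 2) 0 Post := by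
  classical
  have h3 : R (.inl .gamma) = γ.toReal := hR.input _
  refine Runs.mono (Runs.block_move <| Runs.cons <|
    runs_fragmentProg (hR.store (x := .coef) trivial) hq (A := A) (κ := γ.toReal)
    (by simp [store_work, hA]) (by rw [store_same, h3])
    fun R₁ a1 a2 a3 => Runs.block_sub <| Runs.cons (a := 0) (k := 0) <|
    runs_fragmentProg (a1.store (x := .coef) trivial) hq
    (A := R₁ (.inr (e .acc))) (κ := -γ.toReal)
    (by simp [store_work]) (by rw [store_same, a1.zero, a2, zero_sub])
    fun R' h' _ hacc => Runs.nil (h R' h' ?_)) (by lia) (by lia) fun _ h => h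
  rw [hacc, a3]
  ring

lemma runs_arcSens (hR : Ready e M γ ε R) (hA : R (.inr (e .acc)) = 0)
    (h : ∀ R', Ready e M γ ε R' → R' (.inr (e .acc)) + γ.toReal * (2 * Fintype.card D.Node)
      = M.sensitivity D γ.toReal → Post R') :
    Runs sb 1 (.block (Finset.univ.toList.map (arcSensProg e))) R (12 * D.arcSize) 0 Post := by
  classical
  set S : G.Arc → ℝ := fun a => 2 * ((M.beta a).toReal + γ.toReal * (M.alpha a ^ 2 + 1))
    + (M.beta a).toReal * ∑ c, -M.logCpd D a c with hS
  refine (Runs.forAll (fun a => 5 * Fintype.card (G.Setting (D.cluster (D.home a))) + 7) (fun _ => 0)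
    (fun t R => Ready e M γ ε R ∧ R (.inr (e .acc)) + (t.map S).sum = ∑ a, S a) ?_
    ⟨hR, by rw [hA, zero_add, Finset.sum_map_toList]⟩ fun R' h' => h R' h'.1 ?_).mono ?_ (by simp)
      fun _ h => h
  · rintro a t R ⟨h1, h2⟩
    refine runs_arcSensProg h1 rfl fun R' h' hacc => ⟨h', ?_⟩
    rw [hacc, ← h2, List.map_cons, List.sum_cons, add_assoc]
  · rw [PDG.sensitivity, ← hS, ← h'.2]
    simp
  · have := D.card_arc_le_arcSize
    rw [Finset.sum_add_distrib, ← Finset.mul_sum, Finset.sum_const, Finset.card_univ, smul_eq_mul]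
    change 5 * D.arcSize + _ ≤ _
    lia

lemma runs_ask {O : InferSolver} {μ : G.Dist} {δ : ℝ}
    (hO : O.Correct) (hM : M.Cvx γ) (hinc : M.inc γ.toReal ≠ ⊤) (hμ : μ ∈ M.opt γ) (hδ : 0 < δ)
    (hR : Ready e M γ ε R) (hRδ : R (.inr (e .delta)) = δ)
    (h : ∀ R' (q : ∀ i, G.Setting (D.cluster i) → ℝ), Loaded e M γ ε q R' → (∀ i c, 0 ≤ q i c) →
      (∀ i c, |q i c - μ.pr (D.cluster i) c| ≤ δ) → Post R') :
    Runs (inferCall O D M γ) 1 (.block (Finset.univ.toList.map (askProg e))) R (2 * D.size) D.size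
      Post := by
  classical
  refine (Runs.forAll (fun _ => 2) (fun _ => 1)
    (fun t R => Ready e M γ ε R ∧ R (.inr (e .delta)) = δ ∧ ∀ x, x ∉ t →
      0 ≤ R (.inr (e (.prob x))) ∧ |R (.inr (e (.prob x))) - μ.pr (D.cluster x.1) x.2| ≤ δ) ?_
    ⟨hR, hRδ, by simp⟩ fun R' h' => h R' (fun i c => R' (.inr (e (.prob ⟨i, c⟩))))
      ⟨h'.1, fun _ _ => rfl⟩ (fun i c => (h'.2.2 ⟨i, c⟩ (by simp)).1)
      fun i c => (h'.2.2 ⟨i, c⟩ (by simp)).2).mono ?_ ?_ fun _ h => h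
  · rintro x t R ⟨h1, h2, h3⟩
    refine runs_askProg hO hM hinc hμ h1.zero (h2 ▸ hδ) fun v hv hvp =>
      ⟨h1.store (by simp) (by simp), by rw [store_work, if_neg (by simp), h2], fun y hy => ?_⟩
    by_cases hyx : y = x
    · subst hyx
      rw [store_same]
      exact ⟨hv, h2 ▸ hvp⟩
    · rw [store_work, if_neg (by simpa using hyx)]
      exact h3 y (by simp [hyx, hy])
  · simp [TreeDecomp.size, mul_comm]
  · simp [TreeDecomp.size]

lemma runs_arcVal {A : ℝ} (hR : Loaded e M γ ε q R) (hq : ∀ i c, 0 ≤ q i c)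
    (hA : R (.inr (e .acc)) = A)
    (h : ∀ R', Loaded e M γ ε q R' →
      R' (.inr (e .acc)) = A + ∑ a, M.arcVal D γ.toReal q a → Post R') :
    Runs sb 1 (.block (Finset.univ.toList.map (arcValProg e))) R (23 * D.arcSize) 0 Post := by
  refine (Runs.forAll (fun a => 19 * Fintype.card (G.Setting (D.cluster (D.home a))) + 4)
    (fun _ => 0) (fun t R => Loaded e M γ ε q R ∧
      R (.inr (e .acc)) + (t.map (M.arcVal D γ.toReal q)).sum = A + ∑ a, M.arcVal D γ.toReal q a) ?_
    ⟨hR, by rw [hA, Finset.sum_map_toList]⟩ fun R' h' => h R' h'.1 (by simpa using h'.2)).mono ?_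
      (by simp) fun _ h => h
  · rintro a t R ⟨h1, h2⟩
    refine runs_arcValProg h1 hq rfl fun R' h' hacc => ⟨h', ?_⟩
    rw [hacc, ← h2, List.map_cons, List.sum_cons, add_assoc]
  · have := D.card_arc_le_arcSize
    rw [Finset.sum_add_distrib, ← Finset.mul_sum, Finset.sum_const, Finset.card_univ, smul_eq_mul]
    change 19 * D.arcSize + _ ≤ _
    lia

lemma runs_nodeVal {sep : D.Node → Finset G.Var} {A : ℝ} (hR : Loaded e M γ ε q R)
    (hq : ∀ i c, 0 ≤ q i c) (hA : R (.inr (e .acc)) = A)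
    (h : ∀ R', R' (.inr (e .acc)) = A + γ.toReal * ∑ i,
      (VarGraph.fragment (D.cluster i) (q i) - VarGraph.fragment (sep i) (q i)) → Post R') :
    Runs sb 1 (.block (Finset.univ.toList.map (nodeValProg e sep))) R (16 * D.size) 0 Post := by
  set S : D.Node → ℝ := fun i =>
    VarGraph.fragment (D.cluster i) (q i) - VarGraph.fragment (sep i) (q i)
  refine (Runs.forAll (fun i => 14 * Fintype.card (G.Setting (D.cluster i)) + 2)
    (fun _ => 0) (fun t R => Loaded e M γ ε q R ∧
      R (.inr (e .acc)) + γ.toReal * (t.map S).sum = A + γ.toReal * ∑ i, S i) ?_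
    ⟨hR, by rw [hA, Finset.sum_map_toList]⟩ fun R' h' => h R' (by simpa using h'.2)).mono ?_
      (by simp) fun _ h => h
  · rintro i t R ⟨h1, h2⟩
    refine runs_nodeValProg h1 hq rfl fun R' h' hacc => ⟨h', ?_⟩
    rw [hacc, ← h2, List.map_cons, List.sum_cons]
    ring
  · have := D.card_node_le_size
    rw [Finset.sum_add_distrib, ← Finset.mul_sum, Finset.sum_const, Finset.card_univ, smul_eq_mul]
    change 14 * D.size + _ ≤ _
    lia

lemma runs_precisionProg {W : ℝ} (hR : Ready e M γ ε R) (hW : 0 ≤ W) (hε : 0 < ε)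
    (hA : R (.inr (e .acc)) + γ.toReal * (2 * Fintype.card D.Node) = W)
    (h : ∀ R', Ready e M γ ε R' →
      R' (.inr (e .delta)) = (ε / (4 * D.size * (W + ε))) ^ 2 / D.size → Post R') :
    Runs sb 1 (.block (precisionProg D e)) R 10 0 Post := by
  classical
  have h1 : R (.inl .eps) = ε := hR.input _
  have h3 : R (.inl .gamma) = γ.toReal := hR.input _
  have hN : (0 : ℝ) < D.size := by exact_mod_cast D.one_le_size
  refine Runs.block_const <| Runs.block_mul ?_
  simp only [store_same, store_inl, h3]
  refine Runs.block_add ?_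
  simp only [store_same, store_work, reduceCtorEq, if_false]
  refine Runs.block_add ?_
  simp only [store_same, store_inl, h1]
  rw [show R (.inr (e .acc)) + γ.toReal * (((2 * Fintype.card D.Node : ℕ) : ℚ) : ℝ) = W by
    rw [← hA]; push_cast; ring]
  refine Runs.block_const <| Runs.block_mul ?_
  simp only [store_same, store_work, reduceCtorEq, if_false]
  have h4 : (((4 * D.size : ℕ) : ℚ) : ℝ) * (W + ε) = 4 * D.size * (W + ε) := by push_cast; ring
  rw [h4]
  refine Runs.block_div ?_ ?_
  · rw [store_same]
    positivity
  simp only [store_same, store_inl, h1]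
  refine Runs.block_mul ?_
  simp only [store_same]
  refine Runs.block_const <| Runs.block_div ?_ <| Runs.nil (a := 0) (h _ ?_ ?_)
  · rw [store_same]
    exact_mod_cast hN.ne'
  · repeat' first | exact hR | refine Ready.store ?_ (by simp) (by simp)
  · simp only [store_same, store_work, reduceCtorEq, if_false]
    push_cast
    ring

/-- Inconsistency calculation reduces to inference, with a number of calls linear in the size of
the tree decomposition. -/
lemma exists_calcsInc (D : TreeDecomp G) :
    ∃ P, CalcsInc D P ((100 : ℝ) * D.size) ((100 : ℝ) * (D.size + D.arcSize)) := by
  classical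
  obtain ⟨e⟩ := D.exists_workReg_embedding
  obtain ⟨sep, hsep⟩ := PDG.exists_junctionVal D
  -- Neither `e` nor `sep` depends on the numbers of the instance.
  refine ⟨incProg e sep, fun M γ hM hinc ε hε O hO => ?_⟩
  obtain ⟨μ, hμ, r, hr, herr⟩ := hsep M γ hM hinc
  have hN : (0 : ℝ) < D.size := by exact_mod_cast D.one_le_size
  have hγ : 0 ≤ γ.toReal := by
    cases γ with
    | zeroPlus => exact le_rfl
    | real g => exact hM.2.1.le
  have hW := PDG.sensitivity_nonneg D hM.1 hγ
  set W := M.sensitivity D γ.toReal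
  set s := ε / (4 * D.size * (W + ε)) with hs
  have hs0 : 0 < s := by positivity
  have hN1 := D.one_le_size
  have hrun : Runs (inferCall O D M γ) 1 (incProg e sep) (inputMem M γ ε)
      (60 * (D.size + D.arcSize)) D.size fun R' => |r - R' (.inr 0)| < ε := by
    have hR : Ready e M γ ε (store (inputMem M γ ε) (.inr (e .one)) (1 : ℚ)) :=
      ⟨fun n => store_inl _ _ _ _, by rw [store_work, if_neg (by simp)]; rfl,
        by rw [store_same]; norm_num⟩
    refine Runs.mono (Runs.block_const <| Runs.cons <| runs_arcSens hR
      (by rw [store_work, if_neg (by simp)]; rfl) fun R₁ a1 a2 => Runs.cons <|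
      runs_precisionProg a1 hW hε a2 fun R₂ b1 b2 => Runs.cons <|
      runs_ask hO hM hinc hμ (by positivity) b1 b2 fun R₃ q c1 c2 c3 => Runs.block_const <|
      Runs.cons <| runs_arcVal (A := 0) (c1.store (x := .acc) trivial) c2
        (by rw [store_same]; norm_num) fun R₄ d1 d2 => Runs.cons <|
      runs_nodeVal d1 c2 d2 fun R₅ f1 => Runs.block_move <| Runs.nil (a := 0) (k := 0) ?_)
      (by lia) (by lia) fun _ h => h
    rw [store_same, f1, zero_add]
    exact herr ε hε _ _ hs rfl q c2 c3
  obtain ⟨R', t, k, hex, ht, hk, hpost⟩ := hrun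
  refine ⟨R', t, k, hex, ⟨r, hr, hpost⟩, ?_, ?_⟩
  · have : (k : ℝ) ≤ D.size := by exact_mod_cast hk
    linarith
  · have : (t : ℝ) ≤ 60 * (D.size + D.arcSize) + D.size * 1 := by exact_mod_cast ht
    have : (0 : ℝ) ≤ D.arcSize := Nat.cast_nonneg _
    linarith

end TreeDecomp
end

noncomputable section

/-! ## Small tree decompositions -/

section RunningIntersection

variable {ι V : Type} [DecidableEq V] {cl : ι → Finset V}

/-- Clusters can be dropped until there are few of them. -/
lemma RunInt.exists_reduce (l : List ι) (h : RunInt cl l) :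
    ∃ L : List ι, L.Nodup ∧ RunInt cl L ∧ (∀ i ∈ L, i ∈ l) ∧ (∀ i ∈ l, ∃ j ∈ L, cl i ⊆ cl j) ∧
      L.length ≤ 1 + (covered cl l).card := by
  classical
  induction l with
  | nil => exact ⟨[], List.nodup_nil, trivial, by simp, by simp, by simp⟩
  | cons i l ih =>
    obtain ⟨L, hnd, hrun, hsub, hcov, hlen⟩ := ih h.1
    by_cases hl : l = []
    · subst hl
      exact ⟨[i], by simp, ⟨trivial, by simp⟩, by simp, by simp, by simp⟩
    obtain ⟨p, hp, hint⟩ := h.2 hl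
    obtain ⟨b, hb, hpb⟩ := hcov p hp
    have hmono : covered cl l ⊆ covered cl (i :: l) := Finset.subset_union_right
    by_cases hib : cl i ⊆ cl b
    · refine ⟨L, hnd, hrun, fun j hj => List.mem_cons_of_mem _ (hsub j hj), fun j hj => ?_,
        hlen.trans (Nat.add_le_add_left (Finset.card_le_card hmono) 1)⟩
      rcases List.mem_cons.1 hj with rfl | hj
      exacts [⟨b, hb, hib⟩, hcov j hj]
    · have hinter : ∀ j ∈ l, cl i ∩ cl j ⊆ cl b := fun j hj => (hint j hj).trans hpb
      refine ⟨i :: L, List.nodup_cons.2 ⟨fun hi => hib ?_, hnd⟩,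
        ⟨hrun, fun _ => ⟨b, hb, fun j hj => hinter j (hsub j hj)⟩⟩, fun j hj => ?_, fun j hj => ?_, ?_⟩
      · simpa using hinter i (hsub i hi)
      · rcases List.mem_cons.1 hj with rfl | hj
        exacts [by simp, List.mem_cons_of_mem _ (hsub j hj)]
      · rcases List.mem_cons.1 hj with rfl | hj
        · exact ⟨j, by simp, subset_rfl⟩
        · obtain ⟨k, hk, hjk⟩ := hcov j hj
          exact ⟨k, List.mem_cons_of_mem _ hk, hjk⟩
      -- Whatever `cl i` shares with the clusters of `l` lies in `cl b`, so its variable outside `cl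
      -- b` is new and pays for keeping `i`.
      · obtain ⟨x, hx, hxb⟩ := Finset.not_subset.1 hib
        have hss : covered cl l ⊂ covered cl (i :: l) := by
          refine ⟨hmono, fun hle => hxb ?_⟩
          obtain ⟨j, hj, hxj⟩ := mem_covered.1 (hle (Finset.mem_union_left _ hx))
          exact hinter j hj (Finset.mem_inter.2 ⟨hx, hxj⟩)
        have := Finset.card_lt_card hss
        rw [List.length_cons]
        lia

/-- A list of clusters with the running intersection property is carried by a tree. -/
lemma RunInt.exists_forest (L : List ι) (hnd : L.Nodup) (h : RunInt cl L) :
    ∃ H : SimpleGraph ι, H.IsAcyclic ∧ (∀ i j, H.Adj i j → i ∈ L) ∧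
      ∀ i ∈ L, ∀ j ∈ L, ∃ q : H.Walk i j, ∀ k ∈ q.support, k ∈ L ∧ cl i ∩ cl j ⊆ cl k := by
  classical
  induction L with
  | nil => exact ⟨⊥, SimpleGraph.isAcyclic_bot, by simp, by simp⟩
  | cons i L ih =>
    obtain ⟨hi, hnd⟩ := List.nodup_cons.1 hnd
    obtain ⟨H, hac, hadj, hwalk⟩ := ih hnd h.1
    by_cases hL : L = []
    · subst hL
      refine ⟨H, hac, fun a b hab => absurd (hadj a b hab) (by simp), fun a ha b hb => ?_⟩
      rw [List.mem_singleton] at ha hb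
      subst ha hb
      exact ⟨.nil, by simp⟩
    obtain ⟨p, hp, hint⟩ := h.2 hL
    have hip : i ≠ p := fun h => hi (h ▸ hp)
    -- Edges of `H` stay inside `L`, so `i` is isolated in `H`, and joining it to `p` creates no
    -- cycle.
    have hreach : ¬ H.Reachable i p := by
      rintro ⟨w⟩
      cases w with
      | nil => exact hip rfl
      | cons hadj' _ => exact hi (hadj _ _ hadj')
    set H' := H ⊔ SimpleGraph.edge i p with hH'
    have hle : H ≤ H' := le_sup_left
    have hnew : H'.Adj i p := Or.inr (by simp [SimpleGraph.edge_adj, hip])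
    have hleaf : ∀ j ∈ L, ∃ q : H'.Walk i j, ∀ k ∈ q.support, k ∈ i :: L ∧ cl i ∩ cl j ⊆ cl k := by
      intro j hj
      obtain ⟨q, hq⟩ := hwalk p hp j hj
      refine ⟨.cons hnew (q.mapLe hle), fun k hk => ?_⟩
      rw [SimpleGraph.Walk.support_cons, List.mem_cons, SimpleGraph.Walk.support_mapLe_eq_support] at hk
      rcases hk with rfl | hk
      · exact ⟨by simp, Finset.inter_subset_left⟩
      · obtain ⟨h1, h2⟩ := hq k hk
        exact ⟨List.mem_cons_of_mem _ h1, fun x hx =>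
          h2 (Finset.mem_inter.2 ⟨hint j hj hx, Finset.mem_of_mem_inter_right hx⟩)⟩
    refine ⟨H', hac.sup_edge_of_not_reachable hreach, fun a b hab => ?_, fun a ha b hb => ?_⟩
    · rcases hab with hab | hab
      · exact List.mem_cons_of_mem _ (hadj a b hab)
      · rw [SimpleGraph.edge_adj] at hab
        rcases hab.1 with ⟨rfl, -⟩ | ⟨rfl, -⟩
        exacts [by simp, List.mem_cons_of_mem _ hp]
    · rcases List.mem_cons.1 ha with rfl | ha' <;> rcases List.mem_cons.1 hb with rfl | hb'
      · exact ⟨.nil, by simp⟩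
      · exact hleaf b hb'
      · obtain ⟨q, hq⟩ := hleaf a ha'
        refine ⟨q.reverse, fun k hk => ?_⟩
        rw [Finset.inter_comm]
        exact hq k (by simpa using hk)
      · obtain ⟨q, hq⟩ := hwalk a ha' b hb'
        refine ⟨q.mapLe hle, fun k hk => ?_⟩
        rw [SimpleGraph.Walk.support_mapLe_eq_support] at hk
        exact ⟨List.mem_cons_of_mem _ (hq k hk).1, (hq k hk).2⟩

end RunningIntersection

namespace TreeDecomp

variable {G : VarGraph}

/-- A tree decomposition can be replaced by one of the same width with few nodes. -/
lemma exists_small (D : TreeDecomp G) {T : ℕ} (hD : D.WidthLE T) :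
    ∃ D' : TreeDecomp G, D'.WidthLE T ∧ Fintype.card D'.Node ≤ 1 + Fintype.card G.Var := by
  classical
  obtain ⟨l, -, hall, hrun⟩ := D.exists_runInt
  obtain ⟨L, hnd, hrunL, -, hcov, hlen⟩ := hrun.exists_reduce
  obtain ⟨H, hac, -, hwalk⟩ := hrunL.exists_forest L hnd
  -- `up i` is a kept node whose cluster contains that of `i`; it takes over the variables and arcs
  -- of `i`.
  choose up hupL hup using fun i => hcov i (hall i)
  obtain ⟨i₀⟩ := D.isTree.connected.nonempty
  have hconn : (H.induce {i | i ∈ L}).Connected := by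
    refine (SimpleGraph.connected_iff _).2 ⟨fun a b => ?_, ⟨⟨up i₀, hupL i₀⟩⟩⟩
    obtain ⟨q, hq⟩ := hwalk a a.2 b b.2
    exact ⟨q.induce _ fun k hk => (hq k hk).1⟩
  refine ⟨{
    Node := {i // i ∈ L}
    tree := H.induce {i | i ∈ L}
    isTree := ⟨hconn, hac.induce _⟩
    cluster := fun i => D.cluster i.1
    var_mem := fun x => ?_
    home := fun a => ⟨up (D.home a), hupL _⟩
    src_subset := fun a => (D.src_subset a).trans (hup _)
    tgt_subset := fun a => (D.tgt_subset a).trans (hup _)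
    path_subset := fun i j p hp k hk => ?_ }, fun i => hD i.1, ?_⟩
  · obtain ⟨i, hi⟩ := D.var_mem x
    exact ⟨⟨up i, hupL i⟩, hup i hi⟩
  · obtain ⟨q, hq⟩ := hwalk i i.2 j j.2
    let f := (SimpleGraph.Embedding.induce (G := H) {i | i ∈ L}).toHom
    have hpath : (p.map f).IsPath := hp.map Subtype.val_injective
    -- Paths in a forest are unique, so the given path is the walk from `RunInt.exists_forest`, cut
    -- down to a path.
    have he : (p.map f).support = q.bypass.support := congrArg (fun w => w.1.support)
      ((hac.subsingleton_path _ _).elim ⟨p.map f, hpath⟩ ⟨q.bypass, q.bypass_isPath⟩)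
    have hk' : f k ∈ (p.map f).support := by
      rw [SimpleGraph.Walk.support_map]
      exact List.mem_map_of_mem hk
    exact (hq k (q.support_bypass_subset_support (he ▸ hk'))).2
  · have h1 : Fintype.card {i // i ∈ L} = L.length := by
      rw [Fintype.card_of_subtype L.toFinset (by simp), List.toFinset_card_of_nodup hnd]
    have h2 := Finset.card_le_univ (covered D.cluster l)
    exact h1.le.trans (hlen.trans (Nat.add_le_add_left h2 1))

lemma card_setting_le {V : ℕ} [Nonempty G.Var] (hV : ∀ x, Fintype.card (G.Val x) ≤ V) {T : ℕ}
    {U : Finset G.Var} (hU : U.card ≤ T) : Fintype.card (G.Setting U) ≤ V ^ T := by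
  obtain ⟨x⟩ := ‹Nonempty G.Var›
  -- A variable has at least one value, so `V ≥ 1` and powers of `V` grow with the exponent; this is
  -- where a nonempty set of variables is needed.
  have hV1 : 1 ≤ V := Fintype.card_pos.trans_le (hV x)
  rw [Fintype.card_pi]
  refine (Finset.prod_le_pow_card _ _ V fun x _ => hV x.1).trans ?_
  rw [Finset.card_univ, Fintype.card_coe]
  exact Nat.pow_le_pow_right hV1 hU

/-- For bounded width and bounded numbers of values, the reduction is linear in the size of the
hypergraph. -/
lemma exists_linear_calcsInc (T V : ℕ) : ∃ C : ℝ, ∀ (G : VarGraph), Nonempty G.Var →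
    (∀ x, Fintype.card (G.Val x) ≤ V) → (∃ D : TreeDecomp G, D.WidthLE T) →
    ∃ (D : TreeDecomp G) (P : _), D.WidthLE T ∧ CalcsInc D P (C * Fintype.card G.Var)
      (C * (Fintype.card G.Var + Fintype.card G.Arc)) := by
  -- `1 + |X| ≤ 2 |X|` for nonempty `X` doubles the constant 100.
  refine ⟨200 * (V : ℝ) ^ (T + 1), fun G hne hV ⟨D₀, hD₀⟩ => ?_⟩
  obtain ⟨D, hD, hcard⟩ := D₀.exists_small hD₀
  obtain ⟨P, hP⟩ := exists_calcsInc D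
  refine ⟨D, P, hD, fun M γ hM hinc ε hε O hO => ?_⟩
  obtain ⟨R, t, k, hex, hr, hk, ht⟩ := hP M γ hM hinc ε hε O hO
  have h1 : D.size ≤ (1 + Fintype.card G.Var) * V ^ (T + 1) := by
    refine (Finset.sum_le_card_nsmul _ _ _ fun i _ => card_setting_le hV (hD i)).trans ?_
    rw [Finset.card_univ, smul_eq_mul]
    exact Nat.mul_le_mul_right _ hcard
  have h2 : D.arcSize ≤ Fintype.card G.Arc * V ^ (T + 1) := by
    refine (Finset.sum_le_card_nsmul _ _ _ fun a _ => card_setting_le hV (hD (D.home a))).trans ?_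
    rw [Finset.card_univ, smul_eq_mul]
  have h1' : (D.size : ℝ) ≤ (1 + Fintype.card G.Var) * (V : ℝ) ^ (T + 1) := by exact_mod_cast h1
  have h2' : (D.arcSize : ℝ) ≤ Fintype.card G.Arc * (V : ℝ) ^ (T + 1) := by exact_mod_cast h2
  have h3 : (1 : ℝ) ≤ Fintype.card G.Var := by exact_mod_cast Fintype.card_pos
  have hV0 : (0 : ℝ) ≤ (V : ℝ) ^ (T + 1) := by positivity
  have h4 := mul_le_mul_of_nonneg_right h3 hV0
  have h5 : (0 : ℝ) ≤ Fintype.card G.Arc * (V : ℝ) ^ (T + 1) := by positivity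
  exact ⟨R, t, k, hex, hr, by linarith, by linarith⟩

end TreeDecomp
end

theorem mainTheorem6 :
    -- unconditional inference by comparing inconsistencies
    (∃ (P : Prog ℕ (ℕ × ℕ)) (C : ℝ), P.LogFree ∧
      ∀ (G : VarGraph) (M : PDG G) (γ : TradeOff), M.Cvx γ → M.inc γ.toReal ≠ ⊤ →
        ∃ μ : G.Dist, M.opt γ = {μ} ∧
          ∀ (Y : Finset G.Var) (y : G.Setting Y) (ε : ℝ), 0 < ε →
            ∀ O : Comparer, O.Correct →
              ∃ (R : ℕ → ℝ) (t k : ℕ),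
                Exec (compareCall O M γ Y y) P (initMem ε 0) R t k ∧
                |R 0 - μ.pr Y y| ≤ ε ∧
                (t : ℝ) ≤ C * Real.log (2 + 1 / ε) ∧
                (k : ℝ) ≤ C * Real.log (2 + 1 / ε)) ∧
    -- conditional inference by approximate inconsistency calculation
    (∃ (P : Prog ℕ (Bool × ℕ × ℕ)) (C : ℝ), P.LogFree ∧
      ∀ (G : VarGraph) (M : PDG G) (γ : ℝ), M.Cvx (.real γ) → M.inc γ ≠ ⊤ →
        ∃ μ : G.Dist, M.opt (.real γ) = {μ} ∧
          ∀ (X Y : Finset G.Var) (v : G.Setting (X ∪ Y)) (ε px : ℝ),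
            px = μ.pr X (v.sub Finset.subset_union_left) → 0 < px → 0 < ε →
            ∀ O : IncSolver, O.Correct →
              ∃ (R : ℕ → ℝ) (t k : ℕ),
                Exec (incCall O M γ X Y v) P (initMem ε γ) R t k ∧
                |R 0 - μ.condPr X Y v| ≤ ε ∧
                (t : ℝ) ≤
                  C * Real.log ((2 + |(M.inc γ).toReal|) / (min γ 1 * min ε 1 * px)) *
                    Real.log (2 / (min ε 1 * px)) ∧
                (k : ℝ) ≤ C * Real.log (2 / min ε 1) * Real.log (2 + Real.log (1 / px))) ∧
    -- approximate inconsistency calculation by inference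
    ((∃ C : ℝ, ∀ (G : VarGraph) (D : TreeDecomp G), ∃ P,
        CalcsInc D P (C * D.size) (C * (D.size + D.arcSize))) ∧
      ∀ T V : ℕ, ∃ C : ℝ, ∀ (G : VarGraph), Nonempty G.Var →
        (∀ x, Fintype.card (G.Val x) ≤ V) → (∃ D : TreeDecomp G, D.WidthLE T) →
        ∃ (D : TreeDecomp G) (P : _), D.WidthLE T ∧
          CalcsInc D P (C * Fintype.card G.Var)
            (C * (Fintype.card G.Var + Fintype.card G.Arc))) := by
  exact ⟨exists_searchProg, exists_inferProg, ⟨100, fun _ D => D.exists_calcsInc⟩,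
    TreeDecomp.exists_linear_calcsInc⟩
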